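/- Let $n\ge 1$, $p\ge 0$ be integers. For a nondegenerate open $n$-simplex $T\subset\mathbb R^n$ with vertices $z_0,\dots,z_n$ let $F_i$ be the face opposite to $z_i$, $\eta_{z_i}$ the barycentric coordinate of $z_i$, $h_T=\operatorname{diam}T$, and for $F=F_i$ put $d_F=\eta_{z_i}$, $\eta_F=\prod_{k\ne i}\eta_{z_k}$, $\eta_T=\prod_k\eta_{z_k}$. Write $P^q(S)$ for the polynomials of degree $\le q$ restricted to $S$, $P^q(\mathcal F_T)$ for the face-wise polynomials of degree $\le q$ on $\partial T$, $(\cdot,\cdot)_T$ and $\langle\cdot,\cdot\rangle_F$ for the $L^2$ inner products on $T$ and $F$, $\langle\cdot,\cdot\rangle_{\partial T}=\sum_F\langle\cdot,\cdot\rangle_F$, $|T|$, $|F|$ for volume and surface area, and $\Pi_T^0$ for the $L^2(T)$-orthogonal projection onto constants. Functions in $H^1(T)$ are evaluated on $\partial T$ as traces, and $\|v\|_{T,\alpha}=(\|v\|_T^2+\alpha^2\|\nabla v\|_T^2)^{1/2}$ (equivalent to $\|v\|_T+\alpha\|\nabla v\|_T$). Choose polynomials $\tilde\chi_{F,j}$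 of degree $\le p$ ($1\le j\le\dim P^p(F)$) such that the restrictions $\tilde\chi_{F,j}|_F$ form a basis of $P^p(F)$, for each face $F$, and a basis $\tilde\chi_{T,j}$ of $P^p(T)$ ($1\le j\le\dim P^p(T)$). We say that the choice is $M$-stable if $\|f\|_{L^\infty(T)}\le M\|f\|_{L^\infty(F)}$ for every face $F$ and every $f\in\operatorname{span}\{\tilde\chi_{F,j}\}_j$. For $\alpha>0$ set $$\eta_{F,j}=\eta_F\tilde\chi_{F,j},\qquad \eta_{\alpha,F,j}=e^{-h_Td_F/\alpha}\,\eta_F\tilde\chi_{F,j},\qquad \eta_{T,j}=\eta_T\tilde\chi_{T,j},$$ and let $\chi_{F,j}\in P^p(F)$ (extended by zero to the other faces) and $\chi_{T,j}\in P^p(T)$ satisfy $\langle\chi_{F,j},\eta_{F,k}\rangle_F=\delta_{jk}|F|$ and $(\chi_{T,j},\eta_{T,k})_T=\delta_{jk}|T|$. For $v\in H^1(T)$ define $$\tilde\Pi v=\Pi_T^0v+\sum_F\sum_j\frac{\langle\chi_{F,j},(1-\Pi_T^0)v\rangle_F}{\langle\chi_{F,j},\eta_{\alpha,F,j}\rangle_F}\,\eta_{\alpha,F,j},\qquad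 \Pi v=\tilde\Pi v+\sum_j\frac{(\chi_{T,j},(1-\tilde\Pi)v)_T}{(\chi_{T,j},\eta_{T,j})_T}\,\eta_{T,j}.$$ **Theorem.** (i) For every $T$ there is a $1$-stable choice of the $\tilde\chi_{F,j}$, $\tilde\chi_{T,j}$; every choice is $M$-stable for some $M$, and for every choice dual functions $\chi_{F,j}$, $\chi_{T,j}$ as above exist. (ii) For all $\gamma>0$, $\kappa$ and $M$ there is a constant $C>0$, depending only on $n,p,\gamma,\kappa,M$, such that the following holds for every simplex $T$ containing a ball of radius $h_T/\gamma$, every $\alpha$ with $0<\alpha\le\kappa h_T$ and every $M$-stable choice. The operator $\Pi$ is idempotent on $P^0(T)$, i.e. $\Pi v=v$ for $v\in P^0(T)$, and for all $v\in H^1(T)$ the function $\Pi v$ lies in $P^0(T)+\operatorname{span}\{\eta_{\alpha,F,j}\}+\operatorname{span}\{\eta_{T,j}\}$ and in $H^1(T)$, and $$\|\Pi v\|_{T,\alpha}\le C\,\|v\|_{T,\alpha},$$ $$\langle\sigma,v-\Pi v\rangle_{\partial T}=0\ \ \forall\sigma\in P^p(\mathcal F_T),\qquad (u,v-\Pi v)_T=0\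 \ \forall u\in P^p(T),\qquad (\boldsymbol\sigma,\nabla(v-\Pi v))_T=0\ \ \forall\boldsymbol\sigma\in P^p(T)^n.$$ -/

import Mathlib

open MeasureTheory Filter Topology
open scoped ContDiff

noncomputable section

namespace Fortin

/-- Euclidean space `ℝⁿ`. -/
abbrev Euc (n : ℕ) : Type := EuclideanSpace ℝ (Fin n)

/-- A nondegenerate `n`-simplex in `ℝⁿ`, given by its `n + 1` affinely independent vertices
`T 0, …, T n`.  The function `T.coord i` is the barycentric coordinate of the vertex `T i`, that is,
the affine function with value `1` at `T i` and `0` at the other vertices. -/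
abbrev Simplex (n : ℕ) : Type := AffineBasis (Fin (n + 1)) ℝ (Euc n)

section Geometry

variable {n : ℕ} (T : Simplex n)

/-- The open element: the interior of the convex hull of the vertices. -/
def elem : Set (Euc n) := interior (convexHull ℝ (Set.range T))

/-- The (closed) face opposite to the vertex `T i`. -/
def face (i : Fin (n + 1)) : Set (Euc n) := convexHull ℝ (T '' {i}ᶜ)

/-- The boundary of the element, the union of its `n + 1` faces. -/
def bdry : Set (Euc n) := ⋃ i, face T i

/-- The diameter `h_T`. -/
def size : ℝ := Metric.diam (elem T)

/-- Shape regularity with parameter `γ`: the element contains a ball of radius `h_T / γ`. -/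
def ShapeRegular (γ : ℝ) : Prop := ∃ x, Metric.ball x (size T / γ) ⊆ elem T

/-- The volume `|T|`. -/
def vol : ℝ := volume.real (elem T)

/-- The surface measure on hypersurfaces of `ℝⁿ` (the `(n-1)`-dimensional Hausdorff measure,
normalized to agree with Lebesgue measure on hyperplanes; counting measure for `n = 1`). -/
def surf (n : ℕ) : Measure (Euc n) := Measure.euclideanHausdorffMeasure (n - 1)

/-- The surface area `|F|` of the face opposite to `T i`. -/
def area (i : Fin (n + 1)) : ℝ := (surf n).real (face T i)

/-- The pairing `∫_F f g` on the face opposite to `T i`. -/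
def faceInner (i : Fin (n + 1)) (f g : Euc n → ℝ) : ℝ := ∫ x in face T i, f x * g x ∂(surf n)

/-- The pairing `∫_T f g`. -/
def elemInner (f g : Euc n → ℝ) : ℝ := ∫ x in elem T, f x * g x

/-- The norm of `L²(T)`, for functions with values in a normed space. -/
def l2norm {F : Type*} [NormedAddCommGroup F] (f : Euc n → F) : ℝ :=
  (eLpNorm f 2 (volume.restrict (elem T))).toReal

end Geometry

section Sobolev

variable {n : ℕ} (T : Simplex n)

/-- `g` is a weak gradient of `v` on the element. -/
def IsWeakGrad (v : Euc n → ℝ) (g : Euc n → Euc n) : Prop :=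
  ∀ φ : Euc n → ℝ, ContDiff ℝ ∞ φ → HasCompactSupport φ → tsupport φ ⊆ elem T →
    ∀ k : Fin n, ∫ x in elem T, v x * gradient φ x k = -∫ x in elem T, g x k * φ x

/-- `v ∈ L²(T)` has a weak gradient in `L²(T)ⁿ`. -/
def MemH1 (v : Euc n → ℝ) : Prop :=
  MemLp v 2 (volume.restrict (elem T)) ∧
    ∃ g, MemLp g 2 (volume.restrict (elem T)) ∧ IsWeakGrad T v g

open Classical in
/-- The weak gradient of `v` (unique almost everywhere); only used for `v ∈ H¹(T)`. -/
def weakGrad (v : Euc n → ℝ) : Euc n → Euc n :=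
  if h : ∃ g, MemLp g 2 (volume.restrict (elem T)) ∧ IsWeakGrad T v g then h.choose else 0

/-- `w ∈ L²(∂T)` is the trace of `v ∈ H¹(T)`: for some functions `φ k` that are continuously
differentiable up to the boundary, `φ k → v` in `H¹(T)` and `φ k → w` in `L²(∂T)`. -/
def IsTrace (v w : Euc n → ℝ) : Prop :=
  MemLp w 2 ((surf n).restrict (bdry T)) ∧
    ∃ φ : ℕ → Euc n → ℝ, (∀ k, ContDiff ℝ 1 (φ k)) ∧
      Tendsto (fun k => eLpNorm (fun x => φ k x - v x) 2 (volume.restrict (elem T)))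
        atTop (𝓝 0) ∧
      Tendsto (fun k => eLpNorm (fun x => gradient (φ k) x - weakGrad T v x) 2
        (volume.restrict (elem T))) atTop (𝓝 0) ∧
      Tendsto (fun k => eLpNorm (fun x => φ k x - w x) 2 ((surf n).restrict (bdry T)))
        atTop (𝓝 0)

open Classical in
/-- The trace of `v ∈ H¹(T)` on the boundary (unique almost everywhere). -/
def trace (v : Euc n → ℝ) : Euc n → ℝ :=
  if h : ∃ w, IsTrace T v w then h.choose else 0

/-- The norm `(‖v‖_T² + α² ‖∇v‖_T²)^(1/2)`. -/
def normα (α : ℝ) (v : Euc n → ℝ) : ℝ :=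
  Real.sqrt (l2norm T v ^ 2 + α ^ 2 * l2norm T (weakGrad T v) ^ 2)

end Sobolev

section Polynomials

/-- A polynomial in `n` variables as a function on `ℝⁿ`. -/
def evalPoly (n : ℕ) : MvPolynomial (Fin n) ℝ →ₗ[ℝ] (Euc n → ℝ) where
  toFun P x := MvPolynomial.eval (fun k => x k) P
  map_add' P Q := by ext x; simp
  map_smul' c P := by ext x; simp

/-- The polynomial functions on `ℝⁿ` of total degree at most `q`. -/
def polyFun (n q : ℕ) : Submodule ℝ (Euc n → ℝ) :=
  (MvPolynomial.restrictTotalDegree (Fin n) ℝ q).map (evalPoly n)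

/-- The space `P^q(S)` of restrictions to `S` of polynomials of degree at most `q`. -/
def polyOn {n : ℕ} (q : ℕ) (S : Set (Euc n)) : Submodule ℝ (S → ℝ) :=
  (polyFun n q).map (LinearMap.funLeft ℝ ℝ (Subtype.val : S → Euc n))

/-- `dim P^q(S)`. -/
def dimP {n : ℕ} (q : ℕ) (S : Set (Euc n)) : ℕ := Module.finrank ℝ (polyOn q S)

/-- The functions `b j` are polynomials of degree at most `q` whose restrictions to `S` form a
basis of `P^q(S)`. -/
def IsPolyBasis {n : ℕ} (q : ℕ) (S : Set (Euc n)) (b : Fin (dimP q S) → Euc n → ℝ) : Prop :=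
  (∀ j, b j ∈ polyFun n q) ∧
    LinearIndependent ℝ (fun j => S.domRestrict (b j)) ∧
    Submodule.span ℝ (Set.range fun j => S.domRestrict (b j)) = polyOn q S

end Polynomials

section Bubbles

variable {n : ℕ} (T : Simplex n)

/-- The face bubble `η_F`, `F` the face opposite to `T i`. -/
def faceBubble (i : Fin (n + 1)) (x : Euc n) : ℝ := ∏ k ∈ Finset.univ.erase i, T.coord k x

/-- The element bubble `η_T`. -/
def elemBubble (x : Euc n) : ℝ := ∏ k, T.coord k x

/-- The modified face bubble `η_{α,F} = exp(-h_T d_F / α) η_F`, where `d_F` is the barycentric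
coordinate of the vertex opposite to `F`. -/
def modFaceBubble (α : ℝ) (i : Fin (n + 1)) (x : Euc n) : ℝ :=
  Real.exp (-(size T * T.coord i x) / α) * faceBubble T i x

end Bubbles

/-- A choice of the functions `χ̃_{F,j}` and `χ̃_{T,j}`: polynomials of degree at most `p` such that
`χ̃_{F,j}|_F` is a basis of `P^p(F)` for every face `F`, and `χ̃_{T,j}` is a basis of `P^p(T)`. -/
structure PolyBases {n : ℕ} (T : Simplex n) (p : ℕ) where
  onFace : ∀ i : Fin (n + 1), Fin (dimP p (face T i)) → Euc n → ℝ
  onElem : Fin (dimP p (elem T)) → Euc n → ℝ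
  onFace_basis : ∀ i, IsPolyBasis p (face T i) (onFace i)
  onElem_basis : IsPolyBasis p (elem T) onElem

section Operators

variable {n : ℕ} {T : Simplex n} {p : ℕ}

/-- `‖f‖_{L^∞(T)} ≤ M ‖f‖_{L^∞(F)}` for every face `F` and every `f` in the span of the
functions `χ̃_{F,j}`. -/
def PolyBases.Stable (B : PolyBases T p) (M : ℝ) : Prop :=
  ∀ (i : Fin (n + 1)) (c : Fin (dimP p (face T i)) → ℝ) (b : ℝ),
    (∀ y ∈ face T i, |∑ j, c j * B.onFace i j y| ≤ b) →
      ∀ x ∈ elem T, |∑ j, c j * B.onFace i j x| ≤ M * b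

/-- The function `η_{F,j} = η_F χ̃_{F,j}`. -/
def PolyBases.etaF (B : PolyBases T p) (i : Fin (n + 1)) (j : Fin (dimP p (face T i)))
    (x : Euc n) : ℝ := faceBubble T i x * B.onFace i j x

/-- The function `η_{α,F,j} = η_{α,F} χ̃_{F,j}`. -/
def PolyBases.etaαF (B : PolyBases T p) (α : ℝ) (i : Fin (n + 1))
    (j : Fin (dimP p (face T i))) (x : Euc n) : ℝ := modFaceBubble T α i x * B.onFace i j x

/-- The function `η_{T,j} = η_T χ̃_{T,j}`. -/
def PolyBases.etaT (B : PolyBases T p) (j : Fin (dimP p (elem T))) (x : Euc n) : ℝ :=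
  elemBubble T x * B.onElem j x

/-- The dual functions `χ_{F,j}` and `χ_{T,j}`.  The function `χ_{F,j}` is a polynomial on the face
`F` and zero on the other faces; only its polynomial on `F` is recorded. -/
structure DualSystem (B : PolyBases T p) where
  onFace : ∀ i : Fin (n + 1), Fin (dimP p (face T i)) → Euc n → ℝ
  onElem : Fin (dimP p (elem T)) → Euc n → ℝ
  onFace_mem : ∀ i j, onFace i j ∈ polyFun n p
  onElem_mem : ∀ j, onElem j ∈ polyFun n p
  onFace_dual : ∀ i j k,
    faceInner T i (onFace i j) (B.etaF i k) = if j = k then area T i else 0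
  onElem_dual : ∀ j k, elemInner T (onElem j) (B.etaT k) = if j = k then vol T else 0

/-- The `L²(T)`-orthogonal projection onto constants. -/
def meanProj (T : Simplex n) (v : Euc n → ℝ) : Euc n → ℝ := fun _ => ⨍ x in elem T, v x

/-- The operator `v ↦ Π⁰v + ∑_F ∑_j ⟨χ_{F,j}, (1-Π⁰)v⟩_F / ⟨χ_{F,j}, η_{α,F,j}⟩_F · η_{α,F,j}`. -/
def preFortin (α : ℝ) (B : PolyBases T p) (D : DualSystem B) (v : Euc n → ℝ) : Euc n → ℝ :=
  meanProj T v + ∑ i, ∑ j,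
    (faceInner T i (D.onFace i j) (trace T (v - meanProj T v)) /
      faceInner T i (D.onFace i j) (B.etaαF α i j)) • B.etaαF α i j

/-- The Fortin operator: `preFortin` (written `Π̃` here) corrected by element bubbles,
`v ↦ Π̃v + ∑_j (χ_{T,j}, v - Π̃v)_T / (χ_{T,j}, η_{T,j})_T · η_{T,j}`. -/
def fortin (α : ℝ) (B : PolyBases T p) (D : DualSystem B) (v : Euc n → ℝ) : Euc n → ℝ :=
  preFortin α B D v + ∑ j,
    (elemInner T (D.onElem j) (v - preFortin α B D v) /
      elemInner T (D.onElem j) (B.etaT j)) • B.etaT j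

/-- The discrete space `P⁰(T) + span {η_{α,F,j}} + span {η_{T,j}}`. -/
def discreteSpace (α : ℝ) (B : PolyBases T p) : Submodule ℝ (Euc n → ℝ) :=
  polyFun n 0 ⊔ Submodule.span ℝ {f | ∃ i j, f = B.etaαF α i j} ⊔
    Submodule.span ℝ (Set.range B.etaT)

end Operators

end Fortin

end

open Fortin

namespace Fortin

/-! ### Convex geometry of the simplex -/

section Simplex

variable {n : ℕ} (T : Simplex n)

/-! Everything rests on one divergence identity. Write `n = m + 1` and let `F` be the face opposite
to the vertex `z_i`, at height `H`. The field `g(x)(x - z_i)` is tangential to the faces through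
`z_i` and has constant normal component `H` on `F`, so `∫_T (n g + ∇g·(x - z_i)) = H ∫_F g`
(`cone_identity`). Integration along rays from `z_i` proves it without normal vectors. With `g = φ²`
it is a multiplicative trace inequality (`face_sq_le`); with `g = exp(-β d_F)` it bounds the mass of
a boundary layer by a multiple of `|T|/β` (`setIntegral_exp_le`); with `g = qφ` it is an integration
by parts that recovers the face moments of a trace from `v` and `∇v` (`MemH1.faceInner_trace`).

Moments. By duality the correction on `F` is `η_{α,F} w`, where `w` in the span of the `χ̃_{F,j}`
satisfies `⟨q, η_F w⟩_F = ⟨q, (1 - Π⁰)v⟩_F` for all `q` in `P^p` (`DualSystem.faceInner_liftFace`).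
On `F` the exponential is one and the other face bubbles vanish, so the face moments come out right.
The element bubble vanishes on the boundary and repairs the element moments without disturbing them.
Subtracting the integration by parts formulas of two vertices leaves the derivative along the edge
between them, so the gradient moments vanish as well (`MemH1.integral_weakGrad_eq_zero`).

Bound. Testing with `q = w` gives `∫_F η_F w² = ⟨w, (1 - Π⁰)v⟩_F`. Norm equivalence for polynomials,
carried over affinely from a reference simplex, turns the left side into a sup norm, and the trace
inequality bounds the right side. With `v` in place of `(1 - Π⁰)v` the result is `|T| sup_F w² ≲
‖v‖² + h‖v‖‖∇v‖` (`exists_face_sup_bound`). Stability extends the sup bound to `T`, where the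
squared exponential has mass at most `(n + 1)(α/h)|T|`. The product is `≲ (α/h)‖v‖² + ‖v‖ α‖∇v‖`,
hence `≲ ‖v‖²_{T,α}`: the thin layer pays exactly for the trace, which is the robustness in `α`. A
gradient costs `1/α` from the exponential and `1/h ≤ κ/α` from the polynomial factor
(`exists_face_estimate`). Only `w` enters, not the bases, so the choice matters through `M` alone.

Traces are defined by approximation, so density of `C¹` functions in `H¹(T)` is needed as well. It
follows by contracting towards an interior point and then mollifying (`MemH1.exists_approx`). -/

theorem elem_eq : elem T = {x | ∀ i, 0 < T.coord i x} :=
  T.interior_convexHull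

theorem mem_elem {x : Euc n} : x ∈ elem T ↔ ∀ i, 0 < T.coord i x := by
  rw [elem_eq]; rfl

theorem mem_hull {x : Euc n} :
    x ∈ convexHull ℝ (Set.range T) ↔ ∀ i, 0 ≤ T.coord i x := by
  rw [T.convexHull_eq_nonneg_coord]; rfl

theorem isOpen_elem : IsOpen (elem T) := isOpen_interior

theorem measurableSet_elem : MeasurableSet (elem T) := (isOpen_elem T).measurableSet

theorem elem_subset_hull : elem T ⊆ convexHull ℝ (Set.range T) := interior_subset

theorem elem_nonempty : (elem T).Nonempty := ⟨_, AffineBasis.centroid_mem_interior_convexHull T⟩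

theorem convex_elem : Convex ℝ (elem T) := (convex_convexHull ℝ _).interior

theorem isCompact_hull : IsCompact (convexHull ℝ (Set.range T)) :=
  (Set.finite_range T).isCompact_convexHull (𝕜 := ℝ)

theorem closure_elem : closure (elem T) = convexHull ℝ (Set.range T) := by
  rw [elem, (convex_convexHull ℝ _).closure_interior_eq_closure_of_nonempty_interior
    (elem_nonempty T), (isCompact_hull T).isClosed.closure_eq]

theorem isBounded_elem : Bornology.IsBounded (elem T) :=
  (isCompact_hull T).isBounded.subset (elem_subset_hull T)

theorem vertex_mem_hull (i : Fin (n + 1)) : T i ∈ convexHull ℝ (Set.range T) :=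
  subset_convexHull ℝ _ ⟨i, rfl⟩

theorem volume_elem_lt_top : volume (elem T) < ⊤ := (isBounded_elem T).measure_lt_top

theorem volume_elem_pos : 0 < volume (elem T) :=
  (isOpen_elem T).measure_pos volume (elem_nonempty T)

theorem vol_pos : 0 < vol T :=
  ENNReal.toReal_pos (volume_elem_pos T).ne' (volume_elem_lt_top T).ne

instance isFiniteMeasure_restrict_elem : IsFiniteMeasure (volume.restrict (elem T)) :=
  ⟨by simpa using volume_elem_lt_top T⟩

/-- The frontier of a convex set is a null set. This is used to replace the closed faces, which
carry the surface measure, by open simplices. -/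
theorem hull_ae_eq_elem :
    (convexHull ℝ (Set.range T) : Set (Euc n)) =ᵐ[volume] elem T := by
  refine (ae_eq_of_subset_of_measure_ge (elem_subset_hull T) ?_
    (measurableSet_elem T).nullMeasurableSet (isCompact_hull T).measure_lt_top.ne).symm
  have h := (convex_convexHull ℝ (Set.range T)).addHaar_frontier volume
  calc volume (convexHull ℝ (Set.range T))
      ≤ volume (elem T ∪ frontier (convexHull ℝ (Set.range T))) := by
        refine measure_mono fun x hx => ?_
        by_cases hx' : x ∈ elem T
        · exact Or.inl hx'
        · exact Or.inr ⟨subset_closure hx, hx'⟩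
    _ ≤ volume (elem T) := by
        refine (measure_union_le _ _).trans ?_
        rw [h, add_zero]

theorem norm_sub_le_size {x y : Euc n} (hx : x ∈ convexHull ℝ (Set.range T))
    (hy : y ∈ convexHull ℝ (Set.range T)) : ‖x - y‖ ≤ size T := by
  rw [size, ← Metric.diam_closure, closure_elem, ← dist_eq_norm]
  exact Metric.dist_le_diam_of_mem (isCompact_hull T).isBounded hx hy

theorem size_nonneg : 0 ≤ size T := Metric.diam_nonneg

theorem size_pos (hn : 1 ≤ n) : 0 < size T := by
  have h : T (Fin.last n) ≠ T 0 := fun h => by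
    have h' := congrArg Fin.val (T.ind.injective h)
    simp only [Fin.val_last, Fin.val_zero] at h'
    omega
  exact (norm_pos_iff.2 (sub_ne_zero.2 h)).trans_le
    (norm_sub_le_size T (vertex_mem_hull T _) (vertex_mem_hull T _))

@[fun_prop]
theorem continuous_coord (i : Fin (n + 1)) : Continuous (T.coord i) :=
  (T.coord i).continuous_of_finiteDimensional

theorem coord_le_one {x : Euc n} (hx : x ∈ convexHull ℝ (Set.range T)) (i : Fin (n + 1)) :
    T.coord i x ≤ 1 := by
  rw [← T.sum_coord_apply_eq_one x]
  exact Finset.single_le_sum (f := fun i => T.coord i x) (fun k _ => (mem_hull T).1 hx k)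
    (Finset.mem_univ i)

theorem sum_coord_smul (x : Euc n) : ∑ k, T.coord k x • T k = x :=
  T.linear_combination_coord_eq_self x

theorem coord_lineMap (i : Fin (n + 1)) (x y : Euc n) (t : ℝ) :
    T.coord i (x + t • (y - x)) = T.coord i x + t * (T.coord i y - T.coord i x) := by
  have h : x + t • (y - x) = AffineMap.lineMap x y t := by
    simp [AffineMap.lineMap_apply, add_comm]
  rw [h, AffineMap.apply_lineMap, AffineMap.lineMap_apply]
  simp; ring

theorem coord_add_sub (i : Fin (n + 1)) (x y z : Euc n) :
    T.coord i (x + (y - z)) = T.coord i x + (T.coord i y - T.coord i z) := by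
  have h1 := (T.coord i).map_vadd x (y - z)
  have h2 := (T.coord i).linearMap_vsub y z
  simp only [vadd_eq_add, vsub_eq_sub] at h1 h2
  rw [add_comm x, h1, h2]; ring

end Simplex

/-! ### Isometric charts of the faces and the surface measure -/

section Chart

variable {m : ℕ} (T : Simplex (m + 1)) (i : Fin (m + 2))

/-- An orthonormal basis of the direction space of the face provides the chart. It has to be an
isometry, not just an affine parametrization, so that surface measure becomes Lebesgue measure;
integrals over a face are then integrals over an `m`-simplex, also for `m = 0`. -/
theorem exists_faceChart : ∃ (A : Euc m →ᵃⁱ[ℝ] Euc (m + 1)) (F : Simplex m),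
    ∀ k, A (F k) = T (i.succAbove k) := by
  classical
  set q : Fin (m + 1) → Euc (m + 1) := fun k => T (i.succAbove k) with hq
  have hind : AffineIndependent ℝ q :=
    T.ind.comp_embedding ⟨i.succAbove, Fin.succAbove_right_injective⟩
  set W := vectorSpan ℝ (Set.range q)
  have hW : Module.finrank ℝ W = m := hind.finrank_vectorSpan (by simp)
  let e : W ≃ₗᵢ[ℝ] Euc m := ((stdOrthonormalBasis ℝ W).reindex (finCongr hW)).repr
  let L : Euc m →ₗᵢ[ℝ] Euc (m + 1) := W.subtypeₗᵢ.comp e.symm.toLinearIsometry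
  let A : Euc m →ᵃⁱ[ℝ] Euc (m + 1) :=
    { toFun := fun y => L y + q 0
      linear := L.toLinearMap
      map_vadd' := fun p v => by simp [add_assoc]
      norm_map := fun x => by simp }
  have hA : ∀ k, ∃ y, A y = q k := fun k => by
    have hk : q k - q 0 ∈ W := vsub_mem_vectorSpan ℝ ⟨k, rfl⟩ ⟨0, rfl⟩
    refine ⟨e ⟨q k - q 0, hk⟩, ?_⟩
    change (W.subtypeₗᵢ (e.symm (e ⟨q k - q 0, hk⟩))) + q 0 = q k
    simp
  choose y hy using hA
  have hy' : AffineIndependent ℝ y := by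
    refine AffineIndependent.of_comp A.toAffineMap ?_
    have h : (A.toAffineMap : Euc m → Euc (m + 1)) ∘ y = q := funext hy
    rw [h]; exact hind
  exact ⟨A, ⟨y, hy', hy'.affineSpan_eq_top_iff_card_eq_finrank_add_one.2 (by simp)⟩, hy⟩

/-- An isometric parametrization of the hyperplane containing the face opposite to `T i`. -/
noncomputable def faceChart : Euc m →ᵃⁱ[ℝ] Euc (m + 1) := (exists_faceChart T i).choose

/-- The face opposite to `T i`, as a simplex of lower dimension. -/
noncomputable def faceSimplex : Simplex m := (exists_faceChart T i).choose_spec.choose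

theorem faceChart_vertex (k : Fin (m + 1)) :
    faceChart T i (faceSimplex T i k) = T (i.succAbove k) :=
  (exists_faceChart T i).choose_spec.choose_spec k

@[fun_prop]
theorem continuous_faceChart : Continuous (faceChart T i) := (faceChart T i).continuous

theorem faceChart_eq_sum (y : Euc m) :
    faceChart T i y = ∑ k, (faceSimplex T i).coord k y • T (i.succAbove k) := by
  have h := (faceSimplex T i).affineCombination_coord_eq_self y
  conv_lhs => rw [← h]
  change (faceChart T i).toAffineMap _ = _
  rw [Finset.map_affineCombination _ _ _ ((faceSimplex T i).sum_coord_apply_eq_one y),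
    Finset.affineCombination_eq_linear_combination _ _ _
      ((faceSimplex T i).sum_coord_apply_eq_one y)]
  exact Finset.sum_congr rfl fun k _ => by rw [← faceChart_vertex]; rfl

theorem coord_sum_smul {n : ℕ} (T : Simplex n) {ι : Type*} (s : Finset ι) (w : ι → ℝ)
    (hw : ∑ k ∈ s, w k = 1) (q : ι → Euc n) (j : Fin (n + 1)) :
    T.coord j (∑ k ∈ s, w k • q k) = ∑ k ∈ s, w k * T.coord j (q k) := by
  rw [← Finset.affineCombination_eq_linear_combination _ _ _ hw,
    Finset.map_affineCombination _ _ _ hw, Finset.affineCombination_eq_linear_combination _ _ _ hw]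
  rfl

theorem coord_faceChart_self (y : Euc m) : T.coord i (faceChart T i y) = 0 := by
  rw [faceChart_eq_sum, coord_sum_smul T _ _ ((faceSimplex T i).sum_coord_apply_eq_one y)]
  exact Finset.sum_eq_zero fun k _ => by
    rw [T.coord_apply_ne (Fin.succAbove_ne i k).symm, mul_zero]

theorem coord_faceChart_succAbove (y : Euc m) (k : Fin (m + 1)) :
    T.coord (i.succAbove k) (faceChart T i y) = (faceSimplex T i).coord k y := by
  classical
  rw [faceChart_eq_sum, coord_sum_smul T _ _ ((faceSimplex T i).sum_coord_apply_eq_one y)]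
  simp [AffineBasis.coord_apply]

theorem face_eq_image :
    face T i = faceChart T i '' convexHull ℝ (Set.range (faceSimplex T i)) := by
  have h := (faceChart T i).toAffineMap.image_convexHull (Set.range (faceSimplex T i))
  change faceChart T i '' _ = _ at h
  rw [h, face]
  congr 1
  ext x
  constructor
  · rintro ⟨k, hk, rfl⟩
    obtain ⟨l, rfl⟩ := Fin.exists_succAbove_eq (x := k) (y := i) hk
    exact ⟨_, ⟨l, rfl⟩, faceChart_vertex T i l⟩
  · rintro ⟨_, ⟨l, rfl⟩, rfl⟩
    exact ⟨i.succAbove l, Fin.succAbove_ne i l, (faceChart_vertex T i l).symm⟩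

theorem face_subset_hull : face T i ⊆ convexHull ℝ (Set.range T) :=
  convexHull_mono (Set.image_subset_range _ _)

theorem isCompact_face : IsCompact (face T i) := by
  rw [face_eq_image]
  exact (isCompact_hull _).image (continuous_faceChart T i)

theorem measurableSet_face : MeasurableSet (face T i) := (isCompact_face T i).measurableSet

theorem faceChart_mem_face {y : Euc m} (hy : y ∈ elem (faceSimplex T i)) :
    faceChart T i y ∈ face T i := by
  rw [face_eq_image]; exact ⟨y, elem_subset_hull _ hy, rfl⟩

theorem measurableEmbedding_faceChart : MeasurableEmbedding (faceChart T i) :=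
  (faceChart T i).isometry.isClosedEmbedding.measurableEmbedding

/-- Isometries preserve Hausdorff measure, and the normalized `m`-dimensional one is Lebesgue
measure on `ℝᵐ`. -/
theorem surf_restrict_face : (surf (m + 1)).restrict (face T i) =
    (volume.restrict (elem (faceSimplex T i))).map (faceChart T i) := by
  have h : (volume : Measure (Euc m)).map (faceChart T i) =
      (surf (m + 1)).restrict (Set.range (faceChart T i)) := by
    rw [← EuclideanSpace.euclideanHausdorffMeasure_eq_volume]
    exact (faceChart T i).isometry.map_euclideanHausdorffMeasure
  rw [← Measure.restrict_congr_set (hull_ae_eq_elem _), face_eq_image]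
  have h2 := (measurableEmbedding_faceChart T i).restrict_map volume
    (faceChart T i '' convexHull ℝ (Set.range (faceSimplex T i)))
  rw [Set.preimage_image_eq _ (faceChart T i).injective, h,
    Measure.restrict_restrict_of_subset (Set.image_subset_range _ _)] at h2
  exact h2

theorem setIntegral_face (f : Euc (m + 1) → ℝ) :
    ∫ x in face T i, f x ∂(surf (m + 1)) =
      ∫ y in elem (faceSimplex T i), f (faceChart T i y) := by
  rw [surf_restrict_face, (measurableEmbedding_faceChart T i).integral_map]

theorem area_eq : area T i = vol (faceSimplex T i) := by
  have h := congrArg (fun μ => μ Set.univ) (surf_restrict_face T i)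
  simp only [Measure.restrict_apply_univ,
    Measure.map_apply (continuous_faceChart T i).measurable MeasurableSet.univ,
    Set.preimage_univ] at h
  rw [area, vol, Measure.real, Measure.real, h]

theorem area_pos : 0 < area T i := by rw [area_eq]; exact vol_pos _

instance isFiniteMeasure_restrict_face :
    IsFiniteMeasure ((surf (m + 1)).restrict (face T i)) := by
  rw [surf_restrict_face]; infer_instance

theorem face_subset_bdry : face T i ⊆ bdry T := Set.subset_iUnion (face T) i

theorem bdry_subset_hull : bdry T ⊆ convexHull ℝ (Set.range T) :=
  Set.iUnion_subset fun i => face_subset_hull T i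

/-- Subadditivity is enough for all estimates on the boundary, so the overlaps of the faces need not
be shown to be null. -/
theorem restrict_bdry_le :
    (surf (m + 1)).restrict (bdry T) ≤ ∑ i, (surf (m + 1)).restrict (face T i) := by
  rw [← Measure.sum_fintype]
  exact Measure.restrict_iUnion_le

instance isFiniteMeasure_restrict_bdry :
    IsFiniteMeasure ((surf (m + 1)).restrict (bdry T)) :=
  isFiniteMeasure_of_le _ (restrict_bdry_le T)

end Chart

/-! ### Integrability on the element and linear parts of barycentric coordinates -/

theorem _root_.Continuous.integrableOn_elem {n : ℕ} {E : Type*} [NormedAddCommGroup E]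
    {f : Euc n → E} (hf : Continuous f) (T : Simplex n) : IntegrableOn f (elem T) :=
  (hf.continuousOn.integrableOn_compact (isCompact_hull T)).mono_set (elem_subset_hull T)

theorem coord_lt_one {m : ℕ} (T : Simplex (m + 1)) {x : Euc (m + 1)} (hx : x ∈ elem T)
    (i : Fin (m + 2)) : T.coord i x < 1 := by
  have h := T.sum_coord_apply_eq_one x
  rw [Fin.sum_univ_succAbove _ i] at h
  have : 0 < ∑ k, T.coord (i.succAbove k) x :=
    Finset.sum_pos (fun k _ => (mem_elem T).1 hx _) Finset.univ_nonempty
  linarith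

/-- The linear part of a barycentric coordinate. -/
noncomputable def coordL {n : ℕ} (T : Simplex n) (i : Fin (n + 1)) : Euc n →L[ℝ] ℝ :=
  LinearMap.toContinuousLinearMap (T.coord i).linear

theorem coordL_sub {n : ℕ} (T : Simplex n) (i : Fin (n + 1)) (x y : Euc n) :
    coordL T i (x - y) = T.coord i x - T.coord i y :=
  (T.coord i).linearMap_vsub x y

theorem coord_eq_coordL_add {n : ℕ} (T : Simplex n) (i : Fin (n + 1)) :
    (T.coord i : Euc n → ℝ) = fun x => coordL T i x + T.coord i 0 := by
  funext x
  have := coordL_sub T i x 0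
  rw [sub_zero] at this
  rw [this]; ring

theorem hasFDerivAt_coord {n : ℕ} (T : Simplex n) (i : Fin (n + 1)) (x : Euc n) :
    HasFDerivAt (T.coord i) (coordL T i) x := by
  rw [coord_eq_coordL_add]
  exact (coordL T i).hasFDerivAt.add_const _

theorem contDiff_coord {n : ℕ} {r : WithTop ℕ∞} (T : Simplex n) (i : Fin (n + 1)) :
    ContDiff ℝ r (T.coord i) := by
  rw [coord_eq_coordL_add]
  exact (coordL T i).contDiff.add contDiff_const

/-! ### The cone identity and the mass of the boundary layer -/

section Cone

variable {m : ℕ} (T : Simplex (m + 1)) (i : Fin (m + 2))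

theorem coord_cone_self (y : Euc m) (t : ℝ) :
    T.coord i (T i + t • (faceChart T i y - T i)) = 1 - t := by
  rw [coord_lineMap, T.coord_apply_eq, coord_faceChart_self]; ring

theorem coord_cone_succAbove (y : Euc m) (t : ℝ) (k : Fin (m + 1)) :
    T.coord (i.succAbove k) (T i + t • (faceChart T i y - T i)) =
      t * (faceSimplex T i).coord k y := by
  rw [coord_lineMap, T.coord_apply_ne (Fin.succAbove_ne i k), coord_faceChart_succAbove]; ring

theorem cone_mem_elem {t : ℝ} (ht : t ∈ Set.Ioo (0 : ℝ) 1) (y : Euc m) :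
    T i + t • (faceChart T i y - T i) ∈ elem T ↔ y ∈ elem (faceSimplex T i) := by
  rw [mem_elem, mem_elem, Fin.forall_iff_succAbove i]
  simp only [coord_cone_self, coord_cone_succAbove, sub_pos, ht.2, true_and,
    mul_pos_iff_of_pos_left ht.1]

/-- Affine coordinates adapted to the vertex `T i` and the opposite face. -/
theorem exists_coneEquiv : ∃ Ψ : (ℝ × Euc m) ≃L[ℝ] Euc (m + 1), ∀ s y,
    Ψ (s, y) = s • (T i - faceChart T i 0) + (faceChart T i y - faceChart T i 0) := by
  let L : (ℝ × Euc m) →ₗ[ℝ] Euc (m + 1) :=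
    (LinearMap.toSpanSingleton ℝ _ (T i - faceChart T i 0)).coprod
      (faceChart T i).toAffineMap.linear
  have hL : ∀ s y, L (s, y) =
      s • (T i - faceChart T i 0) + (faceChart T i y - faceChart T i 0) := fun s y => by
    have h := (faceChart T i).toAffineMap.linearMap_vsub y 0
    simp only [vsub_eq_sub, sub_zero] at h
    simp only [L, LinearMap.coprod_apply, LinearMap.toSpanSingleton_apply, h]
    rfl
  have hinj : Function.Injective L := by
    rw [← LinearMap.ker_eq_bot, LinearMap.ker_eq_bot']
    rintro ⟨s, y⟩ h
    have h1 : T.coord i (faceChart T i 0 + L (s, y)) = s := by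
      have h2 : faceChart T i 0 + L (s, y) = (faceChart T i 0 + s • (T i - faceChart T i 0)) +
          (faceChart T i y - faceChart T i 0) := by rw [hL]; abel
      rw [h2, coord_add_sub, coord_lineMap, T.coord_apply_eq, coord_faceChart_self,
        coord_faceChart_self]
      ring
    rw [h, add_zero, coord_faceChart_self] at h1
    subst h1
    rw [hL, zero_smul, zero_add, sub_eq_zero] at h
    rw [(faceChart T i).injective h]; rfl
  exact ⟨(LinearEquiv.ofInjectiveOfFinrankEq L hinj (by simp [add_comm])).toContinuousLinearEquiv,
    hL⟩

/-- Fubini on slices parallel to the face: the slice on which the apex has barycentric coordinate `1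
- t` is the face scaled by `t`, whence the weight `t ^ m`. Uniqueness of Haar measure yields the
change of variables only up to a factor, which is left unspecified here and found in
`cone_identity`. -/
theorem exists_setIntegral_elem_eq : ∃ c : ℝ, ∀ f : Euc (m + 1) → ℝ, IntegrableOn f (elem T) →
    ∫ x in elem T, f x = c * ∫ t in Set.Ioo (0 : ℝ) 1,
      t ^ m * ∫ y in elem (faceSimplex T i), f (T i + t • (faceChart T i y - T i)) := by
  obtain ⟨Ψ, hΨ⟩ := exists_coneEquiv T i
  set ν : Measure (Euc (m + 1)) := (volume : Measure (ℝ × Euc m)).map Ψ with hν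
  have hvH : (volume : Measure (ℝ × Euc m)).IsAddHaarMeasure :=
    Measure.prod.instIsAddHaarMeasure volume volume
  have hνH : ν.IsAddHaarMeasure := Ψ.isAddHaarMeasure_map volume
  set k := Measure.addHaarScalarFactor (volume : Measure (Euc (m + 1))) ν
  have hk : (volume : Measure (Euc (m + 1))) = k • ν :=
    Measure.isAddLeftInvariant_eq_smul _ _
  have hk0 : k ≠ 0 := fun h => by
    have := volume_elem_pos T
    rw [hk, h] at this; simp at this
  refine ⟨k, fun f hf => ?_⟩
  set a := faceChart T i 0
  set G : Euc (m + 1) → ℝ := fun x => (elem T).indicator f (x + a) with hG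
  have hGi : Integrable G := by
    have := (integrable_indicator_iff (measurableSet_elem T)).2 hf
    exact this.comp_add_right a
  have hΨe : MeasurableEmbedding Ψ := Ψ.toHomeomorph.measurableEmbedding
  have hGi' : Integrable (fun w => G (Ψ w)) (volume : Measure (ℝ × Euc m)) := by
    rw [hk] at hGi
    have h1 : Integrable G ν := by
      have h2 := hGi.smul_measure_nnreal (c := k⁻¹)
      rwa [smul_smul, inv_mul_cancel₀ hk0, one_smul] at h2
    rwa [hν, hΨe.integrable_map_iff] at h1
  have h1 : ∫ x in elem T, f x = k * ∫ w, G (Ψ w) := by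
    rw [← integral_indicator (measurableSet_elem T), ← integral_add_right_eq_self _ a]
    change ∫ x, G x = _
    rw [hk, integral_smul_nnreal_measure, hν, hΨe.integral_map]
    rfl
  -- Rescaling `y` inside the slice turns the linear coordinates into rays from the apex.
  have hcone : ∀ t (y : Euc m), Ψ (1 - t, t • y) + a = T i + t • (faceChart T i y - T i) := by
    intro t y
    have h := (faceChart T i).toAffineMap.linearMap_vsub (t • y) 0
    have h' := (faceChart T i).toAffineMap.linearMap_vsub y 0
    simp only [vsub_eq_sub, sub_zero, map_smul] at h h'
    rw [h'] at h
    rw [hΨ]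
    have h2 : faceChart T i (t • y) - a = t • (faceChart T i y - a) := h.symm
    rw [h2]; module
  have hcoord : ∀ s y, T.coord i (Ψ (s, y) + a) = s := by
    intro s y
    have h2 : Ψ (s, y) + a = (a + s • (T i - a)) + (faceChart T i y - a) := by
      rw [hΨ]; abel
    rw [h2, coord_add_sub, coord_lineMap, T.coord_apply_eq, coord_faceChart_self,
      coord_faceChart_self]
    ring
  rw [h1]
  congr 1
  have h3 : ∫ w, G (Ψ w) = ∫ s, ∫ y, G (Ψ (s, y)) := integral_prod _ hGi'
  have h4 : ∀ s, (∫ y, G (Ψ (s, y))) = (Set.Ioo (0 : ℝ) 1).indicator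
      (fun s => (1 - s) ^ m * ∫ y in elem (faceSimplex T i),
        f (T i + (1 - s) • (faceChart T i y - T i))) s := by
    intro s
    by_cases hs : s ∈ Set.Ioo (0 : ℝ) 1
    · rw [Set.indicator_of_mem hs]
      have ht : (1 - s) ∈ Set.Ioo (0 : ℝ) 1 := ⟨by linarith [hs.2], by linarith [hs.1]⟩
      have h5 := Measure.integral_comp_smul (volume : Measure (Euc m)) (fun y => G (Ψ (s, y)))
        (1 - s)
      have hp : 0 < (1 - s) ^ m := pow_pos ht.1 m
      rw [finrank_euclideanSpace_fin, abs_of_pos (inv_pos.2 hp), smul_eq_mul] at h5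
      rw [← integral_indicator (measurableSet_elem _)]
      have h6 : (fun y => G (Ψ (s, (1 - s) • y))) = (elem (faceSimplex T i)).indicator
          (fun y => f (T i + (1 - s) • (faceChart T i y - T i))) := by
        funext y
        have h7 := hcone (1 - s) y
        rw [sub_sub_cancel] at h7
        have h8 := cone_mem_elem T i ht y
        by_cases hy : y ∈ elem (faceSimplex T i)
        · simp only [hG, h7, Set.indicator_of_mem hy, Set.indicator_of_mem (h8.2 hy)]
        · simp only [hG, h7, Set.indicator_of_notMem hy, Set.indicator_of_notMem (mt h8.1 hy)]
      rw [← h6, h5, ← mul_assoc, mul_inv_cancel₀ hp.ne', one_mul]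
    -- A slice with `s` outside the unit interval misses the open simplex.
    · rw [Set.indicator_of_notMem hs]
      refine integral_eq_zero_of_ae (Eventually.of_forall fun y => ?_)
      refine Set.indicator_of_notMem (fun hy => hs ?_) _
      exact ⟨hcoord s y ▸ (mem_elem T).1 hy i, hcoord s y ▸ coord_lt_one T hy i⟩
  rw [h3]
  simp_rw [h4]
  rw [integral_indicator measurableSet_Ioo, ← integral_Ioc_eq_integral_Ioo,
    ← intervalIntegral.integral_of_le zero_le_one, ← integral_Ioc_eq_integral_Ioo,
    ← intervalIntegral.integral_of_le zero_le_one]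
  have := intervalIntegral.integral_comp_sub_left (a := 0) (b := 1)
    (fun t => t ^ m * ∫ y in elem (faceSimplex T i), f (T i + t • (faceChart T i y - T i))) 1
  simpa using this

/-- The integrand is the derivative of `t ^ (m + 1) * g (z + t • e)`, which vanishes at `t = 0`. -/
theorem integral_radial_deriv {g : Euc (m + 1) → ℝ} (hg : ContDiff ℝ 1 g) (z e : Euc (m + 1)) :
    ∫ t in Set.Ioo (0 : ℝ) 1, t ^ m * ((m + 1 : ℝ) * g (z + t • e) +
      fderiv ℝ g (z + t • e) (t • e)) = g (z + e) := by
  rw [← integral_Ioc_eq_integral_Ioo, ← intervalIntegral.integral_of_le zero_le_one]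
  have hd : ∀ t : ℝ, HasDerivAt (fun t : ℝ => t ^ (m + 1) * g (z + t • e))
      (t ^ m * ((m + 1 : ℝ) * g (z + t • e) + fderiv ℝ g (z + t • e) (t • e))) t := fun t => by
    have h1 : HasDerivAt (fun t : ℝ => z + t • e) e t := by
      simpa using ((hasDerivAt_id t).smul_const e).const_add z
    have h2 := (hg.differentiable one_ne_zero (z + t • e)).hasFDerivAt.comp_hasDerivAt t h1
    refine ((hasDerivAt_pow (m + 1) t).mul h2).congr_deriv ?_
    simp only [map_smul, smul_eq_mul, Function.comp, Nat.cast_add, Nat.cast_one,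
      Nat.add_sub_cancel]
    ring
  have hc : Continuous fun t : ℝ => t ^ m * ((m + 1 : ℝ) * g (z + t • e) +
      fderiv ℝ g (z + t • e) (t • e)) := by
    have := hg.continuous
    have := hg.continuous_fderiv one_ne_zero
    fun_prop
  rw [intervalIntegral.integral_eq_sub_of_hasDerivAt (fun t _ => hd t)
    (hc.intervalIntegrable 0 1)]
  simp

/-- This is the divergence theorem for `g(x)(x - z_i)`. In cone coordinates the order of integration
is exchanged, and along each ray the integrand is an exact derivative. -/
theorem exists_cone_identity : ∃ c : ℝ, ∀ g : Euc (m + 1) → ℝ, ContDiff ℝ 1 g →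
    ∫ x in elem T, ((m + 1 : ℝ) * g x + fderiv ℝ g x (x - T i)) =
      c * ∫ x in face T i, g x ∂(surf (m + 1)) := by
  obtain ⟨c, hc⟩ := exists_setIntegral_elem_eq T i
  refine ⟨c, fun g hg => ?_⟩
  have hgc := hg.continuous
  have hgd := hg.continuous_fderiv one_ne_zero
  have hf : Continuous fun x => (m + 1 : ℝ) * g x + fderiv ℝ g x (x - T i) := by fun_prop
  rw [hc _ (hf.integrableOn_elem T), setIntegral_face]
  congr 1
  simp only [add_sub_cancel_left]
  simp_rw [← integral_const_mul]
  rw [integral_integral_swap]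
  · refine integral_congr_ae (Eventually.of_forall fun y => ?_)
    simp only [integral_radial_deriv hg]
    congr 1; abel
  · rw [Measure.prod_restrict]
    have hQ : Continuous (Function.uncurry fun (t : ℝ) (y : Euc m) =>
        t ^ m * ((m + 1 : ℝ) * g (T i + t • (faceChart T i y - T i)) +
          fderiv ℝ g (T i + t • (faceChart T i y - T i)) (t • (faceChart T i y - T i)))) := by
      unfold Function.uncurry
      fun_prop
    refine (hQ.continuousOn.integrableOn_compact
      ((isCompact_Icc (a := (0 : ℝ)) (b := 1)).prod (isCompact_hull (faceSimplex T i)))).mono_set ?_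
    exact Set.prod_mono Set.Ioo_subset_Icc_self (elem_subset_hull _)

/-- Integration over the cone with apex `T i` and base the opposite face. -/
theorem cone_identity {g : Euc (m + 1) → ℝ} (hg : ContDiff ℝ 1 g) :
    ∫ x in elem T, ((m + 1 : ℝ) * g x + fderiv ℝ g x (x - T i)) =
      (m + 1) * vol T / area T i * ∫ x in face T i, g x ∂(surf (m + 1)) := by
  obtain ⟨c, hc⟩ := exists_cone_identity T i
  rw [hc g hg]
  -- The choice `g = 1` gives `(m + 1)|T| = c|F|` and so determines the factor.
  have h := hc (fun _ => 1) contDiff_const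
  simp only [fderiv_fun_const, Pi.zero_apply, zero_apply, add_zero, mul_one,
    integral_const, smul_eq_mul, measureReal_restrict_apply_univ] at h
  change vol T * _ = c * area T i at h
  congr 1
  have := (area_pos T i).ne'
  field_simp
  linarith

/-- Let `d` be the barycentric coordinate and `g = exp(-β d)`. Since `g = 1` on the face, the cone
identity evaluates the integral of `(m + 1) g + β (1 - d) g` as `(m + 1)|T|`. This integrand
dominates `β g / 2` where `d ≤ 1/2`; where `d ≥ 1/2`, already `β g ≤ 2` because `s exp(-s) ≤ 1`. The
extra summand `1` in the pointwise bound covers the second case. -/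
theorem setIntegral_exp_le {β : ℝ} (hβ : 0 < β) :
    ∫ x in elem T, Real.exp (-(β * T.coord i x)) ≤ 2 * (m + 2) / β * vol T := by
  set g : Euc (m + 1) → ℝ := fun x => Real.exp (-(β * T.coord i x)) with hgdef
  have hg : ContDiff ℝ 1 g := (contDiff_const.mul (contDiff_coord T i)).neg.exp
  have hfd : ∀ x, fderiv ℝ g x (x - T i) = β * (1 - T.coord i x) * g x := fun x => by
    have h2 : HasFDerivAt g _ x := (((hasFDerivAt_coord T i x).const_mul β).neg).exp
    rw [h2.fderiv]
    have h3 : coordL T i (x - T i) = T.coord i x - 1 := by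
      rw [coordL_sub, T.coord_apply_eq i]
    simp only [smul_apply, neg_apply, h3, smul_eq_mul, Pi.neg_apply, g]
    ring
  have hid := cone_identity T i hg
  have hface : ∫ x in face T i, g x ∂(surf (m + 1)) = area T i := by
    rw [setIntegral_face]
    simp only [g, coord_faceChart_self, mul_zero, neg_zero, Real.exp_zero, integral_const,
      smul_eq_mul, mul_one, measureReal_restrict_apply_univ]
    rw [area_eq]; rfl
  rw [hface, div_mul_cancel₀ _ (area_pos T i).ne'] at hid
  simp_rw [hfd] at hid
  have hgc := hg.continuous
  have hI : Continuous fun x => (m + 1 : ℝ) * g x + β * (1 - T.coord i x) * g x := by fun_prop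
  have hle : ∫ x in elem T, g x ≤ ∫ x in elem T, (2 / β) *
      (((m + 1 : ℝ) * g x + β * (1 - T.coord i x) * g x) + 1) := by
    refine setIntegral_mono_on (hgc.integrableOn_elem T) ?_ (measurableSet_elem T) fun x hx => ?_
    · exact (Continuous.integrableOn_elem (by fun_prop) T)
    · have h0 := (mem_elem T).1 hx i
      have h1 := coord_lt_one T hx i
      have hgp : 0 < g x := Real.exp_pos _
      have hm : (0 : ℝ) ≤ m := Nat.cast_nonneg m
      rw [div_mul_eq_mul_div, le_div_iff₀ hβ]
      rcases le_total (T.coord i x) (1 / 2) with h | h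
      · have : g x * (1 / 2) ≤ g x * (1 - T.coord i x) :=
          mul_le_mul_of_nonneg_left (by linarith) hgp.le
        nlinarith [mul_nonneg hm hgp.le]
      · have h2 : g x * (β * T.coord i x) ≤ 1 := by
          have h3 : β * T.coord i x ≤ Real.exp (β * T.coord i x) := by
            linarith [Real.add_one_le_exp (β * T.coord i x)]
          calc g x * (β * T.coord i x) ≤ g x * Real.exp (β * T.coord i x) :=
                mul_le_mul_of_nonneg_left h3 hgp.le
            _ = 1 := by rw [hgdef, ← Real.exp_add]; simp
        have h4 : g x * β * (1 / 2) ≤ g x * β * T.coord i x :=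
          mul_le_mul_of_nonneg_left h (by positivity)
        have h5 : 0 ≤ β * (1 - T.coord i x) * g x :=
          mul_nonneg (mul_nonneg hβ.le (by linarith)) hgp.le
        nlinarith [mul_nonneg hm hgp.le]
  refine hle.trans_eq ?_
  rw [integral_const_mul, integral_add (hI.integrableOn_elem T)
    (continuous_const.integrableOn_elem T), hid]
  simp only [integral_const, smul_eq_mul, mul_one, measureReal_restrict_apply_univ]
  change 2 / β * ((m + 1) * vol T + vol T) = _
  ring

end Cone

/-! ### Polynomial functions -/

section PolyFun

variable {n m q r : ℕ}

theorem mem_polyFun {f : Euc n → ℝ} :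
    f ∈ polyFun n q ↔ ∃ P : MvPolynomial (Fin n) ℝ, P.totalDegree ≤ q ∧
      f = fun x => MvPolynomial.eval (fun k => x k) P := by
  simp only [polyFun, Submodule.mem_map, MvPolynomial.mem_restrictTotalDegree, eq_comm (a := f)]
  rfl

instance finiteDimensional_polyFun : FiniteDimensional ℝ (polyFun n q) := by
  unfold polyFun; infer_instance

instance finiteDimensional_polyOn (S : Set (Euc n)) : FiniteDimensional ℝ (polyOn q S) := by
  unfold polyOn; infer_instance

theorem polyFun_mono (h : q ≤ r) : polyFun n q ≤ polyFun n r := fun f hf => by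
  obtain ⟨P, hP, rfl⟩ := mem_polyFun.1 hf
  exact mem_polyFun.2 ⟨P, hP.trans h, rfl⟩

theorem const_mem_polyFun (c : ℝ) : (fun _ => c) ∈ polyFun n q :=
  mem_polyFun.2 ⟨MvPolynomial.C c, by simp, by simp⟩

theorem mem_polyFun_zero {f : Euc n → ℝ} : f ∈ polyFun n 0 ↔ ∃ c, f = fun _ => c := by
  refine ⟨fun hf => ?_, fun ⟨c, hc⟩ => hc ▸ const_mem_polyFun c⟩
  obtain ⟨P, hP, rfl⟩ := mem_polyFun.1 hf
  rw [Nat.le_zero, MvPolynomial.totalDegree_eq_zero_iff_eq_C] at hP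
  exact ⟨P.coeff 0, by rw [hP]; simp⟩

theorem coordinate_mem_polyFun (k : Fin n) : (fun x : Euc n => x k) ∈ polyFun n 1 :=
  mem_polyFun.2 ⟨MvPolynomial.X k, by simp, by simp⟩

theorem mul_mem_polyFun {f g : Euc n → ℝ} (hf : f ∈ polyFun n q) (hg : g ∈ polyFun n r) :
    (fun x => f x * g x) ∈ polyFun n (q + r) := by
  obtain ⟨P, hP, rfl⟩ := mem_polyFun.1 hf
  obtain ⟨Q, hQ, rfl⟩ := mem_polyFun.1 hg
  exact mem_polyFun.2 ⟨P * Q, (MvPolynomial.totalDegree_mul P Q).trans (by omega), by simp⟩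

theorem prod_mem_polyFun {ι : Type*} (s : Finset ι) (f : ι → Euc n → ℝ) (d : ι → ℕ)
    (hf : ∀ k ∈ s, f k ∈ polyFun n (d k)) :
    (fun x => ∏ k ∈ s, f k x) ∈ polyFun n (∑ k ∈ s, d k) := by
  classical
  induction s using Finset.induction_on with
  | empty => simpa using const_mem_polyFun 1
  | insert a s ha ih =>
    simp only [Finset.prod_insert ha, Finset.sum_insert ha]
    exact mul_mem_polyFun (hf a (Finset.mem_insert_self a s))
      (ih fun k hk => hf k (Finset.mem_insert_of_mem hk))

theorem pow_mem_polyFun {f : Euc n → ℝ} (hf : f ∈ polyFun n 1) (d : ℕ) :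
    (fun x => f x ^ d) ∈ polyFun n d := by
  have := prod_mem_polyFun (Finset.range d) (fun _ => f) (fun _ => 1) fun _ _ => hf
  simpa using this

theorem comp_mem_polyFun {f : Euc n → ℝ} (hf : f ∈ polyFun n q) {A : Euc m → Euc n}
    (hA : ∀ k, (fun y => A y k) ∈ polyFun m 1) : (fun y => f (A y)) ∈ polyFun m q := by
  obtain ⟨P, hP, rfl⟩ := mem_polyFun.1 hf
  have h : (fun y => MvPolynomial.eval (fun k => A y k) P) =
      ∑ s ∈ P.support, P.coeff s • fun y => ∏ k ∈ s.support, A y k ^ s k := by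
    funext y
    rw [MvPolynomial.eval_eq]
    simp
  rw [h]
  refine Submodule.sum_mem _ fun s hs => Submodule.smul_mem _ _ ?_
  exact polyFun_mono ((MvPolynomial.le_totalDegree hs).trans hP)
    (prod_mem_polyFun s.support (fun k y => A y k ^ s k) s fun k _ => pow_mem_polyFun (hA k) _)

theorem linear_mem_polyFun (L : Euc n →ₗ[ℝ] ℝ) : (fun x => L x) ∈ polyFun n 1 := by
  have h : (fun x => L x) =
      ∑ k, L (EuclideanSpace.basisFun (Fin n) ℝ k) • fun x : Euc n => x k := by
    funext x
    conv_lhs => rw [← (EuclideanSpace.basisFun (Fin n) ℝ).sum_repr x, map_sum]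
    simp [mul_comm]
  rw [h]
  exact Submodule.sum_mem _ fun k _ => Submodule.smul_mem _ _ (coordinate_mem_polyFun k)

theorem affine_mem_polyFun (L : Euc n →ᵃ[ℝ] ℝ) : (fun x => L x) ∈ polyFun n 1 := by
  have h : (fun x => L x) = (fun x => L.linear x) + fun _ => L 0 := by
    funext x
    rw [Pi.add_apply, congrFun (AffineMap.decomp L) x]
    rfl
  rw [h]
  exact Submodule.add_mem _ (linear_mem_polyFun _) (const_mem_polyFun _)

theorem coord_mem_polyFun (T : Simplex n) (k : Fin (n + 1)) :
    (fun x => T.coord k x) ∈ polyFun n 1 := affine_mem_polyFun (T.coord k)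

theorem comp_affine_mem_polyFun {f : Euc n → ℝ} (hf : f ∈ polyFun n q)
    (A : Euc m →ᵃ[ℝ] Euc n) : (fun y => f (A y)) ∈ polyFun m q :=
  comp_mem_polyFun hf fun k => affine_mem_polyFun
    ((EuclideanSpace.proj k : Euc n →L[ℝ] ℝ).toLinearMap.toAffineMap.comp A)

theorem comp_sum_coord_mem_polyFun {f : Euc n → ℝ} (hf : f ∈ polyFun n q) (T : Simplex m)
    (z : Fin (m + 1) → Euc n) : (fun y => f (∑ k, T.coord k y • z k)) ∈ polyFun m q := by
  refine comp_mem_polyFun hf fun l => ?_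
  have h : (fun y => (∑ k, T.coord k y • z k) l) =
      ∑ k, (z k l) • fun y => T.coord k y := by
    funext y
    simp [mul_comm]
  rw [h]
  exact Submodule.sum_mem _ fun k _ => Submodule.smul_mem _ _ (coord_mem_polyFun T k)

theorem contDiff_of_mem_polyFun {f : Euc n → ℝ} (hf : f ∈ polyFun n q) {s : WithTop ℕ∞} :
    ContDiff ℝ s f := by
  obtain ⟨P, hP, rfl⟩ := mem_polyFun.1 hf
  simp only [MvPolynomial.eval_eq]
  fun_prop

theorem continuous_of_mem_polyFun {f : Euc n → ℝ} (hf : f ∈ polyFun n q) : Continuous f :=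
  (contDiff_of_mem_polyFun hf (s := 0)).continuous

/-- A finite-dimensional space of functions is closed under pointwise limits, and difference
quotients stay in it because translations preserve the degree. The drop in degree is not needed. -/
theorem fderiv_mem_polyFun {f : Euc n → ℝ} (hf : f ∈ polyFun n q) (e : Euc n) :
    (fun x => fderiv ℝ f x e) ∈ polyFun n q := by
  have hcl : IsClosed (polyFun n q : Set (Euc n → ℝ)) :=
    (polyFun n q).closed_of_finiteDimensional
  refine hcl.mem_of_tendsto (b := 𝓝[≠] (0 : ℝ))
    (f := fun (t : ℝ) x => t⁻¹ • (f (x + t • e) - f x)) ?_ (Eventually.of_forall fun t => ?_)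
  · rw [tendsto_pi_nhds]
    intro x
    have h1 := ((contDiff_of_mem_polyFun hf (s := 1)).differentiable one_ne_zero x).hasFDerivAt
    have h2 := (h1.hasLineDerivAt e)
    have h3 := hasDerivAt_iff_tendsto_slope.1 h2
    simpa [slope_fun_def] using h3
  · refine Submodule.smul_mem _ _ (Submodule.sub_mem _ ?_ hf)
    exact comp_affine_mem_polyFun hf (AffineMap.id ℝ _ + AffineMap.const ℝ _ (t • e))

theorem eq_zero_of_eqOn_elem {f : Euc n → ℝ} (hf : f ∈ polyFun n q) (T : Simplex n)
    (h : ∀ x ∈ elem T, f x = 0) : f = 0 := by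
  obtain ⟨z, hz⟩ := elem_nonempty T
  have ha : AnalyticOnNhd ℝ f Set.univ := fun x _ =>
    (contDiff_of_mem_polyFun hf (s := ω)).contDiffAt.analyticAt
  refine ha.eq_of_eventuallyEq (fun _ _ => analyticAt_const) (z₀ := z) ?_
  exact Filter.mem_of_superset ((isOpen_elem T).mem_nhds hz) h

/-- A dimension count: independent restrictions, as many as the dimension, span the space. It is
applied to the dual functions, for which only independence is at hand. -/
theorem exists_eq_sum_of_linearIndependent {S : Set (Euc n)} {χ : Fin (dimP q S) → Euc n → ℝ}
    (hχ : ∀ j, χ j ∈ polyFun n q) (hli : LinearIndependent ℝ fun j => S.domRestrict (χ j))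
    {f : Euc n → ℝ} (hf : f ∈ polyFun n q) :
    ∃ c : Fin (dimP q S) → ℝ, ∀ x ∈ S, f x = ∑ j, c j * χ j x := by
  have hle : Submodule.span ℝ (Set.range fun j => S.domRestrict (χ j)) ≤ polyOn q S := by
    rw [Submodule.span_le]
    rintro _ ⟨j, rfl⟩
    exact ⟨χ j, hχ j, rfl⟩
  have heq := Submodule.eq_of_le_of_finrank_eq hle (by
    rw [finrank_span_eq_card hli, Fintype.card_fin]; rfl)
  have hmem : S.domRestrict f ∈ polyOn q S := ⟨f, hf, rfl⟩
  rw [← heq, Submodule.mem_span_range_iff_exists_fun] at hmem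
  obtain ⟨c, hc⟩ := hmem
  refine ⟨c, fun x hx => ?_⟩
  have := congrFun hc ⟨x, hx⟩
  simpa using this.symm

end PolyFun

/-! ### Norm equivalence and duality with bubble weights -/

section Bubble

variable {n : ℕ} (T : Simplex n)

@[fun_prop]
theorem continuous_elemBubble : Continuous (elemBubble T) := by
  unfold elemBubble; fun_prop

theorem elemBubble_pos {x : Euc n} (hx : x ∈ elem T) : 0 < elemBubble T x :=
  Finset.prod_pos fun k _ => (mem_elem T).1 hx k

theorem elemBubble_le_one {x : Euc n} (hx : x ∈ elem T) : elemBubble T x ≤ 1 :=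
  Finset.prod_le_one (fun k _ => ((mem_elem T).1 hx k).le)
    fun k _ => coord_le_one T (elem_subset_hull T hx) k

theorem eqOn_zero_of_setIntegral_eq_zero {f : Euc n → ℝ} (hf : Continuous f)
    (h0 : ∀ x ∈ elem T, 0 ≤ f x) (h : ∫ x in elem T, f x = 0) : ∀ x ∈ elem T, f x = 0 := by
  have h1 := (setIntegral_eq_zero_iff_of_nonneg_ae
    (ae_restrict_of_forall_mem (measurableSet_elem T) h0) (hf.integrableOn_elem T)).1 h
  exact Measure.eqOn_open_of_ae_eq h1 (isOpen_elem T) hf.continuousOn continuousOn_const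

theorem eqOn_zero_of_bubble {f g : Euc n → ℝ} (h0 : ∀ x ∈ elem T, elemBubble T x * g x = 0)
    (h : ∀ x, g x = 0 → f x = 0) : ∀ x ∈ elem T, f x = 0 := fun x hx =>
  h x ((mul_eq_zero.1 (h0 x hx)).resolve_left (elemBubble_pos T hx).ne')

/-- The integral on the right is a norm on the finite-dimensional space `V`, because the bubble is
positive inside. A pointwise bounded family of functionals is uniformly bounded for it, as is seen
on a basis. Point values, derivatives at points and values of extended face polynomials are all
treated as such families. -/
theorem exists_bound_bubble_integral {V : Type*} [AddCommGroup V] [Module ℝ V]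
    [FiniteDimensional ℝ V] (Λ : V →ₗ[ℝ] (Euc n → ℝ)) (hc : ∀ v, Continuous (Λ v))
    (hinj : ∀ v, (∀ x ∈ elem T, Λ v x = 0) → v = 0) {ι : Type*} (l : ι → V →ₗ[ℝ] ℝ)
    (hb : ∀ v, ∃ K, ∀ a, |l a v| ≤ K) :
    ∃ C, 0 < C ∧ ∀ a v, |l a v| ≤ C * ∫ x in elem T, elemBubble T x * |Λ v x| := by
  let : Norm V := ⟨fun v => ∫ x in elem T, elemBubble T x * |Λ v x|⟩
  have hnorm : ∀ v : V, ‖v‖ = ∫ x in elem T, elemBubble T x * |Λ v x| := fun _ => rfl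
  have hcont : ∀ v, Continuous fun x => elemBubble T x * |Λ v x| := fun v => by
    have := hc v
    fun_prop
  have hnn : ∀ v, ∀ x ∈ elem T, 0 ≤ elemBubble T x * |Λ v x| := fun v x hx =>
    mul_nonneg (elemBubble_pos T hx).le (abs_nonneg _)
  have core : NormedSpace.Core ℝ V :=
    { norm_nonneg := fun v => setIntegral_nonneg (measurableSet_elem T) (hnn v)
      norm_smul := fun c v => by
        rw [hnorm, hnorm, Real.norm_eq_abs, ← integral_const_mul]
        congr 1; funext x
        rw [map_smul, Pi.smul_apply, smul_eq_mul, abs_mul]; ring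
      norm_triangle := fun v w => by
        rw [hnorm, hnorm, hnorm, ← integral_add ((hcont v).integrableOn_elem T)
          ((hcont w).integrableOn_elem T)]
        refine setIntegral_mono_on ((hcont _).integrableOn_elem T)
          (((hcont v).add (hcont w)).integrableOn_elem T) (measurableSet_elem T) fun x hx => ?_
        rw [map_add, Pi.add_apply, ← mul_add]
        exact mul_le_mul_of_nonneg_left (abs_add_le _ _) (elemBubble_pos T hx).le
      norm_eq_zero_iff := fun v => by
        refine ⟨fun h => hinj v ?_, fun h => by rw [hnorm, h]; simp⟩
        exact eqOn_zero_of_bubble T (eqOn_zero_of_setIntegral_eq_zero T (hcont v) (hnn v) h)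
          fun x => abs_eq_zero.1 }
  let : NormedAddCommGroup V := NormedAddCommGroup.ofCore core
  let : NormedSpace ℝ V := NormedSpace.ofCore core
  let b := Module.finBasis ℝ V
  choose K hK using hb
  -- Coordinates are continuous for the new norm, and `K (b j)` bounds the whole family on the basis
  -- vector `b j`.
  let D : ℝ := ∑ j, ‖(b.coord j).toContinuousLinearMap‖ * |K (b j)|
  have hD : 0 ≤ D := Finset.sum_nonneg fun j _ => mul_nonneg (norm_nonneg _) (abs_nonneg _)
  refine ⟨D + 1, by linarith, fun a v => ?_⟩
  rw [← hnorm]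
  calc |l a v| = |∑ j, b.repr v j * l a (b j)| := by
        conv_lhs => rw [← b.sum_repr v, map_sum]
        simp
    _ ≤ ∑ j, |b.repr v j * l a (b j)| := Finset.abs_sum_le_sum_abs _ _
    _ ≤ ∑ j, (‖(b.coord j).toContinuousLinearMap‖ * |K (b j)|) * ‖v‖ := by
        refine Finset.sum_le_sum fun j _ => ?_
        rw [abs_mul, mul_right_comm]
        refine mul_le_mul ((b.coord j).toContinuousLinearMap.le_opNorm v)
          ((hK _ a).trans (le_abs_self _)) (abs_nonneg _) (by positivity)
    _ = D * ‖v‖ := by rw [Finset.sum_mul]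
    _ ≤ (D + 1) * ‖v‖ := by nlinarith [norm_nonneg v]

/-- The bubble-weighted Gram matrix is positive definite: for a combination `f` in its kernel, the
integral of the bubble times `f²` vanishes. Being injective, the matrix is invertible. -/
theorem exists_bubble_dual {ι : Type*} [Fintype ι] [DecidableEq ι] {b : ι → Euc n → ℝ}
    (hb : ∀ j, Continuous (b j))
    (hli : ∀ c : ι → ℝ, (∀ x ∈ elem T, ∑ j, c j * b j x = 0) → c = 0) (s : ℝ) :
    ∃ a : ι → ι → ℝ, ∀ j k,
      ∫ x in elem T, (∑ l, a j l * b l x) * (elemBubble T x * b k x) = if j = k then s else 0 := by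
  have hint : ∀ (c : ι → ℝ) k, IntegrableOn
      (fun x => (∑ l, c l * b l x) * (elemBubble T x * b k x)) (elem T) := fun c k =>
    Continuous.integrableOn_elem (by fun_prop) T
  let G : (ι → ℝ) →ₗ[ℝ] (ι → ℝ) :=
    { toFun := fun c k => ∫ x in elem T, (∑ l, c l * b l x) * (elemBubble T x * b k x)
      map_add' := fun c d => by
        funext k
        rw [Pi.add_apply, ← integral_add (hint c k) (hint d k)]
        simp only [Pi.add_apply, add_mul, Finset.sum_add_distrib]
      map_smul' := fun r c => by
        funext k
        rw [Pi.smul_apply, smul_eq_mul, RingHom.id_apply, ← integral_const_mul]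
        simp only [Pi.smul_apply, smul_eq_mul, mul_assoc, Finset.mul_sum, Finset.sum_mul] }
  have hG : Function.Injective G := by
    rw [← LinearMap.ker_eq_bot, LinearMap.ker_eq_bot']
    intro c hc
    refine hli c ?_
    have h1 : ∫ x in elem T, elemBubble T x * (∑ l, c l * b l x) ^ 2 = 0 := by
      have h2 : ∀ x, elemBubble T x * (∑ l, c l * b l x) ^ 2 =
          ∑ k, c k * ((∑ l, c l * b l x) * (elemBubble T x * b k x)) := fun x => by
        have h3 : ∀ k, c k * ((∑ l, c l * b l x) * (elemBubble T x * b k x)) =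
            (elemBubble T x * ∑ l, c l * b l x) * (c k * b k x) := fun k => by ring
        simp only [h3]
        rw [← Finset.mul_sum]; ring
      simp_rw [h2]
      rw [integral_finsetSum _ fun k _ => (hint c k).const_mul _]
      refine Finset.sum_eq_zero fun k _ => ?_
      rw [integral_const_mul]
      have := congrFun hc k
      change (∫ x in elem T, _) = 0 at this
      rw [this, mul_zero]
    exact eqOn_zero_of_bubble T (eqOn_zero_of_setIntegral_eq_zero T (by fun_prop)
      (fun x hx => mul_nonneg (elemBubble_pos T hx).le (sq_nonneg _)) h1)
      fun x hx => pow_eq_zero_iff two_ne_zero |>.1 hx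
  have hs := LinearMap.injective_iff_surjective.1 hG
  choose a ha using fun j => hs (Pi.single j s)
  refine ⟨a, fun j k => ?_⟩
  have := congrFun (ha j) k
  rw [Pi.single_apply] at this
  simp only [eq_comm (a := j)]
  exact this

end Bubble

/-! ### Affine transfer to a reference simplex and inverse estimates -/

section Transfer

variable {n : ℕ}

/-- The affine map that sends the vertices of `T` to those of `T'`. -/
noncomputable def transfer (T T' : Simplex n) (x : Euc n) : Euc n := ∑ k, T.coord k x • T' k

theorem coord_transfer (T T' : Simplex n) (x : Euc n) (j : Fin (n + 1)) :
    T'.coord j (transfer T T' x) = T.coord j x := by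
  classical
  rw [transfer, coord_sum_smul _ _ _ (T.sum_coord_apply_eq_one x)]
  simp [AffineBasis.coord_apply]

theorem transfer_transfer (T T' : Simplex n) (x : Euc n) : transfer T' T (transfer T T' x) = x :=
  T.ext_elem fun j => by rw [coord_transfer, coord_transfer]

theorem transfer_mem_elem (T T' : Simplex n) {x : Euc n} :
    transfer T T' x ∈ elem T' ↔ x ∈ elem T := by
  simp only [mem_elem, coord_transfer]

theorem transfer_mem_hull (T T' : Simplex n) {x : Euc n} :
    transfer T T' x ∈ convexHull ℝ (Set.range T') ↔ x ∈ convexHull ℝ (Set.range T) := by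
  simp only [mem_hull, coord_transfer]

theorem transfer_image_elem (T T' : Simplex n) : transfer T T' '' elem T = elem T' := by
  ext x
  refine ⟨?_, fun hx => ⟨transfer T' T x, (transfer_mem_elem T' T).2 hx, transfer_transfer _ _ _⟩⟩
  rintro ⟨y, hy, rfl⟩
  exact (transfer_mem_elem T T').2 hy

theorem elemBubble_transfer (T T' : Simplex n) (x : Euc n) :
    elemBubble T' (transfer T T' x) = elemBubble T x := by
  simp only [elemBubble, coord_transfer]

/-- The linear part of `transfer`. -/
noncomputable def transferL (T T' : Simplex n) : Euc n →L[ℝ] Euc n :=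
  ∑ k, (coordL T k).smulRight (T' k)

theorem transferL_apply (T T' : Simplex n) (e : Euc n) :
    transferL T T' e = ∑ k, coordL T k e • T' k := by
  simp [transferL]

theorem hasFDerivAt_transfer (T T' : Simplex n) (x : Euc n) :
    HasFDerivAt (transfer T T') (transferL T T') x := by
  unfold transfer transferL
  exact HasFDerivAt.fun_sum fun k _ => (hasFDerivAt_coord T k x).smul_const (T' k)

/-- The Jacobian is constant, and `f = 1` identifies it with the ratio of the volumes. -/
theorem setIntegral_transfer (T T' : Simplex n) (f : Euc n → ℝ) :
    ∫ x in elem T', f x = vol T' / vol T * ∫ y in elem T, f (transfer T T' y) := by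
  have h : ∀ f : Euc n → ℝ, ∫ x in elem T', f x =
      |(transferL T T').det| * ∫ y in elem T, f (transfer T T' y) := fun f => by
    rw [← transfer_image_elem T T', integral_image_eq_integral_abs_det_fderiv_smul volume
      (measurableSet_elem T) (fun x _ => (hasFDerivAt_transfer T T' x).hasFDerivWithinAt)
      (Function.LeftInverse.injective (transfer_transfer T T')).injOn]
    simp only [smul_eq_mul]
    rw [integral_const_mul]
  have h1 := h fun _ => 1
  simp only [integral_const, smul_eq_mul, mul_one, measureReal_restrict_apply_univ] at h1
  change vol T' = _ * vol T at h1
  rw [h f, h1, mul_div_cancel_right₀ _ (vol_pos T).ne']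

theorem exists_reference (n : ℕ) : Nonempty (Simplex n) :=
  AffineBasis.exists_affineBasis_of_finiteDimensional (by simp)

/-- Norm equivalence on one reference simplex. Affine transfer preserves degrees, bubbles and
averages, so shape regularity plays no role. -/
theorem exists_le_bubble_average (n q : ℕ) : ∃ C, 0 < C ∧ ∀ (T : Simplex n), ∀ u ∈ polyFun n q,
    ∀ x ∈ convexHull ℝ (Set.range T),
      |u x| ≤ C / vol T * ∫ y in elem T, elemBubble T y * |u y| := by
  obtain ⟨R⟩ := exists_reference n
  obtain ⟨C, hC, h⟩ := exists_bound_bubble_integral R (polyFun n q).subtype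
    (fun v => continuous_of_mem_polyFun v.2)
    (fun v hv => Subtype.ext (eq_zero_of_eqOn_elem v.2 R hv))
    (fun y : convexHull ℝ (Set.range R) => (LinearMap.proj y.1).comp (polyFun n q).subtype)
    (fun v => by
      obtain ⟨K, hK⟩ := (isCompact_hull R).exists_bound_of_continuousOn
        (continuous_of_mem_polyFun v.2).continuousOn
      exact ⟨K, fun y => hK y.1 y.2⟩)
  refine ⟨C * vol R, mul_pos hC (vol_pos R), fun T u hu x hx => ?_⟩
  have h1 := h ⟨transfer T R x, (transfer_mem_hull T R).2 hx⟩
    ⟨_, comp_sum_coord_mem_polyFun hu R T⟩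
  simp only [LinearMap.comp_apply, LinearMap.proj_apply, Submodule.subtype_apply] at h1
  change |u (transfer R T (transfer T R x))| ≤
    C * ∫ y in elem R, elemBubble R y * |u (transfer R T y)| at h1
  rw [transfer_transfer] at h1
  rw [setIntegral_transfer R T]
  simp_rw [elemBubble_transfer]
  refine h1.trans_eq ?_
  have := (vol_pos R).ne'
  have := (vol_pos T).ne'
  field_simp

/-- A scale-free inverse inequality: a direction is measured by the change of the barycentric
coordinates along it, which affine transfer preserves. Shape regularity enters only through
`abs_coordL_le`. -/
theorem exists_fderiv_le (n q : ℕ) : ∃ C, 0 < C ∧ ∀ (T : Simplex n), ∀ u ∈ polyFun n q,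
    ∀ b, (∀ y ∈ elem T, |u y| ≤ b) → ∀ (e : Euc n) (r : ℝ), (∀ k, |coordL T k e| ≤ r) →
      ∀ x ∈ elem T, |fderiv ℝ u x e| ≤ C * r * b := by
  obtain ⟨R⟩ := exists_reference n
  obtain ⟨C, hC, h⟩ := exists_bound_bubble_integral R (polyFun n q).subtype
    (fun v => continuous_of_mem_polyFun v.2)
    (fun v hv => Subtype.ext (eq_zero_of_eqOn_elem v.2 R hv))
    (fun a : convexHull ℝ (Set.range R) × Fin (n + 1) =>
      { toFun := fun v => fderiv ℝ v.1 a.1.1 (R a.2)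
        map_add' := fun v w => by
          have hd : ∀ v : polyFun n q, DifferentiableAt ℝ v.1 a.1.1 := fun v =>
            (contDiff_of_mem_polyFun v.2 (s := 1)).differentiable one_ne_zero _
          rw [Submodule.coe_add, fderiv_add (hd v) (hd w)]; rfl
        map_smul' := fun c v => by
          have hd : DifferentiableAt ℝ v.1 a.1.1 :=
            (contDiff_of_mem_polyFun v.2 (s := 1)).differentiable one_ne_zero _
          rw [Submodule.coe_smul, fderiv_const_smul hd]; rfl })
    (fun v => by
      have hK : ∀ k, ∃ K, ∀ x ∈ convexHull ℝ (Set.range R), ‖fderiv ℝ v.1 x (R k)‖ ≤ K :=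
        fun k => (isCompact_hull R).exists_bound_of_continuousOn
          (continuous_of_mem_polyFun (fderiv_mem_polyFun v.2 (R k))).continuousOn
      choose K hK using hK
      refine ⟨∑ k, |K k|, fun a => ((hK a.2 a.1.1 a.1.2).trans (le_abs_self _)).trans ?_⟩
      exact Finset.single_le_sum (f := fun k => |K k|) (fun k _ => abs_nonneg _)
        (Finset.mem_univ a.2))
  refine ⟨(n + 1) * (C * vol R), mul_pos (by positivity) (mul_pos hC (vol_pos R)),
    fun T u hu b hb e r hr x hx => ?_⟩
  set w : Euc n → ℝ := fun y => u (transfer R T y) with hw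
  have hwm : w ∈ polyFun n q := comp_sum_coord_mem_polyFun hu R T
  have hxR : transfer T R x ∈ convexHull ℝ (Set.range R) :=
    (transfer_mem_hull T R).2 (elem_subset_hull T hx)
  have huw : u = fun x => w (transfer T R x) := by
    funext x; rw [hw]; simp only [transfer_transfer]
  -- The transferred direction is a combination of the vertex vectors of `R`, so finitely many
  -- directional derivatives on `R` suffice.
  have hderiv : fderiv ℝ u x e = ∑ k, coordL T k e * fderiv ℝ w (transfer T R x) (R k) := by
    have h1 : HasFDerivAt w (fderiv ℝ w (transfer T R x)) (transfer T R x) :=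
      ((contDiff_of_mem_polyFun hwm (s := 1)).differentiable one_ne_zero _).hasFDerivAt
    have h2 := h1.comp x (hasFDerivAt_transfer T R x)
    conv_lhs => rw [huw]
    rw [show (fun x => w (transfer T R x)) = w ∘ transfer T R from rfl, h2.fderiv,
      ContinuousLinearMap.comp_apply, transferL_apply, map_sum]
    simp
  have hint : ∫ y in elem R, elemBubble R y * |w y| ≤ vol R * b := by
    have hwc := continuous_of_mem_polyFun hwm
    calc ∫ y in elem R, elemBubble R y * |w y| ≤ ∫ _ in elem R, b := by
          refine setIntegral_mono_on (Continuous.integrableOn_elem (by fun_prop) R)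
            (continuous_const.integrableOn_elem R) (measurableSet_elem R) fun y hy => ?_
          have := hb _ ((transfer_mem_elem R T).2 hy)
          exact (mul_le_of_le_one_left (abs_nonneg _) (elemBubble_le_one R hy)).trans this
      _ = vol R * b := by simp [vol]
  have hk : ∀ k, |fderiv ℝ w (transfer T R x) (R k)| ≤ C * (vol R * b) := fun k =>
    (h (⟨_, hxR⟩, k) ⟨w, hwm⟩).trans (mul_le_mul_of_nonneg_left hint hC.le)
  rw [hderiv]
  calc |∑ k, coordL T k e * fderiv ℝ w (transfer T R x) (R k)|
      ≤ ∑ k, |coordL T k e * fderiv ℝ w (transfer T R x) (R k)| := Finset.abs_sum_le_sum_abs _ _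
    _ ≤ ∑ _k : Fin (n + 1), r * (C * (vol R * b)) := by
        refine Finset.sum_le_sum fun k _ => ?_
        rw [abs_mul]
        exact mul_le_mul (hr k) (hk k) (abs_nonneg _) ((abs_nonneg _).trans (hr k))
    _ = (n + 1) * (C * vol R) * r * b := by
        simp only [Finset.sum_const, Finset.card_univ, Fintype.card_fin, nsmul_eq_mul,
          Nat.cast_add, Nat.cast_one]
        ring

/-- A barycentric coordinate changes by at most one along a segment inside the element, and the
inscribed ball contains a segment of length `h/γ` in every direction. -/
theorem abs_coordL_le {T : Simplex n} {γ : ℝ} (hγ : 0 < γ) (hs : 0 < size T)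
    (hT : ShapeRegular T γ) (k : Fin (n + 1)) (e : Euc n) :
    |coordL T k e| ≤ γ / size T * ‖e‖ := by
  obtain ⟨z, hz⟩ := hT
  rcases eq_or_ne e 0 with rfl | he
  · simp
  have hen : 0 < ‖e‖ := norm_pos_iff.2 he
  -- Half the radius of the ball: the segment from `-r` to `r` has length `h/γ`, and its end points
  -- lie in the open ball.
  set r := size T / γ / 2 with hr
  have hr0 : 0 < r := by positivity
  have hball : ∀ s : ℝ, |s| = r / ‖e‖ → z + s • e ∈ elem T := fun s h => by
    refine hz ?_
    rw [Metric.mem_ball, dist_eq_norm, add_sub_cancel_left, norm_smul, Real.norm_eq_abs, h,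
      div_mul_cancel₀ _ hen.ne', hr]
    have : 0 < size T / γ := by positivity
    linarith
  have hrn : |r / ‖e‖| = r / ‖e‖ := abs_of_pos (by positivity)
  have hp := hball (r / ‖e‖) hrn
  have hm := hball (-(r / ‖e‖)) (by rw [abs_neg, hrn])
  have h1 := coordL_sub T k (z + (r / ‖e‖) • e) (z + (-(r / ‖e‖)) • e)
  have h2 : z + (r / ‖e‖) • e - (z + (-(r / ‖e‖)) • e) = (2 * (r / ‖e‖)) • e := by module
  rw [h2, map_smul, smul_eq_mul] at h1
  have h3 : |2 * (r / ‖e‖) * coordL T k e| ≤ 1 := by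
    rw [h1, abs_le]
    have := (mem_elem T).1 hp k
    have := (mem_elem T).1 hm k
    have := coord_le_one T (elem_subset_hull T hp) k
    have := coord_le_one T (elem_subset_hull T hm) k
    constructor <;> linarith
  rw [abs_mul, abs_of_pos (by positivity)] at h3
  have h4 : 2 * (r / ‖e‖) = (γ / size T * ‖e‖)⁻¹ := by
    rw [hr]; field_simp
  rw [h4, inv_mul_le_iff₀ (by positivity), mul_one] at h3
  exact h3

end Transfer

/-! ### Polynomial bases on a set -/

section Bases

variable {n q : ℕ} {S : Set (Euc n)}

theorem exists_isPolyBasis (q : ℕ) (S : Set (Euc n)) : ∃ b, IsPolyBasis q S b := by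
  let B : Module.Basis (Fin (dimP q S)) ℝ (polyOn q S) := Module.finBasis ℝ (polyOn q S)
  have h : ∀ j, ∃ f ∈ polyFun n q, S.domRestrict f = (B j : S → ℝ) := fun j => (B j).2
  choose b hb hbB using h
  refine ⟨b, hb, ?_, ?_⟩
  · simp_rw [hbB]
    exact B.linearIndependent.map' (polyOn q S).subtype (Submodule.ker_subtype _)
  · simp_rw [hbB]
    have h2 := congrArg (Submodule.map (polyOn q S).subtype) B.span_eq
    rw [Submodule.map_span, ← Set.range_comp, Submodule.map_subtype_top] at h2
    exact h2

theorem IsPolyBasis.congr {b b' : Fin (dimP q S) → Euc n → ℝ} (hb : IsPolyBasis q S b)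
    (hmem : ∀ j, b' j ∈ polyFun n q) (h : ∀ j, ∀ x ∈ S, b' j x = b j x) :
    IsPolyBasis q S b' := by
  have h' : (fun j => S.domRestrict (b' j)) = fun j => S.domRestrict (b j) := by
    funext j x; exact h j x x.2
  exact ⟨hmem, h' ▸ hb.2.1, h' ▸ hb.2.2⟩

theorem IsPolyBasis.eq_zero {b : Fin (dimP q S) → Euc n → ℝ} (hb : IsPolyBasis q S b)
    {c : Fin (dimP q S) → ℝ} (h : ∀ x ∈ S, ∑ j, c j * b j x = 0) : c = 0 := by
  have h1 := Fintype.linearIndependent_iff.1 hb.2.1 c (by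
    funext x
    simpa using h x x.2)
  exact funext h1

theorem IsPolyBasis.continuous {b : Fin (dimP q S) → Euc n → ℝ} (hb : IsPolyBasis q S b) (j) :
    Continuous (b j) := continuous_of_mem_polyFun (hb.1 j)

theorem sum_mul_mem_polyFun {ι : Type*} [Fintype ι] {b : ι → Euc n → ℝ}
    (hb : ∀ j, b j ∈ polyFun n q) (c : ι → ℝ) : (fun x => ∑ j, c j * b j x) ∈ polyFun n q := by
  have h : (fun x => ∑ j, c j * b j x) = ∑ j, c j • b j := by
    funext x; simp
  rw [h]
  exact Submodule.sum_mem _ fun j _ => Submodule.smul_mem _ _ (hb j)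

end Bases

theorem coord_add {n : ℕ} (T : Simplex n) (j : Fin (n + 1)) (x e : Euc n) :
    T.coord j (x + e) = T.coord j x + coordL T j e := by
  rw [coord_eq_coordL_add]; simp only [map_add]; ring

/-! ### Polynomials on a face, stable extensions, existence of dual functions -/

section Face

variable {m p : ℕ} (T : Simplex (m + 1)) (i : Fin (m + 2))

theorem mem_face {x : Euc (m + 1)} :
    x ∈ face T i ↔ (∀ k, 0 ≤ T.coord k x) ∧ T.coord i x = 0 := by
  constructor
  · intro hx
    refine ⟨(mem_hull T).1 (face_subset_hull T i hx), ?_⟩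
    rw [face_eq_image] at hx
    obtain ⟨y, -, rfl⟩ := hx
    exact coord_faceChart_self T i y
  · rintro ⟨h0, hi⟩
    have hsum := T.sum_coord_apply_eq_one x
    rw [Fin.sum_univ_succAbove _ i, hi, zero_add] at hsum
    rw [face_eq_image]
    refine ⟨∑ k, T.coord (i.succAbove k) x • faceSimplex T i k, ?_, ?_⟩
    · rw [mem_hull]
      intro k
      classical
      rw [coord_sum_smul _ _ _ hsum]
      simpa [AffineBasis.coord_apply] using h0 (i.succAbove k)
    · refine T.ext_elem fun j => ?_
      rcases Fin.eq_self_or_eq_succAbove i j with rfl | ⟨k, rfl⟩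
      · rw [coord_faceChart_self, hi]
      · classical
        rw [coord_faceChart_succAbove, coord_sum_smul _ _ _ hsum]
        simp [AffineBasis.coord_apply]

theorem faceBubble_faceChart (y : Euc m) :
    faceBubble T i (faceChart T i y) = elemBubble (faceSimplex T i) y := by
  have h : Finset.univ.erase i = Finset.univ.image i.succAbove := by
    ext k
    simp only [Finset.mem_erase, Finset.mem_univ, and_true, Finset.mem_image, true_and]
    exact ⟨fun hk => Fin.exists_succAbove_eq hk, fun ⟨l, hl⟩ => hl ▸ Fin.succAbove_ne i l⟩
  rw [faceBubble, elemBubble, h, Finset.prod_image fun a _ b _ h =>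
    Fin.succAbove_right_injective h]
  simp only [coord_faceChart_succAbove]

theorem faceBubble_of_mem_face {k : Fin (m + 2)} (hk : k ≠ i) {x : Euc (m + 1)}
    (hx : x ∈ face T i) : faceBubble T k x = 0 :=
  Finset.prod_eq_zero (Finset.mem_erase.2 ⟨hk.symm, Finset.mem_univ i⟩) ((mem_face T i).1 hx).2

theorem elemBubble_of_mem_face {x : Euc (m + 1)} (hx : x ∈ face T i) : elemBubble T x = 0 :=
  Finset.prod_eq_zero (Finset.mem_univ i) ((mem_face T i).1 hx).2

theorem modFaceBubble_of_mem_face (α : ℝ) {x : Euc (m + 1)} (hx : x ∈ face T i) :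
    modFaceBubble T α i x = faceBubble T i x := by
  rw [modFaceBubble, ((mem_face T i).1 hx).2]; simp

theorem faceInner_eq (f g : Euc (m + 1) → ℝ) : faceInner T i f g =
    ∫ y in elem (faceSimplex T i), f (faceChart T i y) * g (faceChart T i y) :=
  setIntegral_face T i _

theorem faceInner_congr {f f' g g' : Euc (m + 1) → ℝ} (hf : ∀ x ∈ face T i, f x = f' x)
    (hg : ∀ x ∈ face T i, g x = g' x) : faceInner T i f g = faceInner T i f' g' :=
  setIntegral_congr_fun (measurableSet_face T i) fun x hx => by
    simp only [hf x hx, hg x hx]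

theorem eqOn_face_of_chart {f : Euc (m + 1) → ℝ} (hf : Continuous f)
    (h : ∀ y ∈ elem (faceSimplex T i), f (faceChart T i y) = 0) : ∀ x ∈ face T i, f x = 0 := by
  rw [face_eq_image, ← closure_elem]
  rintro _ ⟨y, hy, rfl⟩
  have hcl : IsClosed {y | f (faceChart T i y) = 0} :=
    isClosed_eq (by fun_prop) continuous_const
  exact closure_minimal (fun y hy => h y hy) hcl hy

theorem comp_faceChart_mem_polyFun {f : Euc (m + 1) → ℝ} {q : ℕ} (hf : f ∈ polyFun (m + 1) q) :
    (fun y => f (faceChart T i y)) ∈ polyFun m q :=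
  comp_affine_mem_polyFun hf (faceChart T i).toAffineMap

/-- The projection onto the hyperplane of the face opposite to `T i` along an edge. -/
noncomputable def faceProj (x : Euc (m + 1)) : Euc (m + 1) :=
  x + T.coord i x • (T (i.succAbove 0) - T i)

theorem faceProj_of_mem_face {x : Euc (m + 1)} (hx : x ∈ face T i) : faceProj T i x = x := by
  rw [faceProj, ((mem_face T i).1 hx).2, zero_smul, add_zero]

/-- The barycentric weight of `T i` is moved to one other vertex, so all weights stay nonnegative.
-/
theorem faceProj_mem_face {x : Euc (m + 1)} (hx : x ∈ elem T) : faceProj T i x ∈ face T i := by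
  classical
  have h : ∀ j, T.coord j (faceProj T i x) = T.coord j x +
      T.coord i x * ((if j = i.succAbove 0 then 1 else 0) - if j = i then 1 else 0) := fun j => by
    rw [faceProj, coord_add, map_smul, smul_eq_mul, coordL_sub, T.coord_apply, T.coord_apply]
  have h0 := (mem_elem T).1 hx
  rw [mem_face]
  refine ⟨fun j => ?_, ?_⟩
  · rw [h]
    have := h0 i
    have := h0 j
    by_cases hj : j = i
    · subst hj
      split_ifs <;> linarith
    · split_ifs <;> linarith
  · rw [h, if_neg (Fin.succAbove_ne i 0).symm, if_pos rfl]; ring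

theorem comp_faceProj_mem_polyFun {f : Euc (m + 1) → ℝ} {q : ℕ} (hf : f ∈ polyFun (m + 1) q) :
    (fun y => f (faceProj T i y)) ∈ polyFun (m + 1) q := by
  refine comp_mem_polyFun hf fun k => ?_
  have h : (fun y => faceProj T i y k) = (fun y => y k) +
      ((T (i.succAbove 0) - T i : Euc (m + 1)) k) • fun y => T.coord i y := by
    funext y; simp [faceProj, mul_comm]
  rw [h]
  exact Submodule.add_mem _ (coordinate_mem_polyFun k)
    (Submodule.smul_mem _ _ (coord_mem_polyFun T i))

/-- Face polynomials are extended to be constant along one edge direction. Composition with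
`faceProj` changes nothing on the face, and every value attained in the element is one attained on
the face. -/
theorem exists_stable_one : ∃ B : PolyBases T p, B.Stable 1 := by
  choose b hb using fun i => exists_isPolyBasis p (face T i)
  obtain ⟨c, hc⟩ := exists_isPolyBasis p (elem T)
  refine ⟨⟨fun i j x => b i j (faceProj T i x), c, fun i => (hb i).congr
    (fun j => comp_faceProj_mem_polyFun T i ((hb i).1 j))
    fun j x hx => by rw [faceProj_of_mem_face T i hx], hc⟩, ?_⟩
  intro i c K hK x hx
  rw [one_mul]
  have h := hK _ (faceProj_mem_face T i hx)
  simpa only [faceProj_of_mem_face T i (faceProj_mem_face T i hx)] using h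

variable {T}

theorem IsPolyBasis.eq_zero_of_chart {b : Fin (dimP p (face T i)) → Euc (m + 1) → ℝ}
    (hb : IsPolyBasis p (face T i) b) {c : Fin (dimP p (face T i)) → ℝ}
    (h : ∀ y ∈ elem (faceSimplex T i), ∑ j, c j * b j (faceChart T i y) = 0) : c = 0 :=
  hb.eq_zero (eqOn_face_of_chart T i (f := fun x => ∑ j, c j * b j x)
    (continuous_of_mem_polyFun (sum_mul_mem_polyFun hb.1 c)) h)

/-- Norm equivalence on the coefficient space, where the bubble integral over the face is a norm
because the restrictions to the face are independent. -/
theorem exists_face_bound (B : PolyBases T p) (i : Fin (m + 2)) :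
    ∃ C : ℝ, 0 < C ∧ ∀ (c : Fin (dimP p (face T i)) → ℝ) (K : ℝ),
      (∀ y ∈ face T i, |∑ j, c j * B.onFace i j y| ≤ K) →
        ∀ x ∈ elem T, |∑ j, c j * B.onFace i j x| ≤ C * K := by
  have hb := B.onFace_basis i
  have hcont := hb.continuous
  obtain ⟨C, hC, h⟩ := exists_bound_bubble_integral (faceSimplex T i)
    (V := Fin (dimP p (face T i)) → ℝ)
    { toFun := fun c y => ∑ j, c j * B.onFace i j (faceChart T i y)
      map_add' := fun c d => by
        funext y; simp [add_mul, Finset.sum_add_distrib]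
      map_smul' := fun r c => by
        funext y; simp [mul_assoc, Finset.mul_sum] }
    (fun c => by
      change Continuous fun y => ∑ j, c j * B.onFace i j (faceChart T i y)
      fun_prop)
    (fun c hc => hb.eq_zero_of_chart i hc)
    (fun x : elem T =>
      { toFun := fun c => ∑ j, c j * B.onFace i j x.1
        map_add' := fun c d => by simp [add_mul, Finset.sum_add_distrib]
        map_smul' := fun r c => by simp [mul_assoc, Finset.mul_sum] })
    (fun c => by
      obtain ⟨K, hK⟩ := (isCompact_hull T).exists_bound_of_continuousOn
        (continuous_of_mem_polyFun (sum_mul_mem_polyFun hb.1 c)).continuousOn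
      exact ⟨K, fun x => hK x.1 (elem_subset_hull T x.2)⟩)
  refine ⟨C * vol (faceSimplex T i), mul_pos hC (vol_pos _), fun c K hK x hx => ?_⟩
  refine (h ⟨x, hx⟩ c).trans ?_
  rw [mul_assoc]
  refine mul_le_mul_of_nonneg_left ?_ hC.le
  change ∫ y in elem (faceSimplex T i), elemBubble (faceSimplex T i) y *
    |∑ j, c j * B.onFace i j (faceChart T i y)| ≤ _
  calc _ ≤ ∫ _ in elem (faceSimplex T i), K := by
        refine setIntegral_mono_on (Continuous.integrableOn_elem (by fun_prop) _)
          (continuous_const.integrableOn_elem _) (measurableSet_elem _) fun y hy => ?_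
        exact (mul_le_of_le_one_left (abs_nonneg _) (elemBubble_le_one _ hy)).trans
          (hK _ (faceChart_mem_face T i hy))
    _ = vol (faceSimplex T i) * K := by simp [vol]

theorem face_nonempty (T : Simplex (m + 1)) (i : Fin (m + 2)) : (face T i).Nonempty := by
  obtain ⟨y, hy⟩ := elem_nonempty (faceSimplex T i)
  exact ⟨_, faceChart_mem_face T i hy⟩

theorem exists_stable (B : PolyBases T p) : ∃ M : ℝ, B.Stable M := by
  choose C hC h using exists_face_bound B
  refine ⟨∑ i, C i, fun i c K hK x hx => (h i c K hK x hx).trans ?_⟩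
  obtain ⟨z, hz⟩ := face_nonempty T i
  exact mul_le_mul_of_nonneg_right (Finset.single_le_sum (fun k _ => (hC k).le)
    (Finset.mem_univ i)) ((abs_nonneg _).trans (hK z hz))

/-- The dual functions are sought in the spans of the given bases. In the chart a face bubble is the
element bubble of the lower-dimensional simplex, so `exists_bubble_dual` serves both cases. -/
theorem nonempty_dualSystem (B : PolyBases T p) : Nonempty (DualSystem B) := by
  have h : ∀ i, ∃ a : Fin (dimP p (face T i)) → Fin (dimP p (face T i)) → ℝ, ∀ j k,
      ∫ y in elem (faceSimplex T i), (∑ l, a j l * B.onFace i l (faceChart T i y)) *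
        (elemBubble (faceSimplex T i) y * B.onFace i k (faceChart T i y)) =
          if j = k then area T i else 0 := fun i =>
    exists_bubble_dual (faceSimplex T i)
      (b := fun j y => B.onFace i j (faceChart T i y))
      (fun j => ((B.onFace_basis i).continuous j).comp (continuous_faceChart T i))
      (fun c hc => (B.onFace_basis i).eq_zero_of_chart i hc) (area T i)
  choose a ha using h
  obtain ⟨d, hd⟩ := exists_bubble_dual T (b := B.onElem) (B.onElem_basis.continuous)
    (fun c hc => B.onElem_basis.eq_zero hc) (vol T)
  refine ⟨⟨fun i j x => ∑ l, a i j l * B.onFace i l x, fun j x => ∑ l, d j l * B.onElem l x,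
    fun i j => sum_mul_mem_polyFun (B.onFace_basis i).1 _,
    fun j => sum_mul_mem_polyFun B.onElem_basis.1 _, fun i j k => ?_, fun j k => hd j k⟩⟩
  rw [faceInner_eq, ← ha i j k]
  simp only [PolyBases.etaF, faceBubble_faceChart]

end Face

/-! ### The dual functions span the polynomials -/

section Dual

variable {m p : ℕ} {T : Simplex (m + 1)} {B : PolyBases T p} (D : DualSystem B)

/-- Pairing a vanishing combination with the `k`-th bubble function isolates the `k`-th coefficient
times the area, so the dual functions are independent. By dimension they span, and testing against
them is testing against all polynomials. -/
theorem DualSystem.exists_face_combination (i : Fin (m + 2)) {f : Euc (m + 1) → ℝ}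
    (hf : f ∈ polyFun (m + 1) p) :
    ∃ c : Fin (dimP p (face T i)) → ℝ, ∀ x ∈ face T i, f x = ∑ j, c j * D.onFace i j x := by
  refine exists_eq_sum_of_linearIndependent (D.onFace_mem i) ?_ hf
  rw [Fintype.linearIndependent_iff]
  intro c hc k
  have hzero : ∀ x ∈ face T i, ∑ j, c j * D.onFace i j x = 0 := fun x hx => by
    simpa using congrFun hc ⟨x, hx⟩
  have hD := fun j => continuous_of_mem_polyFun (D.onFace_mem i j)
  have hB := continuous_of_mem_polyFun ((B.onFace_basis i).1 k)
  have h1 : faceInner T i (fun x => ∑ j, c j * D.onFace i j x) (B.etaF i k) =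
      ∑ j, c j * faceInner T i (D.onFace i j) (B.etaF i k) := by
    simp only [faceInner_eq, PolyBases.etaF, faceBubble_faceChart, Finset.sum_mul]
    rw [integral_finsetSum _ fun j _ => Continuous.integrableOn_elem (by fun_prop) _]
    simp only [mul_assoc, integral_const_mul]
  have h2 : faceInner T i (fun x => ∑ j, c j * D.onFace i j x) (B.etaF i k) =
      faceInner T i 0 (B.etaF i k) := faceInner_congr T i hzero fun _ _ => rfl
  rw [h1] at h2
  simp only [D.onFace_dual, mul_ite, mul_zero, Finset.sum_ite_eq', Finset.mem_univ, if_true,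
    faceInner_eq, Pi.zero_apply, zero_mul, integral_zero] at h2
  exact (mul_eq_zero.1 h2).resolve_right (area_pos T i).ne'

theorem DualSystem.exists_elem_combination {f : Euc (m + 1) → ℝ} (hf : f ∈ polyFun (m + 1) p) :
    ∃ c : Fin (dimP p (elem T)) → ℝ, ∀ x ∈ elem T, f x = ∑ j, c j * D.onElem j x := by
  refine exists_eq_sum_of_linearIndependent D.onElem_mem ?_ hf
  rw [Fintype.linearIndependent_iff]
  intro c hc k
  have hzero : ∀ x ∈ elem T, ∑ j, c j * D.onElem j x = 0 := fun x hx => by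
    simpa using congrFun hc ⟨x, hx⟩
  have hD := fun j => continuous_of_mem_polyFun (D.onElem_mem j)
  have hB := continuous_of_mem_polyFun (B.onElem_basis.1 k)
  have h1 : elemInner T (fun x => ∑ j, c j * D.onElem j x) (B.etaT k) =
      ∑ j, c j * elemInner T (D.onElem j) (B.etaT k) := by
    simp only [elemInner, PolyBases.etaT, Finset.sum_mul]
    rw [integral_finsetSum _ fun j _ => Continuous.integrableOn_elem (by fun_prop) _]
    simp only [mul_assoc, integral_const_mul]
  have h2 : elemInner T (fun x => ∑ j, c j * D.onElem j x) (B.etaT k) = 0 := by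
    rw [elemInner, setIntegral_congr_fun (g := fun _ => (0 : ℝ)) (measurableSet_elem T)
      fun x hx => by simp only [hzero x hx, zero_mul]]
    simp
  rw [h1] at h2
  simp only [D.onElem_dual, mul_ite, mul_zero, Finset.sum_ite_eq', Finset.mem_univ, if_true] at h2
  exact (mul_eq_zero.1 h2).resolve_right (vol_pos T).ne'

end Dual

theorem sq_eLpNorm_two {X E : Type*} [MeasurableSpace X] [NormedAddCommGroup E] (μ : Measure X)
    (f : X → E) : eLpNorm f 2 μ ^ 2 = ∫⁻ x, ‖f x‖ₑ ^ 2 ∂μ := by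
  have h := eLpNorm_nnreal_pow_eq_lintegral (μ := μ) (f := f) (p := 2) two_ne_zero
  simpa using h

/-! ### Contracted mollification: bounds and derivatives -/

section Mollify

variable {n : ℕ}

/-- Contraction towards `z` followed by convolution with a bump function. -/
noncomputable def mollify (ρ : ContDiffBump (0 : Euc n)) (z : Euc n) (ε : ℝ) (F : Euc n → ℝ)
    (x : Euc n) : ℝ :=
  ∫ t, F t * ρ.normed volume ((1 - ε) • x + ε • z - t)

variable (ρ : ContDiffBump (0 : Euc n)) (z : Euc n) {ε : ℝ}

theorem mollify_eq (ε : ℝ) (F : Euc n → ℝ) (x : Euc n) : mollify ρ z ε F x =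
    ∫ y, F ((1 - ε) • x + ε • z - y) * ρ.normed volume y := by
  rw [mollify, ← integral_sub_left_eq_self _ volume ((1 - ε) • x + ε • z)]
  simp only [sub_sub_cancel]

theorem lintegral_comp_affine (hε : ε < 1) (w : Euc n) {G : Euc n → ENNReal}
    (hG : Measurable G) : ∫⁻ x, G ((1 - ε) • x + w) =
      ENNReal.ofReal (((1 - ε) ^ n)⁻¹) * ∫⁻ x, G x := by
  have h1 : (1 - ε) ≠ 0 := by linarith
  have h2 := Measure.map_addHaar_smul (volume : Measure (Euc n)) h1
  have h3 : ∫⁻ x, G ((1 - ε) • x + w) =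
      ∫⁻ x, G (x + w) ∂(Measure.map ((1 - ε) • ·) (volume : Measure (Euc n))) := by
    rw [lintegral_map (by fun_prop) (by fun_prop)]
  rw [h3, h2, lintegral_smul_measure, lintegral_add_right_eq_self, finrank_euclideanSpace_fin,
    abs_of_pos (by have : 0 < 1 - ε := by linarith
                   positivity)]
  rfl

theorem enorm_mollify_sq_le (ε : ℝ) {F : Euc n → ℝ} (hF : Measurable F) (x : Euc n) :
    ‖mollify ρ z ε F x‖ₑ ^ 2 ≤ ∫⁻ y, ‖F ((1 - ε) • x + ε • z - y)‖ₑ ^ 2 ∂(volume.withDensity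
      fun y => ENNReal.ofReal (ρ.normed volume y)) := by
  set P := (volume : Measure (Euc n)).withDensity fun y => ENNReal.ofReal (ρ.normed volume y)
    with hP
  have hψ : Measurable fun y => ENNReal.ofReal (ρ.normed volume y) :=
    ρ.continuous_normed.measurable.ennreal_ofReal
  have : IsProbabilityMeasure P := ⟨by
    rw [hP, withDensity_apply _ MeasurableSet.univ, Measure.restrict_univ,
      ← ofReal_integral_eq_lintegral_ofReal ρ.integrable_normed
        (Eventually.of_forall ρ.nonneg_normed), ρ.integral_normed, ENNReal.ofReal_one]⟩
  have hm : Measurable fun y => F ((1 - ε) • x + ε • z - y) := by fun_prop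
  have h1 : ‖mollify ρ z ε F x‖ₑ ≤ ∫⁻ y, ‖F ((1 - ε) • x + ε • z - y)‖ₑ ∂P := by
    rw [mollify_eq, hP, lintegral_withDensity_eq_lintegral_mul _ hψ hm.enorm]
    refine (enorm_integral_le_lintegral_enorm _).trans_eq (lintegral_congr fun y => ?_)
    rw [enorm_mul, mul_comm, Pi.mul_apply, Real.enorm_eq_ofReal (ρ.nonneg_normed y)]
  -- Jensen's inequality in the form that the `L¹` norm is at most the `L²` norm for a probability
  -- measure.
  rw [← sq_eLpNorm_two, ← eLpNorm_one_eq_lintegral_enorm] at *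
  gcongr
  exact h1.trans (eLpNorm_le_eLpNorm_of_exponent_le (by norm_num) hm.aestronglyMeasurable)

/-- Averaging does not increase the norm; the contraction costs the Jacobian factor, which stays
bounded for `ε ≤ 1/2`. -/
theorem eLpNorm_mollify_le (hε : ε < 1) {F : Euc n → ℝ} (hF : Measurable F) :
    eLpNorm (mollify ρ z ε F) 2 volume ^ 2 ≤
      ENNReal.ofReal (((1 - ε) ^ n)⁻¹) * eLpNorm F 2 volume ^ 2 := by
  rw [sq_eLpNorm_two, sq_eLpNorm_two]
  set P := (volume : Measure (Euc n)).withDensity fun y => ENNReal.ofReal (ρ.normed volume y)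
    with hP
  have hψ : Measurable fun y => ENNReal.ofReal (ρ.normed volume y) :=
    ρ.continuous_normed.measurable.ennreal_ofReal
  have hPu : P Set.univ = 1 := by
    rw [hP, withDensity_apply _ MeasurableSet.univ, Measure.restrict_univ,
      ← ofReal_integral_eq_lintegral_ofReal ρ.integrable_normed
        (Eventually.of_forall ρ.nonneg_normed), ρ.integral_normed, ENNReal.ofReal_one]
  refine (lintegral_mono fun x => enorm_mollify_sq_le ρ z ε hF x).trans ?_
  rw [lintegral_lintegral_swap (by fun_prop)]
  have h : ∀ y, ∫⁻ x, ‖F ((1 - ε) • x + ε • z - y)‖ₑ ^ 2 =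
      ENNReal.ofReal (((1 - ε) ^ n)⁻¹) * ∫⁻ x, ‖F x‖ₑ ^ 2 := fun y => by
    have := lintegral_comp_affine hε (ε • z - y) (G := fun x => ‖F x‖ₑ ^ 2) (by fun_prop)
    simpa only [add_sub_assoc] using this
  simp only [h]
  rw [lintegral_const, hPu, mul_one]

theorem mollify_sub (ε : ℝ) {F G : Euc n → ℝ} (hF : LocallyIntegrable F)
    (hG : LocallyIntegrable G) (x : Euc n) :
    mollify ρ z ε (F - G) x = mollify ρ z ε F x - mollify ρ z ε G x := by
  have h : ∀ F : Euc n → ℝ, LocallyIntegrable F →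
      Integrable fun t => F t * ρ.normed volume ((1 - ε) • x + ε • z - t) := fun F hF =>
    ρ.hasCompactSupport_normed.convolutionExists_right (ContinuousLinearMap.mul ℝ ℝ) hF
      ρ.continuous_normed _
  rw [mollify, mollify, mollify, ← integral_sub (h F hF) (h G hG)]
  simp only [Pi.sub_apply, sub_mul]

theorem contDiff_mollify (ε : ℝ) {F : Euc n → ℝ} (hF : LocallyIntegrable F) :
    ContDiff ℝ 1 (mollify ρ z ε F) := by
  have h := ρ.hasCompactSupport_normed (μ := volume).contDiff_convolution_right
    (ContinuousLinearMap.mul ℝ ℝ) hF (ρ.contDiff_normed (n := 1))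
  have h2 : ContDiff ℝ 1 fun x : Euc n => (1 - ε) • x + ε • z := by fun_prop
  exact h.comp h2

theorem fderiv_mollify (ε : ℝ) {F : Euc n → ℝ} (hF : LocallyIntegrable F) (x e : Euc n) :
    fderiv ℝ (mollify ρ z ε F) x e = (1 - ε) *
      ∫ t, F t * fderiv ℝ (ρ.normed volume) ((1 - ε) • x + ε • z - t) e := by
  have h := ρ.hasCompactSupport_normed (μ := volume).hasFDerivAt_convolution_right
    (ContinuousLinearMap.mul ℝ ℝ) hF (ρ.contDiff_normed (n := 1)) ((1 - ε) • x + ε • z)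
  have h2 : HasFDerivAt (fun x : Euc n => (1 - ε) • x + ε • z)
      ((1 - ε) • ContinuousLinearMap.id ℝ (Euc n)) x :=
    ((hasFDerivAt_id x).const_smul (1 - ε)).add_const _
  have h3 := h.comp x h2
  rw [show mollify ρ z ε F = (convolution F (ρ.normed volume) (ContinuousLinearMap.mul ℝ ℝ)
    volume) ∘ (fun x : Euc n => (1 - ε) • x + ε • z) from rfl, h3.fderiv]
  simp only [ContinuousLinearMap.comp_apply, smul_apply, ContinuousLinearMap.id_apply, map_smul,
    smul_eq_mul]
  congr 1
  rw [convolution_precompR_apply _ hF ((ρ.hasCompactSupport_normed).fderiv ℝ)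
    ((ρ.contDiff_normed (n := 1)).continuous_fderiv one_ne_zero)]
  rfl

end Mollify

/-! ### Convergence of the contracted mollifications -/

section Approx

variable {n : ℕ} {T : Simplex n} {z : Euc n} {r ε : ℝ}

/-- Such a `w` is a convex combination of `x` and a point of the ball around `z`. Contraction by `ε`
thus makes room for a kernel of radius `ε r`, so that only values inside the element are sampled. -/
theorem contraction_mem_elem (hr : Metric.closedBall z r ⊆ elem T) (hε : 0 < ε) (hε1 : ε < 1)
    {x w : Euc n} (hx : x ∈ elem T) (hw : ‖w - ((1 - ε) • x + ε • z)‖ ≤ ε * r) : w ∈ elem T := by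
  set d := w - ((1 - ε) • x + ε • z) with hd
  have h1 : z + ε⁻¹ • d ∈ elem T := hr (by
    rw [Metric.mem_closedBall, dist_eq_norm, add_sub_cancel_left, norm_smul, norm_inv,
      Real.norm_eq_abs, abs_of_pos hε, inv_mul_le_iff₀ hε]
    exact hw)
  have h2 := convex_elem T hx h1 (by linarith : 0 ≤ 1 - ε) hε.le (by ring)
  have h3 : (1 - ε) • x + ε • (z + ε⁻¹ • d) = w := by
    rw [smul_add, smul_inv_smul₀ hε.ne', hd]; abel
  rwa [h3] at h2

variable (ρ : ContDiffBump (0 : Euc n))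

theorem mollify_sub_le (hr : Metric.closedBall z r ⊆ elem T) (hε : 0 < ε) (hε1 : ε < 1)
    (hρ : ρ.rOut = ε * r) {g : Euc n → ℝ} (hg : Continuous g) {δ η : ℝ}
    (hu : ∀ a b : Euc n, dist a b < δ → dist (g a) (g b) < η)
    (hδ : ε * (size T + r) < δ) {x : Euc n} (hx : x ∈ elem T) :
    ‖mollify ρ z ε ((elem T).indicator g) x - g x‖ ≤ η := by
  have hz : z ∈ elem T := hr (Metric.mem_closedBall_self (by
    have := ρ.rOut_pos
    rw [hρ] at this
    exact (pos_of_mul_pos_right this hε.le).le))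
  have hlt : ∀ y, ρ.normed volume y ≠ 0 → ‖y‖ < ε * r := fun y hy => by
    have : y ∈ Function.support (ρ.normed volume) := hy
    rw [ρ.support_normed_eq, hρ, Metric.mem_ball, dist_zero_right] at this
    exact this
  have hind : ∀ y, (elem T).indicator g ((1 - ε) • x + ε • z - y) * ρ.normed volume y =
      g ((1 - ε) • x + ε • z - y) * ρ.normed volume y := fun y => by
    by_cases hy : ρ.normed volume y = 0
    · rw [hy, mul_zero, mul_zero]
    · rw [Set.indicator_of_mem]
      refine contraction_mem_elem hr hε hε1 hx ?_
      rw [sub_sub_cancel_left, norm_neg]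
      exact (hlt y hy).le
  have hgx : g x = ∫ y, g x * ρ.normed volume y := by
    rw [integral_const_mul, ρ.integral_normed, mul_one]
  have hi : Integrable fun y => g ((1 - ε) • x + ε • z - y) * ρ.normed volume y := by
    have hc := ρ.continuous_normed (μ := volume)
    exact Continuous.integrable_of_hasCompactSupport (by fun_prop)
      ρ.hasCompactSupport_normed.mul_left
  rw [mollify_eq]
  simp_rw [hind]
  rw [hgx, ← integral_sub hi (ρ.integrable_normed.const_mul _)]
  calc ‖∫ y, (g ((1 - ε) • x + ε • z - y) * ρ.normed volume y - g x * ρ.normed volume y)‖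
      ≤ ∫ y, η * ρ.normed volume y := by
        refine norm_integral_le_of_norm_le (ρ.integrable_normed.const_mul _)
          (Eventually.of_forall fun y => ?_)
        rw [← sub_mul, norm_mul, Real.norm_of_nonneg (ρ.nonneg_normed y)]
        by_cases hy : ρ.normed volume y = 0
        · rw [hy, mul_zero, mul_zero]
        · refine mul_le_mul_of_nonneg_right ?_ (ρ.nonneg_normed y)
          rw [← dist_eq_norm]
          refine (hu _ _ (lt_of_le_of_lt ?_ hδ)).le
          rw [dist_eq_norm]
          have h1 : (1 - ε) • x + ε • z - y - x = ε • (z - x) - y := by module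
          rw [h1]
          refine (norm_sub_le _ _).trans ?_
          rw [norm_smul, Real.norm_eq_abs, abs_of_pos hε, mul_add]
          exact add_le_add (mul_le_mul_of_nonneg_left (norm_sub_le_size T
            (elem_subset_hull T hz) (elem_subset_hull T hx)) hε.le) (hlt y hy).le
    _ = η := by rw [integral_const_mul, ρ.integral_normed, mul_one]

/-- Uniformly bounded operators that converge on a dense class: `f` is approximated in `L²` by a
continuous `g` of compact support, for which the convergence is uniform. -/
theorem tendsto_mollify (hr : Metric.closedBall z r ⊆ elem T)
    {ρ : ℕ → ContDiffBump (0 : Euc n)} {ε : ℕ → ℝ} (hε : ∀ k, 0 < ε k) (hε2 : ∀ k, ε k ≤ 1 / 2)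
    (hε0 : Tendsto ε atTop (𝓝 0)) (hρ : ∀ k, (ρ k).rOut = ε k * r) {f : Euc n → ℝ}
    (hf : Measurable f) (hf2 : MemLp f 2 (volume.restrict (elem T))) :
    Tendsto (fun k => eLpNorm (fun x => mollify (ρ k) z (ε k) ((elem T).indicator f) x - f x) 2
      (volume.restrict (elem T))) atTop (𝓝 0) := by
  set μ := (volume : Measure (Euc n)).restrict (elem T) with hμ
  have hloc : ∀ f : Euc n → ℝ, MemLp f 2 μ → LocallyIntegrable ((elem T).indicator f) :=
    fun f hf => ((integrable_indicator_iff (measurableSet_elem T)).2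
      (hf.integrable one_le_two)).locallyIntegrable
  set K : ENNReal := ENNReal.ofReal (2 ^ n) + 2 + μ Set.univ with hK
  have hKt : K ≠ ⊤ := by
    rw [hK]; exact ENNReal.add_ne_top.2 ⟨by finiteness, measure_ne_top _ _⟩
  have hK0 : K ≠ 0 := by rw [hK]; simp
  -- The summands stem from the mollification of `f - g` (`2 ^ n`), from `g - f` (`1`), and from the
  -- uniform error for `g`, where the root of the measure of the element is at most one plus this
  -- measure.
  suffices H : ∀ η : ℝ, 0 < η → ∀ᶠ k in atTop, eLpNorm (fun x =>
      mollify (ρ k) z (ε k) ((elem T).indicator f) x - f x) 2 μ ≤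
        ENNReal.ofReal η * (ENNReal.ofReal (2 ^ n) + 1 + (1 + μ Set.univ)) by
    rw [ENNReal.tendsto_nhds_zero]
    intro a ha
    rcases eq_or_ne a ⊤ with rfl | hat
    · exact Eventually.of_forall fun _ => le_top
    have hKr : 0 < K.toReal := ENNReal.toReal_pos hK0 hKt
    have har : 0 < a.toReal := ENNReal.toReal_pos ha.ne' hat
    filter_upwards [H (a.toReal / K.toReal) (div_pos har hKr)] with k hk
    refine hk.trans_eq ?_
    have hKe : ENNReal.ofReal (2 ^ n) + 1 + (1 + μ Set.univ) = K := by
      rw [hK, ← one_add_one_eq_two]; ring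
    rw [hKe, ENNReal.ofReal_div_of_pos hKr, ENNReal.ofReal_toReal hat, ENNReal.ofReal_toReal hKt,
      ENNReal.div_mul_cancel hK0 hKt]
  intro η hη
  obtain ⟨g, hgs, hfg, hgc, hg2⟩ := hf2.exists_hasCompactSupport_eLpNorm_sub_le
    ENNReal.ofNat_ne_top (ε := ENNReal.ofReal η) (by simpa using hη)
  obtain ⟨δ, hδ, hu⟩ := Metric.uniformContinuous_iff.1
    (hgs.uniformContinuous_of_continuous hgc) η hη
  have hev : ∀ᶠ k in atTop, ε k * (size T + r) < δ := by
    have : Tendsto (fun k => ε k * (size T + r)) atTop (𝓝 (0 * (size T + r))) :=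
      hε0.mul_const _
    rw [zero_mul] at this
    exact this.eventually_lt_const hδ
  filter_upwards [hev] with k hk
  have hε1 : ε k < 1 := by linarith [hε2 k]
  have hdec : (fun x => mollify (ρ k) z (ε k) ((elem T).indicator f) x - f x) =
      mollify (ρ k) z (ε k) ((elem T).indicator (f - g)) +
        ((fun x => mollify (ρ k) z (ε k) ((elem T).indicator g) x - g x) + (g - f)) := by
    funext x
    rw [Set.indicator_sub', Pi.add_apply, Pi.add_apply,
      mollify_sub _ _ _ (hloc f hf2) (hloc g hg2)]
    simp only [Pi.sub_apply]; ring
  have hm1 : AEStronglyMeasurable (mollify (ρ k) z (ε k) ((elem T).indicator (f - g))) μ :=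
    (contDiff_mollify _ _ _ (hloc _ (hf2.sub hg2))).continuous.aestronglyMeasurable
  have hm2 : AEStronglyMeasurable
      (fun x => mollify (ρ k) z (ε k) ((elem T).indicator g) x - g x) μ :=
    ((contDiff_mollify _ _ _ (hloc _ hg2)).continuous.sub hgc).aestronglyMeasurable
  have hm3 : AEStronglyMeasurable (g - f) μ := (hg2.sub hf2).1
  have hpow : (1 : ℝ) ≤ 2 ^ n := one_le_pow₀ one_le_two
  have b1 : eLpNorm (mollify (ρ k) z (ε k) ((elem T).indicator (f - g))) 2 μ ≤
      ENNReal.ofReal η * ENNReal.ofReal (2 ^ n) := by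
    have hmeas : Measurable ((elem T).indicator (f - g)) :=
      (hf.sub hgc.measurable).indicator (measurableSet_elem T)
    have h1 := eLpNorm_mollify_le (ρ k) z hε1 hmeas
    have h2 : eLpNorm ((elem T).indicator (f - g)) 2 volume ≤ ENNReal.ofReal η := by
      rwa [eLpNorm_indicator_eq_eLpNorm_restrict (measurableSet_elem T)]
    have h3 : ((1 - ε k) ^ n)⁻¹ ≤ (2 : ℝ) ^ n := by
      rw [← inv_pow]
      refine pow_le_pow_left₀ (inv_nonneg.2 (by linarith)) ?_ n
      rw [inv_le_comm₀ (by linarith) two_pos]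
      linarith [hε2 k]
    have h4 : eLpNorm (mollify (ρ k) z (ε k) ((elem T).indicator (f - g))) 2 μ ^ 2 ≤
        (ENNReal.ofReal η * ENNReal.ofReal (2 ^ n)) ^ 2 := by
      calc _ ≤ eLpNorm (mollify (ρ k) z (ε k) ((elem T).indicator (f - g))) 2 volume ^ 2 := by
            gcongr; exact Measure.restrict_le_self
        _ ≤ ENNReal.ofReal (2 ^ n) * ENNReal.ofReal η ^ 2 := by
            refine h1.trans ?_
            gcongr
        _ ≤ ENNReal.ofReal (2 ^ n) ^ 2 * ENNReal.ofReal η ^ 2 := by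
            gcongr
            rw [sq]
            exact le_mul_of_one_le_left' (by
              rw [← ENNReal.ofReal_one]; exact ENNReal.ofReal_le_ofReal hpow)
        _ = _ := by rw [mul_pow, mul_comm]
    exact (ENNReal.pow_le_pow_left_iff two_ne_zero).1 h4
  have b2 : eLpNorm (fun x => mollify (ρ k) z (ε k) ((elem T).indicator g) x - g x) 2 μ ≤
      ENNReal.ofReal η * (1 + μ Set.univ) := by
    have h1 := eLpNorm_le_of_ae_bound (p := 2) (μ := μ)
      (ae_restrict_of_forall_mem (measurableSet_elem T) fun x hx =>
        mollify_sub_le (ρ k) hr (hε k) hε1 (hρ k) hgc (fun a b => @hu a b) hk hx)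
    refine h1.trans ?_
    rw [mul_comm]
    gcongr
    rcases le_total (μ Set.univ) 1 with h | h
    · exact (ENNReal.rpow_le_one h (by simp)).trans le_self_add
    · refine (ENNReal.rpow_le_rpow_of_exponent_le h (z := 1) (by norm_num)).trans ?_
      rw [ENNReal.rpow_one]
      exact le_add_self
  have b3 : eLpNorm (g - f) 2 μ ≤ ENNReal.ofReal η := by
    rwa [eLpNorm_sub_comm]
  rw [hdec]
  refine (eLpNorm_add_le hm1 (hm2.add hm3) one_le_two).trans ?_
  refine (add_le_add b1 ((eLpNorm_add_le hm2 hm3 one_le_two).trans (add_le_add b2 b3))).trans_eq ?_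
  ring

end Approx

/-! ### Inner products and limits in `L²` -/

section L2

variable {X E : Type*} [MeasurableSpace X] {μ : Measure X} [NormedAddCommGroup E]

theorem toReal_eLpNorm_add_le {f g : X → E} (hf : MemLp f 2 μ) (hg : MemLp g 2 μ) :
    (eLpNorm (f + g) 2 μ).toReal ≤ (eLpNorm f 2 μ).toReal + (eLpNorm g 2 μ).toReal := by
  rw [← ENNReal.toReal_add hf.2.ne hg.2.ne]
  exact ENNReal.toReal_mono (ENNReal.add_ne_top.2 ⟨hf.2.ne, hg.2.ne⟩)
    (eLpNorm_add_le hf.1 hg.1 one_le_two)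

theorem toReal_eLpNorm_sub_le {f g : X → E} (hf : MemLp f 2 μ) (hg : MemLp g 2 μ) :
    (eLpNorm (f - g) 2 μ).toReal ≤ (eLpNorm f 2 μ).toReal + (eLpNorm g 2 μ).toReal := by
  rw [sub_eq_add_neg, ← eLpNorm_neg g]
  exact toReal_eLpNorm_add_le hf hg.neg

theorem tendsto_toReal_eLpNorm {φ : ℕ → X → E} {v : X → E} (hφ : ∀ k, MemLp (φ k) 2 μ)
    (hv : MemLp v 2 μ) (h : Tendsto (fun k => eLpNorm (fun x => φ k x - v x) 2 μ) atTop (𝓝 0)) :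
    Tendsto (fun k => (eLpNorm (φ k) 2 μ).toReal) atTop (𝓝 (eLpNorm v 2 μ).toReal) := by
  have h0 := (ENNReal.tendsto_toReal ENNReal.zero_ne_top).comp h
  rw [ENNReal.toReal_zero] at h0
  rw [tendsto_iff_dist_tendsto_zero]
  refine squeeze_zero (fun _ => dist_nonneg) (fun k => ?_) h0
  rw [Real.dist_eq, abs_le]
  have h1 : (eLpNorm (φ k) 2 μ).toReal ≤
      (eLpNorm (φ k - v) 2 μ).toReal + (eLpNorm v 2 μ).toReal := by
    simpa using toReal_eLpNorm_add_le ((hφ k).sub hv) hv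
  have h2 : (eLpNorm v 2 μ).toReal ≤
      (eLpNorm (φ k) 2 μ).toReal + (eLpNorm (φ k - v) 2 μ).toReal := by
    simpa using toReal_eLpNorm_sub_le (hφ k) ((hφ k).sub hv)
  change _ ≤ _ ∧ _ ≤ (eLpNorm (φ k - v) 2 μ).toReal
  constructor
  · change -(eLpNorm (φ k - v) 2 μ).toReal ≤ _
    linarith
  · linarith

variable [InnerProductSpace ℝ E]

theorem integrable_inner {f g : X → E} (hf : MemLp f 2 μ) (hg : MemLp g 2 μ) :
    Integrable (fun x => inner ℝ (f x) (g x)) μ := by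
  refine (L2.integrable_inner (𝕜 := ℝ) (hf.toLp f) (hg.toLp g)).congr ?_
  filter_upwards [hf.coeFn_toLp, hg.coeFn_toLp] with x h1 h2
  rw [h1, h2]

theorem abs_integral_inner_le {f g : X → E} (hf : MemLp f 2 μ) (hg : MemLp g 2 μ) :
    |∫ x, inner ℝ (f x) (g x) ∂μ| ≤ (eLpNorm f 2 μ).toReal * (eLpNorm g 2 μ).toReal := by
  have h : ∫ x, inner ℝ (f x) (g x) ∂μ = inner ℝ (hf.toLp f) (hg.toLp g) := by
    rw [L2.inner_def]
    refine integral_congr_ae ?_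
    filter_upwards [hf.coeFn_toLp, hg.coeFn_toLp] with x h1 h2
    rw [h1, h2]
  rw [h, ← Lp.norm_toLp f hf, ← Lp.norm_toLp g hg]
  exact abs_real_inner_le_norm _ _

theorem toReal_eLpNorm_sq {f : X → E} (hf : MemLp f 2 μ) :
    (eLpNorm f 2 μ).toReal ^ 2 = ∫ x, ‖f x‖ ^ 2 ∂μ := by
  rw [← Lp.norm_toLp f hf, ← real_inner_self_eq_norm_sq, L2.inner_def]
  refine integral_congr_ae ?_
  filter_upwards [hf.coeFn_toLp] with x h1
  rw [h1, real_inner_self_eq_norm_sq]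

theorem abs_integral_mul_le {f g : X → ℝ} (hf : MemLp f 2 μ) (hg : MemLp g 2 μ) :
    |∫ x, f x * g x ∂μ| ≤ (eLpNorm f 2 μ).toReal * (eLpNorm g 2 μ).toReal := by
  have h := abs_integral_inner_le hg hf
  rw [mul_comm]
  simpa using h

theorem tendsto_integral_inner {a : X → E} (ha : MemLp a 2 μ) {φ : ℕ → X → E} {v : X → E}
    (hφ : ∀ k, MemLp (φ k) 2 μ) (hv : MemLp v 2 μ)
    (h : Tendsto (fun k => eLpNorm (fun x => φ k x - v x) 2 μ) atTop (𝓝 0)) :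
    Tendsto (fun k => ∫ x, inner ℝ (a x) (φ k x) ∂μ) atTop (𝓝 (∫ x, inner ℝ (a x) (v x) ∂μ)) := by
  have h0 := ((ENNReal.tendsto_toReal ENNReal.zero_ne_top).comp h).const_mul (eLpNorm a 2 μ).toReal
  rw [ENNReal.toReal_zero, mul_zero] at h0
  rw [tendsto_iff_dist_tendsto_zero]
  refine squeeze_zero (fun _ => dist_nonneg) (fun k => ?_) h0
  rw [Real.dist_eq, ← integral_sub (integrable_inner ha (hφ k)) (integrable_inner ha hv)]
  simp_rw [← inner_sub_right]
  exact abs_integral_inner_le ha ((hφ k).sub hv)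

theorem tendsto_integral_mul {a : X → ℝ} (ha : MemLp a 2 μ) {φ : ℕ → X → ℝ} {v : X → ℝ}
    (hφ : ∀ k, MemLp (φ k) 2 μ) (hv : MemLp v 2 μ)
    (h : Tendsto (fun k => eLpNorm (fun x => φ k x - v x) 2 μ) atTop (𝓝 0)) :
    Tendsto (fun k => ∫ x, a x * φ k x ∂μ) atTop (𝓝 (∫ x, a x * v x ∂μ)) := by
  have := tendsto_integral_inner ha hφ hv h
  simpa [mul_comm] using this

end L2

theorem gradient_apply {n : ℕ} (f : Euc n → ℝ) (x : Euc n) (k : Fin n) :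
    gradient f x k = fderiv ℝ f x (EuclideanSpace.single k 1) := by
  have h : inner ℝ (gradient f x) (EuclideanSpace.single k (1 : ℝ)) =
      fderiv ℝ f x (EuclideanSpace.single k 1) := by
    rw [gradient, InnerProductSpace.toDual_symm_apply]
  rw [← h, EuclideanSpace.inner_single_right]
  simp

theorem inner_gradient {n : ℕ} (f : Euc n → ℝ) (x e : Euc n) :
    inner ℝ (gradient f x) e = fderiv ℝ f x e := by
  rw [gradient, InnerProductSpace.toDual_symm_apply]

theorem _root_.ContDiff.continuous_gradient {n : ℕ} {f : Euc n → ℝ} (hf : ContDiff ℝ 1 f) :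
    Continuous (gradient f) :=
  (InnerProductSpace.toDual ℝ (Euc n)).symm.continuous.comp (hf.continuous_fderiv one_ne_zero)

theorem gradient_sub_of_contDiff {n : ℕ} {f g : Euc n → ℝ} (hf : ContDiff ℝ 1 f)
    (hg : ContDiff ℝ 1 g) (x : Euc n) :
    gradient (fun x => f x - g x) x = gradient f x - gradient g x := by
  rw [gradient, gradient, gradient, fderiv_fun_sub (hf.differentiable one_ne_zero x)
    (hg.differentiable one_ne_zero x), map_sub]

/-! ### Weak gradients and density of `C¹` functions in `H¹(T)` -/

section WeakGrad

variable {n : ℕ} {T : Simplex n}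

theorem _root_.Continuous.memLp_elem {E : Type*} [NormedAddCommGroup E]
    {f : Euc n → E} (hf : Continuous f) (T : Simplex n) :
    MemLp f 2 (volume.restrict (elem T)) := by
  obtain ⟨K, hK⟩ := (isCompact_hull T).exists_bound_of_continuousOn hf.continuousOn
  exact MemLp.of_bound hf.aestronglyMeasurable K
    (ae_restrict_of_forall_mem (measurableSet_elem T) fun x hx => hK x (elem_subset_hull T hx))

theorem integrable_mul_continuous {v a : Euc n → ℝ} (hv : MemLp v 2 (volume.restrict (elem T)))
    (ha : Continuous a) : Integrable (fun x => v x * a x) (volume.restrict (elem T)) := by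
  have := integrable_inner (ha.memLp_elem T) hv
  simpa using this

theorem memLp_coordinate {E : Set (Euc n)} {g : Euc n → Euc n} (hg : MemLp g 2 (volume.restrict E))
    (k : Fin n) : MemLp (fun x => g x k) 2 (volume.restrict E) :=
  (EuclideanSpace.proj k : Euc n →L[ℝ] ℝ).comp_memLp' hg

theorem continuous_gradient_apply {φ : Euc n → ℝ} (hφ : ContDiff ℝ 1 φ) (k : Fin n) :
    Continuous fun x => gradient φ x k :=
  (EuclideanSpace.proj k : Euc n →L[ℝ] ℝ).continuous.comp hφ.continuous_gradient

theorem IsWeakGrad.sub {v w : Euc n → ℝ} {g h : Euc n → Euc n} (hv : IsWeakGrad T v g)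
    (hw : IsWeakGrad T w h) (hv2 : MemLp v 2 (volume.restrict (elem T)))
    (hw2 : MemLp w 2 (volume.restrict (elem T))) (hg2 : MemLp g 2 (volume.restrict (elem T)))
    (hh2 : MemLp h 2 (volume.restrict (elem T))) : IsWeakGrad T (v - w) (g - h) := by
  intro φ hφ hc ht k
  have hφ1 : ContDiff ℝ 1 φ := hφ.of_le (by simp)
  have hgc := continuous_gradient_apply hφ1 k
  simp only [Pi.sub_apply, PiLp.sub_apply, sub_mul]
  rw [integral_sub (integrable_mul_continuous hv2 hgc) (integrable_mul_continuous hw2 hgc),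
    integral_sub (integrable_mul_continuous (memLp_coordinate hg2 k) hφ.continuous)
      (integrable_mul_continuous (memLp_coordinate hh2 k) hφ.continuous),
    hv φ hφ hc ht k, hw φ hφ hc ht k]
  ring

theorem IsWeakGrad.unique {v : Euc n → ℝ} {g h : Euc n → Euc n} (hg : IsWeakGrad T v g)
    (hh : IsWeakGrad T v h) (hg2 : MemLp g 2 (volume.restrict (elem T)))
    (hh2 : MemLp h 2 (volume.restrict (elem T))) : g =ᵐ[volume.restrict (elem T)] h := by
  have hk : ∀ k, ∀ᵐ x ∂(volume.restrict (elem T)), g x k - h x k = 0 := fun k => by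
    have hd := (memLp_coordinate hg2 k).sub (memLp_coordinate hh2 k)
    rw [ae_restrict_iff' (measurableSet_elem T)]
    refine (isOpen_elem T).ae_eq_zero_of_integral_contDiff_smul_eq_zero
      (IntegrableOn.locallyIntegrableOn (hd.integrable one_le_two)) fun φ hφ hc ht => ?_
    rw [← setIntegral_eq_integral_of_forall_compl_eq_zero (s := elem T) fun x hx => by
      rw [image_eq_zero_of_notMem_tsupport (mt (@ht x) hx), zero_smul]]
    have h1 := hg φ hφ hc ht k
    rw [hh φ hφ hc ht k, neg_inj] at h1
    simp only [smul_eq_mul, mul_comm (φ _), sub_mul]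
    rw [integral_sub (integrable_mul_continuous (memLp_coordinate hg2 k) hφ.continuous)
      (integrable_mul_continuous (memLp_coordinate hh2 k) hφ.continuous), h1, sub_self]
  filter_upwards [ae_all_iff.2 hk] with x hx
  ext k
  exact sub_eq_zero.1 (hx k)

theorem isWeakGrad_gradient {f : Euc n → ℝ} (hf : ContDiff ℝ 1 f) :
    IsWeakGrad T f (gradient f) := by
  intro φ hφ hc ht k
  have hφ1 : ContDiff ℝ 1 φ := hφ.of_le (by simp)
  have hfc := hf.continuous
  have hfd := hf.continuous_fderiv one_ne_zero
  have hφc := hφ.continuous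
  have hφd := hφ1.continuous_fderiv one_ne_zero
  simp only [gradient_apply]
  rw [setIntegral_eq_integral_of_forall_compl_eq_zero fun x hx => by
      rw [fderiv_of_notMem_tsupport ℝ (mt (@ht x) hx)]; simp,
    setIntegral_eq_integral_of_forall_compl_eq_zero fun x hx => by
      rw [image_eq_zero_of_notMem_tsupport (mt (@ht x) hx), mul_zero]]
  refine integral_mul_fderiv_eq_neg_fderiv_mul_of_integrable ?_ ?_ ?_
    (fun x _ => hf.differentiable one_ne_zero x) (fun x _ => hφ1.differentiable one_ne_zero x)
  · exact Continuous.integrable_of_hasCompactSupport (by fun_prop) hc.mul_left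
  · exact Continuous.integrable_of_hasCompactSupport (by fun_prop)
      (hc.fderiv_apply ℝ _).mul_left
  · exact Continuous.integrable_of_hasCompactSupport (by fun_prop) hc.mul_left

theorem memH1_of_contDiff {f : Euc n → ℝ} (hf : ContDiff ℝ 1 f) : MemH1 T f :=
  ⟨hf.continuous.memLp_elem T, _, hf.continuous_gradient.memLp_elem T, isWeakGrad_gradient hf⟩

theorem MemH1.weakGrad_spec {v : Euc n → ℝ} (hv : MemH1 T v) :
    MemLp (weakGrad T v) 2 (volume.restrict (elem T)) ∧ IsWeakGrad T v (weakGrad T v) := by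
  rw [weakGrad, dif_pos hv.2]
  exact hv.2.choose_spec

theorem weakGrad_ae_eq {v : Euc n → ℝ} {g : Euc n → Euc n}
    (hg2 : MemLp g 2 (volume.restrict (elem T))) (hg : IsWeakGrad T v g)
    (hv : MemLp v 2 (volume.restrict (elem T))) :
    weakGrad T v =ᵐ[volume.restrict (elem T)] g := by
  have h := MemH1.weakGrad_spec (T := T) (v := v) ⟨hv, g, hg2, hg⟩
  exact h.2.unique hg h.1 hg2

theorem MemH1.sub {v w : Euc n → ℝ} (hv : MemH1 T v) (hw : MemH1 T w) : MemH1 T (v - w) :=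
  ⟨hv.1.sub hw.1, _, hv.weakGrad_spec.1.sub hw.weakGrad_spec.1,
    hv.weakGrad_spec.2.sub hw.weakGrad_spec.2 hv.1 hw.1 hv.weakGrad_spec.1 hw.weakGrad_spec.1⟩

theorem weakGrad_sub_ae_eq {v w : Euc n → ℝ} (hv : MemH1 T v) (hw : MemH1 T w) :
    weakGrad T (v - w) =ᵐ[volume.restrict (elem T)] weakGrad T v - weakGrad T w :=
  weakGrad_ae_eq (hv.weakGrad_spec.1.sub hw.weakGrad_spec.1)
    (hv.weakGrad_spec.2.sub hw.weakGrad_spec.2 hv.1 hw.1 hv.weakGrad_spec.1 hw.weakGrad_spec.1)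
    (hv.1.sub hw.1)

theorem weakGrad_contDiff_ae_eq {f : Euc n → ℝ} (hf : ContDiff ℝ 1 f) :
    weakGrad T f =ᵐ[volume.restrict (elem T)] gradient f :=
  weakGrad_ae_eq (hf.continuous_gradient.memLp_elem T) (isWeakGrad_gradient hf)
    (hf.continuous.memLp_elem T)

theorem integral_indicator_mul {F h : Euc n → ℝ} :
    ∫ t, (elem T).indicator F t * h t = ∫ t in elem T, F t * h t := by
  rw [← integral_indicator (measurableSet_elem T)]
  congr 1; funext t
  by_cases ht : t ∈ elem T <;> simp [ht]

/-- For `x` in the element the shifted kernel is supported inside the element and is an admissible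
test function. The derivative thus passes from the kernel to `v`; the chain rule for the contraction
gives `1 - ε`. -/
theorem gradient_mollify {z : Euc n} {r ε : ℝ} (hr : Metric.closedBall z r ⊆ elem T)
    (hε : 0 < ε) (hε1 : ε < 1) {ρ : ContDiffBump (0 : Euc n)} (hρ : ρ.rOut = ε * r)
    {v v' : Euc n → ℝ} {g : Euc n → Euc n} {g' : Fin n → Euc n → ℝ}
    (hvv : v =ᵐ[volume.restrict (elem T)] v')
    (hgg : ∀ k, (fun x => g x k) =ᵐ[volume.restrict (elem T)] g' k)
    (hv' : MemLp v' 2 (volume.restrict (elem T))) (hg : IsWeakGrad T v g) {x : Euc n}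
    (hx : x ∈ elem T) (k : Fin n) :
    gradient (mollify ρ z ε ((elem T).indicator v')) x k =
      (1 - ε) * mollify ρ z ε ((elem T).indicator (g' k)) x := by
  have hloc : LocallyIntegrable ((elem T).indicator v') :=
    ((integrable_indicator_iff (measurableSet_elem T)).2
      (hv'.integrable one_le_two)).locallyIntegrable
  set w := (1 - ε) • x + ε • z with hw
  rw [gradient_apply, fderiv_mollify ρ z ε hloc, mollify, integral_indicator_mul,
    integral_indicator_mul]
  congr 1
  set χ : Euc n → ℝ := fun t => ρ.normed volume (w - t) with hχ
  have hχc : ContDiff ℝ ∞ χ := (ρ.contDiff_normed (n := ⊤)).comp (contDiff_const.sub contDiff_id)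
  have hχs : Function.support χ ⊆ Metric.closedBall w (ε * r) := fun t ht => by
    have h1 : w - t ∈ Function.support (ρ.normed (volume : Measure (Euc n))) := ht
    rw [ρ.support_normed_eq, hρ, Metric.mem_ball, dist_zero_right] at h1
    rw [Metric.mem_closedBall, dist_eq_norm, norm_sub_rev]
    exact h1.le
  have hχt : tsupport χ ⊆ Metric.closedBall w (ε * r) :=
    closure_minimal hχs Metric.isClosed_closedBall
  have hχe : tsupport χ ⊆ elem T := fun t ht => by
    refine contraction_mem_elem hr hε hε1 hx ?_
    have := hχt ht
    rwa [Metric.mem_closedBall, dist_eq_norm] at this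
  have hχcs : HasCompactSupport χ :=
    HasCompactSupport.intro (isCompact_closedBall w (ε * r)) fun t ht => by
      by_contra h
      exact ht (hχs h)
  have hχd : ∀ t, fderiv ℝ χ t (EuclideanSpace.single k 1) =
      -fderiv ℝ (ρ.normed volume) (w - t) (EuclideanSpace.single k 1) := fun t => by
    have h1 : HasFDerivAt (fun t => w - t) (-ContinuousLinearMap.id ℝ (Euc n)) t :=
      (hasFDerivAt_id t).const_sub w
    have h2 := ((ρ.contDiff_normed (μ := volume) (n := 1)).differentiable one_ne_zero
      (w - t)).hasFDerivAt.comp t h1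
    rw [show χ = ρ.normed volume ∘ fun t => w - t from rfl, h2.fderiv]
    simp
  have h := hg χ hχc hχcs hχe k
  simp only [gradient_apply, hχd, mul_neg, integral_neg, neg_inj] at h
  calc _ = ∫ t in elem T, v t * fderiv ℝ (ρ.normed volume) (w - t)
        (EuclideanSpace.single k 1) := by
        refine integral_congr_ae ?_
        filter_upwards [hvv] with t ht
        rw [ht]
    _ = ∫ t in elem T, g t k * χ t := h
    _ = _ := by
        refine integral_congr_ae ?_
        filter_upwards [hgg k] with t ht
        rw [ht]

theorem eLpNorm_le_sum_coordinate {μ : Measure (Euc n)} {f : Euc n → Euc n}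
    (hf : AEStronglyMeasurable f μ) :
    eLpNorm f 2 μ ≤ ∑ k, eLpNorm (fun x => f x k) 2 μ := by
  have h1 : eLpNorm f 2 μ ≤ eLpNorm (∑ k, fun x => ‖f x k‖) 2 μ := by
    refine eLpNorm_mono_real fun x => ?_
    rw [Finset.sum_apply]
    have h2 : f x = ∑ k, EuclideanSpace.single k (f x k) := by
      ext j
      simp
    conv_lhs => rw [h2]
    refine (norm_sum_le _ _).trans_eq ?_
    simp
  refine h1.trans ((eLpNorm_sum_le (fun k _ => ?_) one_le_two).trans_eq ?_)
  · exact ((EuclideanSpace.proj k : Euc n →L[ℝ] ℝ).continuous.comp_aestronglyMeasurable hf).norm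
  · simp only [eLpNorm_norm]

theorem MemH1.exists_approx {v : Euc n → ℝ} (hv : MemH1 T v) {g : Euc n → Euc n}
    (hg2 : MemLp g 2 (volume.restrict (elem T))) (hg : IsWeakGrad T v g) :
    ∃ φ : ℕ → Euc n → ℝ, (∀ k, ContDiff ℝ 1 (φ k)) ∧
      Tendsto (fun k => eLpNorm (fun x => φ k x - v x) 2 (volume.restrict (elem T)))
        atTop (𝓝 0) ∧
      Tendsto (fun k => eLpNorm (fun x => gradient (φ k) x - g x) 2
        (volume.restrict (elem T))) atTop (𝓝 0) := by
  set μ := (volume : Measure (Euc n)).restrict (elem T) with hμ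
  obtain ⟨z, hz⟩ := elem_nonempty T
  obtain ⟨r, hr0, hr⟩ := Metric.nhds_basis_closedBall.mem_iff.1 ((isOpen_elem T).mem_nhds hz)
  set ε : ℕ → ℝ := fun k => 1 / ((k : ℝ) + 1 + 1) with hεdef
  have hε : ∀ k, 0 < ε k := fun k => by positivity
  have hε2 : ∀ k, ε k ≤ 1 / 2 := fun k => by
    refine one_div_le_one_div_of_le two_pos ?_
    have : (0 : ℝ) ≤ k := Nat.cast_nonneg k
    linarith
  have hε0 : Tendsto ε atTop (𝓝 0) := by
    have h := (tendsto_add_atTop_iff_nat 1).2 (tendsto_one_div_add_atTop_nhds_zero_nat (𝕜 := ℝ))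
    simpa [hεdef] using h
  let ρ : ℕ → ContDiffBump (0 : Euc n) := fun k =>
    ⟨ε k * r / 2, ε k * r, half_pos (mul_pos (hε k) hr0), half_lt_self (mul_pos (hε k) hr0)⟩
  have hρ : ∀ k, (ρ k).rOut = ε k * r := fun k => rfl
  -- The convergence of mollifications is available for measurable functions, hence the passage to
  -- measurable representatives.
  set v' := hv.1.1.mk v with hv'def
  have hvv : v =ᵐ[μ] v' := hv.1.1.ae_eq_mk
  have hv'm : Measurable v' := hv.1.1.stronglyMeasurable_mk.measurable
  have hv'2 : MemLp v' 2 μ := (memLp_congr_ae hvv).1 hv.1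
  have hgk := fun k => memLp_coordinate hg2 k
  set g' : Fin n → Euc n → ℝ := fun k => (hgk k).1.mk _ with hg'def
  have hgg : ∀ k, (fun x => g x k) =ᵐ[μ] g' k := fun k => (hgk k).1.ae_eq_mk
  have hg'm : ∀ k, Measurable (g' k) := fun k => (hgk k).1.stronglyMeasurable_mk.measurable
  have hg'2 : ∀ k, MemLp (g' k) 2 μ := fun k => (memLp_congr_ae (hgg k)).1 (hgk k)
  have hloc : ∀ {f : Euc n → ℝ}, MemLp f 2 μ → LocallyIntegrable ((elem T).indicator f) :=
    fun hf => ((integrable_indicator_iff (measurableSet_elem T)).2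
      (hf.integrable one_le_two)).locallyIntegrable
  have hC : ∀ k, ContDiff ℝ 1 (mollify (ρ k) z (ε k) ((elem T).indicator v')) := fun k =>
    contDiff_mollify _ _ _ (hloc hv'2)
  refine ⟨fun k => mollify (ρ k) z (ε k) ((elem T).indicator v'), hC, ?_, ?_⟩
  · refine (tendsto_mollify hr hε hε2 hε0 hρ hv'm hv'2).congr fun k => eLpNorm_congr_ae ?_
    filter_upwards [hvv] with x hx
    rw [hx]
  · have hlim : Tendsto (fun k => ∑ j, (eLpNorm (fun x => mollify (ρ k) z (ε k)
        ((elem T).indicator (g' j)) x - g' j x) 2 μ + ENNReal.ofReal (ε k) * eLpNorm (g' j) 2 μ))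
        atTop (𝓝 0) := by
      have h : ∀ j ∈ Finset.univ, Tendsto (fun k => eLpNorm (fun x => mollify (ρ k) z (ε k)
          ((elem T).indicator (g' j)) x - g' j x) 2 μ +
            ENNReal.ofReal (ε k) * eLpNorm (g' j) 2 μ) atTop (𝓝 0) := fun j _ => by
        have h1 := tendsto_mollify hr hε hε2 hε0 hρ (hg'm j) (hg'2 j)
        have h2 : Tendsto (fun k => ENNReal.ofReal (ε k) * eLpNorm (g' j) 2 μ) atTop (𝓝 0) := by
          have h3 := ENNReal.tendsto_ofReal hε0
          rw [ENNReal.ofReal_zero] at h3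
          simpa using ENNReal.Tendsto.mul_const h3 (Or.inr (hg'2 j).2.ne)
        simpa using h1.add h2
      simpa using tendsto_finsetSum _ h
    refine tendsto_of_tendsto_of_tendsto_of_le_of_le tendsto_const_nhds hlim
      (fun _ => zero_le) fun k => ?_
    have hm : AEStronglyMeasurable (fun x => gradient (mollify (ρ k) z (ε k)
        ((elem T).indicator v')) x - g x) μ := (hC k).continuous_gradient.aestronglyMeasurable.sub
      hg2.1
    refine (eLpNorm_le_sum_coordinate hm).trans (Finset.sum_le_sum fun j _ => ?_)
    have hmc := (contDiff_mollify (ρ k) z (ε k) (hloc (hg'2 j))).continuous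
    have hε1 : ε k ≤ 1 := (hε2 k).trans (by norm_num)
    -- The error splits into the mollification error of the gradient component and the defect `ε
    -- g_j` of the contraction.
    have hcongr : (fun x => (gradient (mollify (ρ k) z (ε k) ((elem T).indicator v')) x -
        g x) j) =ᵐ[μ] ((1 - ε k) • fun x => mollify (ρ k) z (ε k) ((elem T).indicator (g' j)) x -
          g' j x) - (ε k) • g' j := by
      filter_upwards [hgg j, ae_restrict_mem (measurableSet_elem T)] with x hx hxT
      rw [PiLp.sub_apply, gradient_mollify hr (hε k) (by linarith [hε2 k]) (hρ k) hvv hgg hv'2 hg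
        hxT, hx]
      simp only [Pi.sub_apply, Pi.smul_apply, smul_eq_mul]
      ring
    rw [eLpNorm_congr_ae hcongr]
    refine (eLpNorm_sub_le ((hmc.aestronglyMeasurable.sub (hg'2 j).1).const_smul _)
      ((hg'2 j).1.const_smul _) one_le_two).trans (add_le_add ?_ ?_)
    · rw [eLpNorm_const_smul, Real.enorm_eq_ofReal (by linarith)]
      refine (mul_le_mul_left (ENNReal.ofReal_le_ofReal (by linarith [hε k] : 1 - ε k ≤ 1))
        _).trans ?_
      rw [ENNReal.ofReal_one, one_mul]
      exact le_rfl
    · rw [eLpNorm_const_smul, Real.enorm_eq_ofReal (hε k).le]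

end WeakGrad

/-! ### Trace inequality, existence of traces, integration by parts -/

section Trace

variable {m : ℕ} (T : Simplex (m + 1)) (i : Fin (m + 2))

/-- The factor `(m + 1) |T| / |F|` (the height of `T` over the face) in `cone_identity`. -/
noncomputable def height : ℝ := (m + 1) * vol T / area T i

theorem height_pos : 0 < height T i :=
  div_pos (mul_pos (by positivity) (vol_pos T)) (area_pos T i)

theorem _root_.Continuous.memLp_bdry {E : Type*} [NormedAddCommGroup E]
    [SecondCountableTopologyEither (Euc (m + 1)) E] {f : Euc (m + 1) → E} (hf : Continuous f) :
    MemLp f 2 ((surf (m + 1)).restrict (bdry T)) := by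
  obtain ⟨K, hK⟩ := (isCompact_hull T).exists_bound_of_continuousOn hf.continuousOn
  exact MemLp.of_bound hf.aestronglyMeasurable K
    (ae_restrict_of_forall_mem (MeasurableSet.iUnion (measurableSet_face T)) fun x hx =>
      hK x (bdry_subset_hull T hx))

theorem restrict_face_le : (surf (m + 1)).restrict (face T i) ≤
    (surf (m + 1)).restrict (bdry T) :=
  Measure.restrict_mono (face_subset_bdry T i) le_rfl

theorem _root_.Continuous.memLp_face {E : Type*} [NormedAddCommGroup E]
    [SecondCountableTopologyEither (Euc (m + 1)) E] {f : Euc (m + 1) → E} (hf : Continuous f) :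
    MemLp f 2 ((surf (m + 1)).restrict (face T i)) :=
  (hf.memLp_bdry T).mono_measure (restrict_face_le T i)

/-- The cone identity for a product. -/
theorem cone_identity_mul {q φ : Euc (m + 1) → ℝ} (hq : ContDiff ℝ 1 q) (hφ : ContDiff ℝ 1 φ) :
    height T i * faceInner T i q φ =
      (∫ x in elem T, ((m + 1 : ℝ) * q x + fderiv ℝ q x (x - T i)) * φ x) +
        ∫ x in elem T, inner ℝ (q x • (x - T i)) (gradient φ x) := by
  have hqc := hq.continuous
  have hφc := hφ.continuous
  have hqd := hq.continuous_fderiv one_ne_zero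
  have hφd := hφ.continuous_gradient
  rw [height, faceInner, ← cone_identity T i (hq.mul hφ), ← integral_add
    (Continuous.integrableOn_elem (by fun_prop) T) (Continuous.integrableOn_elem (by fun_prop) T)]
  refine setIntegral_congr_fun (measurableSet_elem T) fun x _ => ?_
  rw [fderiv_fun_mul (hq.differentiable one_ne_zero x) (hφ.differentiable one_ne_zero x),
    real_inner_smul_left, real_inner_comm, inner_gradient]
  simp only [add_apply, smul_apply, smul_eq_mul]
  ring

/-- The cone identity for `φ²`. The product of the two norms must be kept: splitting it by Young's
inequality with weights independent of `α` would destroy the robustness. -/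
theorem face_sq_le {φ : Euc (m + 1) → ℝ} (hφ : ContDiff ℝ 1 φ) :
    height T i * ∫ x in face T i, φ x ^ 2 ∂(surf (m + 1)) ≤
      (m + 1) * l2norm T φ ^ 2 + 2 * size T * (l2norm T φ * l2norm T (gradient φ)) := by
  have hφc := hφ.continuous
  have hφd := hφ.continuous_gradient
  have h := cone_identity T i (hφ.mul hφ)
  have hx : ∀ x, (m + 1 : ℝ) * (φ x * φ x) + fderiv ℝ (fun y => φ y * φ y) x (x - T i) =
      (m + 1 : ℝ) * ‖φ x‖ ^ 2 + 2 * (φ x * inner ℝ (gradient φ x) (x - T i)) := fun x => by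
    rw [fderiv_fun_mul (hφ.differentiable one_ne_zero x) (hφ.differentiable one_ne_zero x),
      inner_gradient, Real.norm_eq_abs, sq_abs]
    simp only [add_apply, smul_apply, smul_eq_mul]
    ring
  change _ = height T i * _ at h
  have hsq : ∫ x in face T i, φ x ^ 2 ∂(surf (m + 1)) =
      ∫ x in face T i, φ x * φ x ∂(surf (m + 1)) := by simp only [sq]
  rw [hsq, ← h]
  simp_rw [hx]
  rw [integral_add (Continuous.integrableOn_elem (by fun_prop) T)
    (Continuous.integrableOn_elem (by fun_prop) T), integral_const_mul, integral_const_mul,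
    ← toReal_eLpNorm_sq (hφc.memLp_elem T), mul_assoc 2]
  refine add_le_add le_rfl (mul_le_mul_of_nonneg_left ?_ two_pos.le)
  have hc : Continuous fun x => inner ℝ (gradient φ x) (x - T i) := by fun_prop
  have h1 := abs_integral_mul_le (hφc.memLp_elem T) (hc.memLp_elem T)
  have h2 : (eLpNorm (fun x => inner ℝ (gradient φ x) (x - T i)) 2
      (volume.restrict (elem T))).toReal ≤ size T * l2norm T (gradient φ) := by
    have h3 : eLpNorm (fun x => inner ℝ (gradient φ x) (x - T i)) 2 (volume.restrict (elem T)) ≤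
        ENNReal.ofReal (size T) * eLpNorm (gradient φ) 2 (volume.restrict (elem T)) := by
      refine eLpNorm_le_mul_eLpNorm_of_ae_le_mul
        (ae_restrict_of_forall_mem (measurableSet_elem T) fun x hx => ?_) 2
      rw [mul_comm]
      exact (norm_inner_le_norm _ _).trans (mul_le_mul_of_nonneg_left
        (norm_sub_le_size T (elem_subset_hull T hx) (vertex_mem_hull T i)) (norm_nonneg _))
    refine (ENNReal.toReal_mono (ENNReal.mul_ne_top ENNReal.ofReal_ne_top
      (hφd.memLp_elem T).2.ne) h3).trans_eq ?_
    rw [ENNReal.toReal_mul, ENNReal.toReal_ofReal (size_nonneg T)]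
    rfl
  refine (le_abs_self _).trans (h1.trans ?_)
  refine (mul_le_mul_of_nonneg_left h2 ENNReal.toReal_nonneg).trans_eq ?_
  simp only [l2norm]; ring

theorem l2norm_nonneg {n : ℕ} (T : Simplex n) {F : Type*} [NormedAddCommGroup F] (f : Euc n → F) :
    0 ≤ l2norm T f := ENNReal.toReal_nonneg

/-- A qualitative bound whose constant may depend on the element; it serves only for the existence
of traces. -/
theorem exists_bdry_norm_le : ∃ K : ℝ, 0 < K ∧ ∀ φ : Euc (m + 1) → ℝ, ContDiff ℝ 1 φ →
    (eLpNorm φ 2 ((surf (m + 1)).restrict (bdry T))).toReal ≤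
      K * (l2norm T φ + l2norm T (gradient φ)) := by
  set K : ℝ := ∑ i, (height T i)⁻¹ * (m + 1 + 2 * size T) with hK
  have hKi : ∀ i, 0 < (height T i)⁻¹ * (m + 1 + 2 * size T) := fun i =>
    mul_pos (inv_pos.2 (height_pos T i)) (by have := size_nonneg T; positivity)
  have hK0 : 0 < K := Finset.sum_pos (fun i _ => hKi i) Finset.univ_nonempty
  refine ⟨Real.sqrt K, Real.sqrt_pos.2 hK0, fun φ hφ => ?_⟩
  have hs : 0 ≤ l2norm T φ + l2norm T (gradient φ) :=
    add_nonneg (l2norm_nonneg T _) (l2norm_nonneg T _)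
  refine (le_abs_self _).trans (abs_le_of_sq_le_sq ?_ (mul_nonneg (Real.sqrt_nonneg _) hs))
  rw [mul_pow, Real.sq_sqrt hK0.le, toReal_eLpNorm_sq (hφ.continuous.memLp_bdry T)]
  have hi : ∀ i, IntegrableOn (fun x => ‖φ x‖ ^ 2) (face T i) (surf (m + 1)) := fun i =>
    (hφ.continuous.memLp_face T i).integrable_norm_pow two_ne_zero
  calc ∫ x in bdry T, ‖φ x‖ ^ 2 ∂(surf (m + 1))
      ≤ ∫ x, ‖φ x‖ ^ 2 ∂(∑ i, (surf (m + 1)).restrict (face T i)) := by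
        refine integral_mono_measure (restrict_bdry_le T)
          (Eventually.of_forall fun x => by positivity) ?_
        exact (integrable_finsetSum_measure).2 fun i _ => hi i
    _ = ∑ i, ∫ x in face T i, φ x ^ 2 ∂(surf (m + 1)) := by
        rw [integral_finsetSum_measure fun i _ => hi i]
        simp only [Real.norm_eq_abs, sq_abs]
    _ ≤ ∑ i, ((height T i)⁻¹ * (m + 1 + 2 * size T)) *
        (l2norm T φ + l2norm T (gradient φ)) ^ 2 := by
        refine Finset.sum_le_sum fun i _ => ?_
        rw [mul_assoc, ← div_eq_inv_mul, le_div_iff₀' (height_pos T i)]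
        refine (face_sq_le T i hφ).trans ?_
        have h1 := l2norm_nonneg T φ
        have h2 := l2norm_nonneg T (gradient φ)
        have h3 := size_nonneg T
        have h4 : (0 : ℝ) ≤ m := Nat.cast_nonneg m
        have h5 : l2norm T φ ^ 2 ≤ (l2norm T φ + l2norm T (gradient φ)) ^ 2 := by nlinarith
        have h6 : l2norm T φ * l2norm T (gradient φ) ≤
          (l2norm T φ + l2norm T (gradient φ)) ^ 2 := by nlinarith [mul_nonneg h1 h2]
        exact (add_le_add (mul_le_mul_of_nonneg_left h5 (by positivity))
          (mul_le_mul_of_nonneg_left h6 (by positivity))).trans_eq (add_mul _ _ _).symm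
    _ = K * (l2norm T φ + l2norm T (gradient φ)) ^ 2 := by rw [hK, Finset.sum_mul]

variable {T}

/-- By the boundary estimate, smooth approximations of `v` form a Cauchy sequence in `L²(∂T)`. -/
theorem exists_isTrace {v : Euc (m + 1) → ℝ} (hv : MemH1 T v) : ∃ w, IsTrace T v w := by
  obtain ⟨hg2, hg⟩ := hv.weakGrad_spec
  obtain ⟨φ, hφ, h1, h2⟩ := hv.exists_approx hg2 hg
  obtain ⟨K, hK, hle⟩ := exists_bdry_norm_le T
  have hmem := fun k => (hφ k).continuous.memLp_bdry T
  set a : ℕ → ℝ := fun k => l2norm T (fun x => φ k x - v x) +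
    l2norm T (fun x => gradient (φ k) x - weakGrad T v x) with ha
  have ha0 : Tendsto a atTop (𝓝 0) := by
    have h3 := (ENNReal.tendsto_toReal ENNReal.zero_ne_top).comp h1
    have h4 := (ENNReal.tendsto_toReal ENNReal.zero_ne_top).comp h2
    simpa [ha, l2norm] using h3.add h4
  have hdist : ∀ k l, dist ((hmem k).toLp (φ k)) ((hmem l).toLp (φ l)) ≤ K * (a k + a l) := by
    intro k l
    rw [dist_eq_norm, ← MemLp.toLp_sub, Lp.norm_toLp]
    refine (hle _ ((hφ k).sub (hφ l))).trans (mul_le_mul_of_nonneg_left ?_ hK.le)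
    have hk1 := ((hφ k).continuous.memLp_elem T).sub hv.1
    have hl1 := ((hφ l).continuous.memLp_elem T).sub hv.1
    have hk2 := ((hφ k).continuous_gradient.memLp_elem T).sub hg2
    have hl2 := ((hφ l).continuous_gradient.memLp_elem T).sub hg2
    have e1 := toReal_eLpNorm_sub_le hk1 hl1
    have e2 := toReal_eLpNorm_sub_le hk2 hl2
    rw [sub_sub_sub_cancel_right] at e1 e2
    have e3 : gradient (fun x => φ k x - φ l x) = gradient (φ k) - gradient (φ l) :=
      funext fun x => gradient_sub_of_contDiff (hφ k) (hφ l) x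
    have e4 : φ k - φ l = fun x => φ k x - φ l x := rfl
    rw [← e3] at e2
    rw [e4] at e1
    simp only [ha, l2norm]
    change _ ≤ (eLpNorm (φ k - v) 2 (volume.restrict (elem T))).toReal + (eLpNorm (gradient (φ k) -
      weakGrad T v) 2 (volume.restrict (elem T))).toReal + ((eLpNorm (φ l - v) 2
        (volume.restrict (elem T))).toReal + (eLpNorm (gradient (φ l) -
      weakGrad T v) 2 (volume.restrict (elem T))).toReal)
    linarith
  have hcau : CauchySeq fun k => (hmem k).toLp (φ k) := by
    rw [Metric.cauchySeq_iff]
    intro e he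
    have hev := ha0.eventually_lt_const (show (0 : ℝ) < e / (2 * K) by positivity)
    obtain ⟨N, hN⟩ := eventually_atTop.1 hev
    refine ⟨N, fun k hk l hl => (hdist k l).trans_lt ?_⟩
    have h3 := hN k hk
    have h4 := hN l hl
    calc K * (a k + a l) < K * (e / (2 * K) + e / (2 * K)) :=
          mul_lt_mul_of_pos_left (add_lt_add h3 h4) hK
      _ = e := by field_simp; ring
  obtain ⟨w, hw⟩ := cauchySeq_tendsto_of_complete hcau
  refine ⟨w, Lp.memLp w, φ, hφ, h1, h2, ?_⟩
  have h3 := (Lp.tendsto_Lp_iff_tendsto_eLpNorm' _ w).1 hw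
  refine h3.congr fun k => eLpNorm_congr_ae ?_
  filter_upwards [(hmem k).coeFn_toLp] with x hx
  rw [Pi.sub_apply, hx]

theorem MemH1.isTrace_trace {v : Euc (m + 1) → ℝ} (hv : MemH1 T v) : IsTrace T v (trace T v) := by
  rw [trace, dif_pos (exists_isTrace hv)]
  exact (exists_isTrace hv).choose_spec

/-- Integration by parts for the trace of an `H¹` function. -/
theorem MemH1.faceInner_trace {v : Euc (m + 1) → ℝ} (hv : MemH1 T v) {q : Euc (m + 1) → ℝ}
    (hq : ContDiff ℝ 1 q) : height T i * faceInner T i q (trace T v) =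
      (∫ x in elem T, ((m + 1 : ℝ) * q x + fderiv ℝ q x (x - T i)) * v x) +
        ∫ x in elem T, inner ℝ (q x • (x - T i)) (weakGrad T v x) := by
  obtain ⟨hw, φ, hφ, h1, h2, h3⟩ := hv.isTrace_trace
  have hqc := hq.continuous
  have hqd := hq.continuous_fderiv one_ne_zero
  have h3' : Tendsto (fun k => eLpNorm (fun x => φ k x - trace T v x) 2
      ((surf (m + 1)).restrict (face T i))) atTop (𝓝 0) :=
    tendsto_of_tendsto_of_tendsto_of_le_of_le tendsto_const_nhds h3 (fun _ => zero_le)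
      fun k => eLpNorm_mono_measure _ (restrict_face_le T i)
  have t1 := (tendsto_integral_mul (hqc.memLp_face T i)
    (fun k => (hφ k).continuous.memLp_face T i) (hw.mono_measure (restrict_face_le T i))
    h3').const_mul (height T i)
  have hac : Continuous fun x => (m + 1 : ℝ) * q x + fderiv ℝ q x (x - T i) := by fun_prop
  have hbc : Continuous fun x => q x • (x - T i) := by fun_prop
  have t2 := (tendsto_integral_mul (hac.memLp_elem T)
    (fun k => (hφ k).continuous.memLp_elem T) hv.1 h1).add
    (tendsto_integral_inner (hbc.memLp_elem T)
    (fun k => (hφ k).continuous_gradient.memLp_elem T) hv.weakGrad_spec.1 h2)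
  refine tendsto_nhds_unique t1 (t2.congr fun k => ?_)
  exact (cone_identity_mul T i hq (hφ k)).symm

theorem MemH1.faceInner_trace_sq_le {v : Euc (m + 1) → ℝ} (hv : MemH1 T v)
    {q : Euc (m + 1) → ℝ} (hq : Continuous q) :
    height T i * faceInner T i q (trace T v) ^ 2 ≤ faceInner T i q q *
      ((m + 1) * l2norm T v ^ 2 + 2 * size T * (l2norm T v * l2norm T (weakGrad T v))) := by
  obtain ⟨hw, φ, hφ, h1, h2, h3⟩ := hv.isTrace_trace
  have h3' : Tendsto (fun k => eLpNorm (fun x => φ k x - trace T v x) 2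
      ((surf (m + 1)).restrict (face T i))) atTop (𝓝 0) :=
    tendsto_of_tendsto_of_tendsto_of_le_of_le tendsto_const_nhds h3 (fun _ => zero_le)
      fun k => eLpNorm_mono_measure _ (restrict_face_le T i)
  have t1 := ((tendsto_integral_mul (hq.memLp_face T i)
    (fun k => (hφ k).continuous.memLp_face T i) (hw.mono_measure (restrict_face_le T i))
    h3').pow 2).const_mul (height T i)
  have n1 := tendsto_toReal_eLpNorm (fun k => (hφ k).continuous.memLp_elem T) hv.1 h1
  have n2 := tendsto_toReal_eLpNorm (fun k => (hφ k).continuous_gradient.memLp_elem T)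
    hv.weakGrad_spec.1 h2
  have t2 := (((n1.pow 2).const_mul (m + 1 : ℝ)).add ((n1.mul n2).const_mul (2 * size T))).const_mul
    (faceInner T i q q)
  refine le_of_tendsto_of_tendsto' t1 t2 fun k => ?_
  have hqq : faceInner T i q q = (eLpNorm q 2 ((surf (m + 1)).restrict (face T i))).toReal ^ 2 := by
    rw [toReal_eLpNorm_sq (hq.memLp_face T i), faceInner]
    simp only [Real.norm_eq_abs, sq_abs]
    simp only [sq]
  have hcs := abs_integral_mul_le (hq.memLp_face T i) ((hφ k).continuous.memLp_face T i)
  have hsq := toReal_eLpNorm_sq ((hφ k).continuous.memLp_face T i)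
  simp only [Real.norm_eq_abs, sq_abs] at hsq
  have hcs2 : (∫ x in face T i, q x * φ k x ∂(surf (m + 1))) ^ 2 ≤
      faceInner T i q q * ∫ x in face T i, φ k x ^ 2 ∂(surf (m + 1)) := by
    rw [hqq, ← hsq, ← mul_pow, ← sq_abs]
    exact pow_le_pow_left₀ (abs_nonneg _) hcs 2
  calc height T i * (∫ x in face T i, q x * φ k x ∂(surf (m + 1))) ^ 2
      ≤ height T i * (faceInner T i q q * ∫ x in face T i, φ k x ^ 2 ∂(surf (m + 1))) :=
        mul_le_mul_of_nonneg_left hcs2 (height_pos T i).le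
    _ = faceInner T i q q * (height T i * ∫ x in face T i, φ k x ^ 2 ∂(surf (m + 1))) := by ring
    _ ≤ _ := mul_le_mul_of_nonneg_left (face_sq_le T i (hφ k)) (hqq ▸ sq_nonneg _)

/-- The trace is a chosen function, but integration by parts expresses its moments through `v` and
its weak gradient, on which the right-hand side depends linearly. -/
theorem faceInner_trace_sub {v w : Euc (m + 1) → ℝ} (hv : MemH1 T v) (hw : MemH1 T w)
    {q : Euc (m + 1) → ℝ} (hq : ContDiff ℝ 1 q) : faceInner T i q (trace T (v - w)) =
      faceInner T i q (trace T v) - faceInner T i q (trace T w) := by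
  refine mul_left_cancel₀ (height_pos T i).ne' ?_
  have hqc := hq.continuous
  have hqd := hq.continuous_fderiv one_ne_zero
  have hac : Continuous fun x => (m + 1 : ℝ) * q x + fderiv ℝ q x (x - T i) := by fun_prop
  have hbc : Continuous fun x => q x • (x - T i) := by fun_prop
  have e1 : ∫ x in elem T, ((m + 1 : ℝ) * q x + fderiv ℝ q x (x - T i)) * (v - w) x =
      (∫ x in elem T, ((m + 1 : ℝ) * q x + fderiv ℝ q x (x - T i)) * v x) -
        ∫ x in elem T, ((m + 1 : ℝ) * q x + fderiv ℝ q x (x - T i)) * w x := by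
    have i1 := integrable_mul_continuous hv.1 hac
    have i2 := integrable_mul_continuous hw.1 hac
    simp only [mul_comm _ ((m + 1 : ℝ) * _ + _)] at i1 i2
    rw [← integral_sub i1 i2]
    simp only [Pi.sub_apply, mul_sub]
  have e2 : ∫ x in elem T, inner ℝ (q x • (x - T i)) (weakGrad T (v - w) x) =
      (∫ x in elem T, inner ℝ (q x • (x - T i)) (weakGrad T v x)) -
        ∫ x in elem T, inner ℝ (q x • (x - T i)) (weakGrad T w x) := by
    rw [← integral_sub (integrable_inner (hbc.memLp_elem T) hv.weakGrad_spec.1)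
      (integrable_inner (hbc.memLp_elem T) hw.weakGrad_spec.1)]
    refine integral_congr_ae ?_
    filter_upwards [weakGrad_sub_ae_eq hv hw] with x hx
    rw [hx, Pi.sub_apply, inner_sub_right]
  rw [mul_sub, (hv.sub hw).faceInner_trace i hq, hv.faceInner_trace i hq, hw.faceInner_trace i hq,
    e1, e2]
  ring

theorem faceInner_trace_of_contDiff {f : Euc (m + 1) → ℝ} (hf : ContDiff ℝ 1 f)
    {q : Euc (m + 1) → ℝ} (hq : ContDiff ℝ 1 q) :
    faceInner T i q (trace T f) = faceInner T i q f := by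
  refine mul_left_cancel₀ (height_pos T i).ne' ?_
  rw [(memH1_of_contDiff hf).faceInner_trace i hq, cone_identity_mul T i hq hf]
  congr 1
  refine integral_congr_ae ?_
  filter_upwards [weakGrad_contDiff_ae_eq (T := T) hf] with x hx
  rw [hx]

/-- A function whose moments on the element and on the faces vanish has a weak gradient with
vanishing moments. -/
theorem MemH1.integral_weakGrad_eq_zero {p : ℕ} {v : Euc (m + 1) → ℝ} (hv : MemH1 T v)
    (hF : ∀ i, ∀ q ∈ polyFun (m + 1) p, faceInner T i q (trace T v) = 0)
    (hT : ∀ q ∈ polyFun (m + 1) p, elemInner T q v = 0) {q : Euc (m + 1) → ℝ}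
    (hq : q ∈ polyFun (m + 1) p) (e : Euc (m + 1)) :
    ∫ x in elem T, q x * inner ℝ e (weakGrad T v x) = 0 := by
  have hqs := contDiff_of_mem_polyFun hq (s := 1)
  have hqc := hqs.continuous
  have hqd := hqs.continuous_fderiv one_ne_zero
  have hg2 := hv.weakGrad_spec.1
  -- The formulas for the vertices `0` and `j` are subtracted. Their face terms vanish, and the
  -- volume terms leave the derivative of `q` along the edge, again a polynomial of degree at most
  -- `p`.
  have hedge : ∀ j, ∫ x in elem T, q x * inner ℝ (T j - T 0) (weakGrad T v x) = 0 := fun j => by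
    have h0 := hv.faceInner_trace 0 hqs
    have hj := hv.faceInner_trace j hqs
    rw [hF _ q hq, mul_zero] at h0 hj
    have hzero : ∫ x in elem T, fderiv ℝ q x (T j - T 0) * v x = 0 :=
      hT _ (fderiv_mem_polyFun hq (T j - T 0))
    have ha : ∀ k, Continuous fun x => (m + 1 : ℝ) * q x + fderiv ℝ q x (x - T k) := fun k => by
      fun_prop
    have hb : ∀ k, Continuous fun x => q x • (x - T k) := fun k => by fun_prop
    have hi : ∀ k, IntegrableOn
        (fun x => ((m + 1 : ℝ) * q x + fderiv ℝ q x (x - T k)) * v x) (elem T) := fun k => by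
      have := integrable_mul_continuous hv.1 (ha k)
      simp only [mul_comm (v _)] at this
      exact this
    have e1 : ∫ x in elem T, fderiv ℝ q x (T j - T 0) * v x =
        (∫ x in elem T, ((m + 1 : ℝ) * q x + fderiv ℝ q x (x - T 0)) * v x) -
          ∫ x in elem T, ((m + 1 : ℝ) * q x + fderiv ℝ q x (x - T j)) * v x := by
      rw [← integral_sub (hi 0) (hi j)]
      congr 1; funext x
      rw [← sub_sub_sub_cancel_left (T 0) (T j) x, map_sub]
      ring
    have e2 : ∫ x in elem T, q x * inner ℝ (T j - T 0) (weakGrad T v x) =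
        (∫ x in elem T, inner ℝ (q x • (x - T 0)) (weakGrad T v x)) -
          ∫ x in elem T, inner ℝ (q x • (x - T j)) (weakGrad T v x) := by
      rw [← integral_sub (integrable_inner ((hb 0).memLp_elem T) hg2)
        (integrable_inner ((hb j).memLp_elem T) hg2)]
      congr 1; funext x
      rw [← inner_sub_left, ← smul_sub, sub_sub_sub_cancel_left, real_inner_smul_left]
    rw [hzero] at e1
    rw [e2]
    linarith
  -- The affine map that fixes all vertices is the identity, so its linear part expands `e` in the
  -- vertices; the coefficients sum to zero, so `T 0` may be subtracted.
  have he : e = ∑ k, coordL T k e • (T k - T 0) := by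
    have h1 := transferL_apply T T e
    have h2 : transferL T T e = e := by
      have h3 := hasFDerivAt_transfer T T 0
      have h4 : transfer T T = id := funext fun x => sum_coord_smul T x
      rw [h4] at h3
      rw [h3.unique (hasFDerivAt_id 0)]; rfl
    have h5 : ∑ k, coordL T k e = 0 := by
      have h6 : ∀ k, coordL T k e = T.coord k e - T.coord k 0 := fun k => by
        rw [← coordL_sub, sub_zero]
      simp_rw [h6]
      rw [Finset.sum_sub_distrib, T.sum_coord_apply_eq_one, T.sum_coord_apply_eq_one, sub_self]
    simp_rw [smul_sub]
    rw [Finset.sum_sub_distrib, ← Finset.sum_smul, h5, zero_smul, sub_zero, ← h1, h2]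
  have hi : ∀ k, Integrable (fun x => coordL T k e * (q x * inner ℝ (T k - T 0) (weakGrad T v x)))
      (volume.restrict (elem T)) := fun k => by
    have hc : Continuous fun x => q x • (T k - T 0) := by fun_prop
    have := integrable_inner (hc.memLp_elem T) hg2
    simp only [real_inner_smul_left] at this
    exact this.const_mul _
  have hx : ∀ x, q x * inner ℝ e (weakGrad T v x) =
      ∑ k, coordL T k e * (q x * inner ℝ (T k - T 0) (weakGrad T v x)) := fun x => by
    conv_lhs => rw [he, sum_inner, Finset.mul_sum]
    refine Finset.sum_congr rfl fun k _ => ?_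
    rw [real_inner_smul_left]; ring
  simp_rw [hx]
  rw [integral_finsetSum _ fun k _ => hi k]
  refine Finset.sum_eq_zero fun k _ => ?_
  rw [integral_const_mul, hedge, mul_zero]

end Trace

/-! ### Robust estimates for the face and element corrections -/

section Estimates

theorem l2norm_sq_le {n : ℕ} {T : Simplex n} {E : Type*} [NormedAddCommGroup E]
    [InnerProductSpace ℝ E] {f : Euc n → E} (hf : Continuous f) {g : Euc n → ℝ}
    (hg : Continuous g) (h : ∀ x ∈ elem T, ‖f x‖ ^ 2 ≤ g x) :
    l2norm T f ^ 2 ≤ ∫ x in elem T, g x := by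
  rw [l2norm, toReal_eLpNorm_sq (hf.memLp_elem T)]
  exact setIntegral_mono_on (Continuous.integrableOn_elem (by fun_prop) T)
    (hg.integrableOn_elem T) (measurableSet_elem T) h

theorem l2norm_sq_le_of_bound {n : ℕ} {T : Simplex n} {E : Type*} [NormedAddCommGroup E]
    [InnerProductSpace ℝ E] {f : Euc n → E} (hf : Continuous f) {b : ℝ}
    (h : ∀ x ∈ elem T, ‖f x‖ ≤ b) : l2norm T f ^ 2 ≤ b ^ 2 * vol T := by
  refine (l2norm_sq_le hf (continuous_const (y := b ^ 2)) fun x hx =>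
    pow_le_pow_left₀ (norm_nonneg _) (h x hx) 2).trans_eq ?_
  simp [vol, mul_comm]

/-- Cauchy–Schwarz against the constant one, and the square of the bubble is at most the bubble. -/
theorem sq_bubble_integral_le {n : ℕ} (T : Simplex n) {u : Euc n → ℝ} (hu : Continuous u) :
    (∫ x in elem T, elemBubble T x * |u x|) ^ 2 ≤
      vol T * ∫ x in elem T, elemBubble T x * u x ^ 2 := by
  have hc : Continuous fun x => elemBubble T x * |u x| := by fun_prop
  have h := abs_integral_mul_le ((continuous_const (y := (1 : ℝ))).memLp_elem T) (hc.memLp_elem T)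
  simp only [one_mul] at h
  have h1 := toReal_eLpNorm_sq ((continuous_const (y := (1 : ℝ))).memLp_elem T)
  have h2 := toReal_eLpNorm_sq (hc.memLp_elem T)
  have h3 := pow_le_pow_left₀ (abs_nonneg _) h 2
  rw [sq_abs, mul_pow, h1, h2] at h3
  refine h3.trans ?_
  have h4 : ∫ _ in elem T, ‖(1 : ℝ)‖ ^ 2 = vol T := by simp [vol]
  rw [h4]
  refine mul_le_mul_of_nonneg_left ?_ (vol_pos T).le
  refine setIntegral_mono_on (Continuous.integrableOn_elem (by fun_prop) T)
    (Continuous.integrableOn_elem (by fun_prop) T) (measurableSet_elem T) fun x hx => ?_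
  rw [Real.norm_eq_abs, sq_abs, mul_pow, sq_abs]
  have h0 := (elemBubble_pos T hx).le
  have h1 := elemBubble_le_one T hx
  refine mul_le_mul_of_nonneg_right ?_ (sq_nonneg _)
  nlinarith

theorem norm_gradient {n : ℕ} (f : Euc n → ℝ) (x : Euc n) : ‖gradient f x‖ = ‖fderiv ℝ f x‖ :=
  (InnerProductSpace.toDual ℝ (Euc n)).symm.norm_map _

theorem exists_norm_fderiv_le (n q : ℕ) {γ : ℝ} (hγ : 0 < γ) : ∃ C, 0 < C ∧
    ∀ (T : Simplex n), 0 < size T → ShapeRegular T γ → ∀ u ∈ polyFun n q,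
      ∀ b, (∀ y ∈ elem T, |u y| ≤ b) → ∀ x ∈ elem T, ‖fderiv ℝ u x‖ ≤ C / size T * b := by
  obtain ⟨C, hC, h⟩ := exists_fderiv_le n q
  refine ⟨C * γ, mul_pos hC hγ, fun T hs hT u hu b hb x hx => ?_⟩
  have hb0 : 0 ≤ b := (abs_nonneg _).trans (hb x hx)
  refine ContinuousLinearMap.opNorm_le_bound _ (by positivity) fun e => ?_
  refine (h T u hu b hb e _ (fun k => abs_coordL_le hγ hs hT k e) x hx).trans_eq ?_
  ring

theorem norm_coordL_le {n : ℕ} {T : Simplex n} {γ : ℝ} (hγ : 0 < γ) (hs : 0 < size T)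
    (hT : ShapeRegular T γ) (k : Fin (n + 1)) : ‖coordL T k‖ ≤ γ / size T :=
  ContinuousLinearMap.opNorm_le_bound _ (by positivity) fun e => abs_coordL_le hγ hs hT k e

theorem elemBubble_mem_polyFun {n : ℕ} (T : Simplex n) : elemBubble T ∈ polyFun n (n + 1) := by
  have := prod_mem_polyFun Finset.univ (fun k x => T.coord k x) (fun _ => 1)
    fun k _ => coord_mem_polyFun T k
  have h : elemBubble T = fun x => ∏ k, T.coord k x := rfl
  rw [h]
  simpa using this

theorem faceBubble_mem_polyFun {n : ℕ} (T : Simplex n) (i : Fin (n + 1)) :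
    faceBubble T i ∈ polyFun n n := by
  have := prod_mem_polyFun (Finset.univ.erase i) (fun k x => T.coord k x) (fun _ => 1)
    fun k _ => coord_mem_polyFun T k
  have h : faceBubble T i = fun x => ∏ k ∈ Finset.univ.erase i, T.coord k x := rfl
  rw [h]
  simpa using this

theorem abs_faceBubble_le_one {n : ℕ} {T : Simplex n} {x : Euc n} (hx : x ∈ elem T)
    (i : Fin (n + 1)) : |faceBubble T i x| ≤ 1 := by
  have h0 := fun k => ((mem_elem T).1 hx k).le
  rw [faceBubble, abs_of_nonneg (Finset.prod_nonneg fun k _ => h0 k)]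
  exact Finset.prod_le_one (fun k _ => h0 k) fun k _ => coord_le_one T (elem_subset_hull T hx) k

/-- A polynomial on a face that is controlled by the trace of an `H¹` function. -/
theorem exists_face_sup_bound (m p : ℕ) : ∃ C, 0 < C ∧ ∀ (T : Simplex (m + 1)) (i : Fin (m + 2))
    (w v : Euc (m + 1) → ℝ), w ∈ polyFun (m + 1) p → MemH1 T v →
    faceInner T i w (fun x => faceBubble T i x * w x) = faceInner T i w (trace T v) →
    ∃ S, 0 ≤ S ∧ (∀ x ∈ face T i, |w x| ≤ S) ∧ S ^ 2 * vol T ≤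
      C * ((m + 1) * l2norm T v ^ 2 + 2 * size T * (l2norm T v * l2norm T (weakGrad T v))) := by
  obtain ⟨C, hC, h⟩ := exists_le_bubble_average m p
  refine ⟨C ^ 4 / (m + 1), by positivity, fun T i w v hw hv hwv => ?_⟩
  set F := faceSimplex T i
  set A := faceChart T i
  set Q := (m + 1) * l2norm T v ^ 2 + 2 * size T * (l2norm T v * l2norm T (weakGrad T v))
  have hQ : 0 ≤ Q := by
    have h1 := l2norm_nonneg T v
    have h2 := l2norm_nonneg T (weakGrad T v)
    have h3 := size_nonneg T
    positivity
  have hwc := continuous_of_mem_polyFun hw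
  have hAc : Continuous A := continuous_faceChart T i
  have hwA : Continuous fun y => w (A y) := hwc.comp hAc
  set J := ∫ y in elem F, elemBubble F y * |w (A y)| with hJ
  have hF := vol_pos F
  have hT := vol_pos T
  have hJ0 : 0 ≤ J := setIntegral_nonneg (measurableSet_elem F) fun y hy =>
    mul_nonneg (elemBubble_pos F hy).le (abs_nonneg _)
  set S := C / vol F * J with hS
  have hS0 : 0 ≤ S := by positivity
  have hsup : ∀ y ∈ convexHull ℝ (Set.range F), |w (A y)| ≤ S := fun y hy =>
    h F _ (comp_faceChart_mem_polyFun T i hw) y hy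
  refine ⟨S, hS0, fun x hx => ?_, ?_⟩
  · rw [face_eq_image] at hx
    obtain ⟨y, hy, rfl⟩ := hx
    exact hsup y hy
  set Y := faceInner T i w (trace T v) with hY
  -- Testing the defining relation with `w` itself: `Y` is the integral of the face bubble times
  -- `w²`.
  have h1 : J ^ 2 ≤ vol F * Y := by
    refine (sq_bubble_integral_le F hwA).trans_eq ?_
    rw [← hwv, faceInner_eq]
    congr 1
    refine integral_congr_ae (Eventually.of_forall fun y => ?_)
    simp only [faceBubble_faceChart]
    ring
  have h2 : height T i * Y ^ 2 ≤ S ^ 2 * vol F * Q := by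
    refine (hv.faceInner_trace_sq_le i hwc).trans (mul_le_mul_of_nonneg_right ?_ hQ)
    rw [faceInner_eq]
    calc ∫ y in elem F, w (A y) * w (A y) ≤ ∫ _ in elem F, S ^ 2 := by
          refine setIntegral_mono_on (Continuous.integrableOn_elem (by fun_prop) F)
            (continuous_const.integrableOn_elem F) (measurableSet_elem F) fun y hy => ?_
          rw [← sq, ← sq_abs]
          exact pow_le_pow_left₀ (abs_nonneg _) (hsup y (elem_subset_hull F hy)) 2
      _ = S ^ 2 * vol F := by simp [vol, mul_comm]
  have hH : height T i = (m + 1) * vol T / vol F := by rw [height, area_eq]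
  rw [hH] at h2
  have h3 : S ^ 2 ≤ C ^ 2 / vol F * Y := by
    rw [hS, mul_pow, div_pow]
    calc C ^ 2 / vol F ^ 2 * J ^ 2 ≤ C ^ 2 / vol F ^ 2 * (vol F * Y) :=
          mul_le_mul_of_nonneg_left h1 (by positivity)
      _ = C ^ 2 / vol F * Y := by field_simp
  -- The bounds combine to `S⁴ ≲ Y² ≲ S² Q`, and one factor `S²` has to be cancelled.
  rcases hS0.eq_or_lt with h0 | h0
  · rw [← h0]
    have : (0 : ℝ) ^ 2 * vol T = 0 := by ring
    rw [this]; positivity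
  have h4 : (S ^ 2) ^ 2 ≤ (C ^ 2 / vol F * Y) ^ 2 := pow_le_pow_left₀ (sq_nonneg _) h3 2
  have h5 : (m + 1) * vol T * Y ^ 2 ≤ S ^ 2 * vol F ^ 2 * Q := by
    have := mul_le_mul_of_nonneg_right h2 hF.le
    calc (m + 1) * vol T * Y ^ 2 = (m + 1) * vol T / vol F * Y ^ 2 * vol F := by field_simp
      _ ≤ _ := this.trans_eq (by ring)
  have h6 : (m + 1) * vol T * (S ^ 2) ^ 2 ≤ C ^ 4 * Q * S ^ 2 := by
    calc (m + 1) * vol T * (S ^ 2) ^ 2 ≤ (m + 1) * vol T * (C ^ 2 / vol F * Y) ^ 2 :=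
          mul_le_mul_of_nonneg_left h4 (by positivity)
      _ = C ^ 4 / vol F ^ 2 * ((m + 1) * vol T * Y ^ 2) := by ring
      _ ≤ C ^ 4 / vol F ^ 2 * (S ^ 2 * vol F ^ 2 * Q) :=
          mul_le_mul_of_nonneg_left h5 (by positivity)
      _ = C ^ 4 * Q * S ^ 2 := by field_simp
  have h7 : (m + 1) * vol T * S ^ 2 ≤ C ^ 4 * Q := by
    have : 0 < S ^ 2 := by positivity
    refine le_of_mul_le_mul_right ?_ this
    calc (m + 1) * vol T * S ^ 2 * S ^ 2 = (m + 1) * vol T * (S ^ 2) ^ 2 := by ring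
      _ ≤ _ := h6
  rw [div_mul_eq_mul_div, le_div_iff₀ (by positivity)]
  linarith

/-- A polynomial on the element that is controlled by its bubble-weighted moments. -/
theorem exists_elem_sup_bound (n p : ℕ) : ∃ C, 0 < C ∧ ∀ (T : Simplex n) (u r : Euc n → ℝ),
    u ∈ polyFun n p → MemLp r 2 (volume.restrict (elem T)) →
    elemInner T u (fun x => elemBubble T x * u x) = elemInner T u r →
    ∃ S, 0 ≤ S ∧ (∀ x ∈ elem T, |u x| ≤ S) ∧ S ^ 2 * vol T ≤ C * l2norm T r ^ 2 := by
  obtain ⟨C, hC, h⟩ := exists_le_bubble_average n p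
  refine ⟨C ^ 4, by positivity, fun T u r hu hr hur => ?_⟩
  have huc := continuous_of_mem_polyFun hu
  set J := ∫ y in elem T, elemBubble T y * |u y| with hJ
  have hT := vol_pos T
  have hJ0 : 0 ≤ J := setIntegral_nonneg (measurableSet_elem T) fun y hy =>
    mul_nonneg (elemBubble_pos T hy).le (abs_nonneg _)
  set S := C / vol T * J with hS
  have hS0 : 0 ≤ S := by positivity
  have hsup : ∀ x ∈ elem T, |u x| ≤ S := fun x hx => h T u hu x (elem_subset_hull T hx)
  refine ⟨S, hS0, hsup, ?_⟩
  have h1 : J ^ 2 ≤ vol T * |elemInner T u r| := by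
    refine (sq_bubble_integral_le T huc).trans ?_
    refine mul_le_mul_of_nonneg_left ?_ hT.le
    refine le_trans (le_of_eq ?_) (le_abs_self _)
    rw [← hur, elemInner]
    congr 1; funext y; ring
  have h2 : elemInner T u r ^ 2 ≤ S ^ 2 * vol T * l2norm T r ^ 2 := by
    have h3 := abs_integral_mul_le (huc.memLp_elem T) hr
    have h4 := pow_le_pow_left₀ (abs_nonneg _) h3 2
    rw [sq_abs, mul_pow] at h4
    exact h4.trans (mul_le_mul_of_nonneg_right (l2norm_sq_le_of_bound huc hsup) (sq_nonneg _))
  have h3 : S ^ 2 ≤ C ^ 2 / vol T * |elemInner T u r| := by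
    rw [hS, mul_pow, div_pow]
    calc C ^ 2 / vol T ^ 2 * J ^ 2 ≤ C ^ 2 / vol T ^ 2 * (vol T * |elemInner T u r|) :=
          mul_le_mul_of_nonneg_left h1 (by positivity)
      _ = C ^ 2 / vol T * |elemInner T u r| := by field_simp
  -- As on the face, `S⁴` is bounded by a multiple of `S²`, which is then cancelled.
  rcases hS0.eq_or_lt with h0 | h0
  · rw [← h0]
    have : (0 : ℝ) ^ 2 * vol T = 0 := by ring
    rw [this]; positivity
  have h4 : (S ^ 2) ^ 2 ≤ (C ^ 2 / vol T * |elemInner T u r|) ^ 2 :=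
    pow_le_pow_left₀ (sq_nonneg _) h3 2
  have h6 : vol T * (S ^ 2) ^ 2 ≤ C ^ 4 * l2norm T r ^ 2 * S ^ 2 := by
    calc vol T * (S ^ 2) ^ 2 ≤ vol T * (C ^ 2 / vol T * |elemInner T u r|) ^ 2 :=
          mul_le_mul_of_nonneg_left h4 hT.le
      _ = C ^ 4 / vol T * elemInner T u r ^ 2 := by
          rw [mul_pow, sq_abs]; field_simp
      _ ≤ C ^ 4 / vol T * (S ^ 2 * vol T * l2norm T r ^ 2) :=
          mul_le_mul_of_nonneg_left h2 (by positivity)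
      _ = C ^ 4 * l2norm T r ^ 2 * S ^ 2 := by field_simp
  have : 0 < S ^ 2 := by positivity
  refine le_of_mul_le_mul_right ?_ this
  calc S ^ 2 * vol T * S ^ 2 = vol T * (S ^ 2) ^ 2 := by ring
    _ ≤ _ := h6

theorem contDiff_modFaceBubble {n : ℕ} (T : Simplex n) (α : ℝ) (i : Fin (n + 1)) :
    ContDiff ℝ 1 (modFaceBubble T α i) := by
  have h1 := contDiff_coord T i (r := 1)
  have h2 := contDiff_of_mem_polyFun (faceBubble_mem_polyFun T i) (s := 1)
  unfold modFaceBubble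
  fun_prop

theorem normα_sq {n : ℕ} (T : Simplex n) (α : ℝ) (v : Euc n → ℝ) :
    normα T α v ^ 2 = l2norm T v ^ 2 + α ^ 2 * l2norm T (weakGrad T v) ^ 2 :=
  Real.sq_sqrt (by positivity)

set_option maxHeartbeats 1000000 in
-- The sup of `w` over the element, controlled through stability and the trace of `v`, is multiplied
-- by the `L²` mass of the exponential. The gradient is pointwise at most `G / α` times the same
-- product, so one integral settles both claims.
theorem exists_face_estimate (m p : ℕ) {γ κ : ℝ} (M : ℝ) (hγ : 0 < γ) (hκ : 0 ≤ κ) :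
    ∃ C, 0 < C ∧ ∀ T : Simplex (m + 1), ShapeRegular T γ → ∀ α, 0 < α → α ≤ κ * size T →
    ∀ (i : Fin (m + 2)) (w v : Euc (m + 1) → ℝ), w ∈ polyFun (m + 1) p → MemH1 T v →
    (∀ b, (∀ y ∈ face T i, |w y| ≤ b) → ∀ x ∈ elem T, |w x| ≤ M * b) →
    faceInner T i w (fun x => faceBubble T i x * w x) = faceInner T i w (trace T v) →
    l2norm T (fun x => modFaceBubble T α i x * w x) ≤ C * normα T α v ∧
    α * l2norm T (gradient fun x => modFaceBubble T α i x * w x) ≤ C * normα T α v := by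
  obtain ⟨K, hK, hsup⟩ := exists_face_sup_bound m p
  obtain ⟨L, hL, hder⟩ := exists_norm_fderiv_le (m + 1) (m + 1 + p) hγ
  set D : ℝ := M ^ 2 * (m + 2) * K * ((m + 1) * κ + 1) with hD
  have hD0 : 0 ≤ D := by positivity
  -- The first summand is for the derivative of the polynomial factor, the second for that of the
  -- exponential.
  set G : ℝ := L * κ + γ with hG
  have hG0 : 0 < G := by positivity
  -- The summand `1` keeps the constant positive when `M = 0`.
  refine ⟨Real.sqrt D * (1 + G) + 1, by positivity, fun T hT α hα hακ i w v hw hv hM hwv => ?_⟩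
  have hs : 0 < size T := size_pos T (by omega)
  have hvol := vol_pos T
  obtain ⟨S, hS0, hS, hSQ⟩ := hsup T i w v hw hv hwv
  set W := M * S with hW
  have hwW : ∀ x ∈ elem T, |w x| ≤ W := hM S hS
  set N := normα T α v with hN
  have hN0 : 0 ≤ N := Real.sqrt_nonneg _
  set a := l2norm T v with ha
  set b := l2norm T (weakGrad T v) with hb
  have hN2 : N ^ 2 = a ^ 2 + α ^ 2 * b ^ 2 := normα_sq T α v
  have ha0 : 0 ≤ a := l2norm_nonneg T _
  have hb0 : 0 ≤ b := l2norm_nonneg T _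
  set ψ : Euc (m + 1) → ℝ := fun x => Real.exp (-(size T * T.coord i x) / α) with hψ
  set P : Euc (m + 1) → ℝ := fun x => faceBubble T i x * w x with hP
  have hPm : P ∈ polyFun (m + 1) (m + 1 + p) := mul_mem_polyFun (faceBubble_mem_polyFun T i) hw
  have hPW : ∀ x ∈ elem T, |P x| ≤ W := fun x hx => by
    rw [hP, abs_mul]
    exact (mul_le_of_le_one_left (abs_nonneg _) (abs_faceBubble_le_one hx i)).trans (hwW x hx)
  have hE : (fun x => modFaceBubble T α i x * w x) = fun x => ψ x * P x := by
    funext x; simp only [modFaceBubble, hψ, hP]; ring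
  have hψd : ∀ x, HasFDerivAt ψ (ψ x • (-(size T / α)) • coordL T i) x := fun x => by
    have h1 : HasFDerivAt (fun x => -(size T * T.coord i x) / α)
        ((-(size T / α)) • coordL T i) x := by
      have h2 := (hasFDerivAt_coord T i x).const_mul (-(size T / α))
      refine h2.congr_of_eventuallyEq (Eventually.of_forall fun y => ?_)
      simp only; ring
    exact h1.exp
  have hPc := contDiff_of_mem_polyFun hPm (s := 1)
  have hψ0 : ∀ x, 0 < ψ x := fun x => Real.exp_pos _
  have hψc : Continuous ψ := by rw [hψ]; fun_prop
  have hψsq : ∫ x in elem T, ψ x ^ 2 ≤ (m + 2) * (α / size T) * vol T := by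
    have h1 := setIntegral_exp_le T i (β := 2 * (size T / α)) (by positivity)
    have h2 : ∀ x, ψ x ^ 2 = Real.exp (-(2 * (size T / α) * T.coord i x)) := fun x => by
      rw [hψ, ← Real.exp_nat_mul]; congr 1; push_cast; ring
    simp_rw [h2]
    refine h1.trans_eq ?_
    field_simp
  have hakκ : α / size T ≤ κ := (div_le_iff₀ hs).2 hακ
  have hmain : W ^ 2 * ∫ x in elem T, ψ x ^ 2 ≤ D * N ^ 2 := by
    -- The heart of the robustness: the layer factor `α / h` cancels the `h` of the trace inequality
    -- and puts `α` in front of the gradient.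
    have h1 : (α / size T) * ((m + 1) * a ^ 2 + 2 * size T * (a * b)) ≤
        ((m + 1) * κ + 1) * N ^ 2 := by
      have h2 : (α / size T) * ((m + 1) * a ^ 2 + 2 * size T * (a * b)) =
          (m + 1) * (α / size T) * a ^ 2 + 2 * (a * (α * b)) := by field_simp
      have h3 : (m + 1) * (α / size T) * a ^ 2 ≤ (m + 1) * κ * a ^ 2 := by gcongr
      have h4 : 2 * (a * (α * b)) ≤ N ^ 2 := by
        rw [hN2]; nlinarith [sq_nonneg (a - α * b)]
      have h5 : a ^ 2 ≤ N ^ 2 := by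
        rw [hN2]; nlinarith [sq_nonneg (α * b)]
      have h6 : (m + 1) * κ * a ^ 2 ≤ (m + 1) * κ * N ^ 2 := by gcongr
      rw [h2]; linarith
    calc W ^ 2 * ∫ x in elem T, ψ x ^ 2 ≤ W ^ 2 * ((m + 2) * (α / size T) * vol T) :=
          mul_le_mul_of_nonneg_left hψsq (sq_nonneg _)
      _ = M ^ 2 * (m + 2) * (α / size T) * (S ^ 2 * vol T) := by rw [hW]; ring
      _ ≤ M ^ 2 * (m + 2) * (α / size T) * (K * ((m + 1) * a ^ 2 + 2 * size T * (a * b))) :=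
          mul_le_mul_of_nonneg_left hSQ (by positivity)
      _ = M ^ 2 * (m + 2) * K * ((α / size T) * ((m + 1) * a ^ 2 + 2 * size T * (a * b))) := by
          ring
      _ ≤ M ^ 2 * (m + 2) * K * (((m + 1) * κ + 1) * N ^ 2) :=
          mul_le_mul_of_nonneg_left h1 (by positivity)
      _ = D * N ^ 2 := by rw [hD]; ring
  have hsqrt : D * N ^ 2 = (Real.sqrt D * N) ^ 2 := by rw [mul_pow, Real.sq_sqrt hD0]
  have hDN : 0 ≤ Real.sqrt D * N := by positivity
  have hl2 : l2norm T (fun x => ψ x * P x) ≤ Real.sqrt D * N := by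
    refine (le_abs_self _).trans (abs_le_of_sq_le_sq ?_ hDN)
    rw [← hsqrt]
    refine le_trans ?_ hmain
    rw [← integral_const_mul]
    refine l2norm_sq_le (f := fun x => ψ x * P x) (hψc.mul hPc.continuous) (by fun_prop)
      fun x hx => ?_
    rw [norm_mul, mul_pow, Real.norm_eq_abs, Real.norm_eq_abs, sq_abs, mul_comm]
    exact mul_le_mul_of_nonneg_right (pow_le_pow_left₀ (abs_nonneg _) (hPW x hx) 2) (sq_nonneg _)
  have hEc : ContDiff ℝ 1 (fun x => ψ x * P x) := by
    rw [← hE]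
    exact (contDiff_modFaceBubble T α i).mul (contDiff_of_mem_polyFun hw)
  have hgrad : ∀ x ∈ elem T, ‖gradient (fun x => ψ x * P x) x‖ ≤ G / α * (W * ψ x) := by
    intro x hx
    -- The sign of `M` is not prescribed; nonnegativity of `W` is read off from the bound at the
    -- point `x`.
    have hW0 : 0 ≤ W := (abs_nonneg _).trans (hPW x hx)
    have h1 : HasFDerivAt (fun x => ψ x * P x)
        (ψ x • fderiv ℝ P x + P x • ψ x • (-(size T / α)) • coordL T i) x :=
      (hψd x).mul ((hPc.differentiable one_ne_zero x).hasFDerivAt)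
    have h2 := hder T hs hT P hPm W hPW x hx
    have h3 := norm_coordL_le hγ hs hT i
    rw [norm_gradient, h1.fderiv]
    refine (norm_add_le _ _).trans ?_
    rw [norm_smul, norm_smul, norm_smul, norm_smul, norm_neg, Real.norm_of_nonneg (hψ0 x).le,
      Real.norm_of_nonneg (by positivity : 0 ≤ size T / α), Real.norm_eq_abs]
    have h4 : L / size T ≤ L * κ / α := by
      rw [div_le_div_iff₀ hs hα]
      calc L * α ≤ L * (κ * size T) := mul_le_mul_of_nonneg_left hακ hL.le
        _ = L * κ * size T := by ring
    calc ψ x * ‖fderiv ℝ P x‖ + |P x| * (ψ x * (size T / α * ‖coordL T i‖))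
        ≤ ψ x * (L * κ / α * W) + W * (ψ x * (size T / α * (γ / size T))) := by
          refine add_le_add (mul_le_mul_of_nonneg_left (h2.trans
            (mul_le_mul_of_nonneg_right h4 hW0)) (hψ0 x).le) ?_
          refine mul_le_mul (hPW x hx) ?_ (by have := hψ0 x; positivity) hW0
          exact mul_le_mul_of_nonneg_left (mul_le_mul_of_nonneg_left h3 (by positivity)) (hψ0 x).le
      _ = G / α * (W * ψ x) := by rw [hG]; field_simp
  have hl2g : α * l2norm T (gradient fun x => ψ x * P x) ≤ G * (Real.sqrt D * N) := by
    refine (le_abs_self _).trans (abs_le_of_sq_le_sq ?_ (by positivity))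
    have h1 : l2norm T (gradient fun x => ψ x * P x) ^ 2 ≤
        ∫ x in elem T, (G / α) ^ 2 * W ^ 2 * ψ x ^ 2 := by
      refine l2norm_sq_le hEc.continuous_gradient (by fun_prop) fun x hx => ?_
      refine (pow_le_pow_left₀ (norm_nonneg _) (hgrad x hx) 2).trans_eq ?_
      ring
    rw [integral_const_mul] at h1
    rw [mul_pow, mul_pow, ← hsqrt]
    calc α ^ 2 * l2norm T (gradient fun x => ψ x * P x) ^ 2
        ≤ α ^ 2 * ((G / α) ^ 2 * W ^ 2 * ∫ x in elem T, ψ x ^ 2) :=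
          mul_le_mul_of_nonneg_left h1 (sq_nonneg _)
      _ = G ^ 2 * (W ^ 2 * ∫ x in elem T, ψ x ^ 2) := by field_simp
      _ ≤ G ^ 2 * (D * N ^ 2) := mul_le_mul_of_nonneg_left hmain (sq_nonneg _)
  rw [hE]
  have hGD : 0 ≤ G * (Real.sqrt D * N) := by positivity
  have hC : (Real.sqrt D * (1 + G) + 1) * N =
      Real.sqrt D * N + G * (Real.sqrt D * N) + N := by ring
  rw [hC]
  constructor
  · linarith
  · linarith

/-- No boundary layer is needed here: the data are bounded in `L²(T)` without a trace, and `α ≤ κ h`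
absorbs the factor `1/h` of the inverse estimate. -/
theorem exists_elem_estimate (n p : ℕ) {γ κ : ℝ} (hγ : 0 < γ) (hκ : 0 ≤ κ) (hn : 1 ≤ n) :
    ∃ C, 0 < C ∧ ∀ T : Simplex n, ShapeRegular T γ → ∀ α, 0 < α → α ≤ κ * size T →
    ∀ u r : Euc n → ℝ, u ∈ polyFun n p → MemLp r 2 (volume.restrict (elem T)) →
    elemInner T u (fun x => elemBubble T x * u x) = elemInner T u r →
    l2norm T (fun x => elemBubble T x * u x) ≤ C * l2norm T r ∧
    α * l2norm T (gradient fun x => elemBubble T x * u x) ≤ C * l2norm T r := by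
  obtain ⟨K, hK, hsup⟩ := exists_elem_sup_bound n p
  obtain ⟨L, hL, hder⟩ := exists_norm_fderiv_le n (n + 1 + p) hγ
  refine ⟨Real.sqrt K * (1 + L * κ), by positivity, fun T hT α hα hακ u r hu hr hur => ?_⟩
  have hs : 0 < size T := size_pos T hn
  obtain ⟨S, hS0, hS, hSr⟩ := hsup T u r hu hr hur
  set P : Euc n → ℝ := fun x => elemBubble T x * u x with hP
  have hPm : P ∈ polyFun n (n + 1 + p) := mul_mem_polyFun (elemBubble_mem_polyFun T) hu
  have hPS : ∀ x ∈ elem T, |P x| ≤ S := fun x hx => by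
    rw [hP, abs_mul, abs_of_pos (elemBubble_pos T hx)]
    exact (mul_le_of_le_one_left (abs_nonneg _) (elemBubble_le_one T hx)).trans (hS x hx)
  have hPc := contDiff_of_mem_polyFun hPm (s := 1)
  have hr0 := l2norm_nonneg T r
  have hsqrt : K * l2norm T r ^ 2 = (Real.sqrt K * l2norm T r) ^ 2 := by
    rw [mul_pow, Real.sq_sqrt hK.le]
  have hKr : 0 ≤ Real.sqrt K * l2norm T r := by positivity
  have h1 : l2norm T P ≤ Real.sqrt K * l2norm T r := by
    refine (le_abs_self _).trans (abs_le_of_sq_le_sq ?_ hKr)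
    rw [← hsqrt]
    exact (l2norm_sq_le_of_bound hPc.continuous hPS).trans hSr
  have h2 : α * l2norm T (gradient P) ≤ L * κ * (Real.sqrt K * l2norm T r) := by
    refine (le_abs_self _).trans (abs_le_of_sq_le_sq ?_ (by positivity))
    have h3 := l2norm_sq_le_of_bound hPc.continuous_gradient (T := T) (b := L / size T * S)
      fun x hx => by rw [norm_gradient]; exact hder T hs hT P hPm S hPS x hx
    have hakκ : α / size T ≤ κ := (div_le_iff₀ hs).2 hακ
    rw [mul_pow, mul_pow, ← hsqrt]
    calc α ^ 2 * l2norm T (gradient P) ^ 2 ≤ α ^ 2 * ((L / size T * S) ^ 2 * vol T) :=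
          mul_le_mul_of_nonneg_left h3 (sq_nonneg _)
      _ = (L * (α / size T)) ^ 2 * (S ^ 2 * vol T) := by ring
      _ ≤ (L * κ) ^ 2 * (K * l2norm T r ^ 2) := by
          have := vol_pos T
          gcongr
  have h4 : 0 ≤ L * κ * (Real.sqrt K * l2norm T r) := by positivity
  have hC : Real.sqrt K * (1 + L * κ) * l2norm T r =
      Real.sqrt K * l2norm T r + L * κ * (Real.sqrt K * l2norm T r) := by ring
  rw [hC]
  constructor
  · linarith
  · linarith

end Estimates

/-! ### Basis-free form of the operator and its moments -/

section Lifting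

variable {m p : ℕ} {T : Simplex (m + 1)} {B : PolyBases T p} (D : DualSystem B)

/-- The combination of the face functions whose moments, weighted with the face bubble, are those
of `g`. -/
noncomputable def DualSystem.liftFace (i : Fin (m + 2)) (g : Euc (m + 1) → ℝ) :
    Euc (m + 1) → ℝ :=
  fun x => ∑ j, faceInner T i (D.onFace i j) g / area T i * B.onFace i j x

/-- The combination of the element functions whose moments, weighted with the element bubble, are
those of `r`. -/
noncomputable def DualSystem.liftElem (r : Euc (m + 1) → ℝ) : Euc (m + 1) → ℝ :=
  fun x => ∑ j, elemInner T (D.onElem j) r / vol T * B.onElem j x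

theorem DualSystem.liftFace_mem (i : Fin (m + 2)) (g : Euc (m + 1) → ℝ) :
    D.liftFace i g ∈ polyFun (m + 1) p :=
  sum_mul_mem_polyFun (B.onFace_basis i).1 _

theorem DualSystem.liftElem_mem (r : Euc (m + 1) → ℝ) : D.liftElem r ∈ polyFun (m + 1) p :=
  sum_mul_mem_polyFun B.onElem_basis.1 _

theorem integrable_mul_of_memLp {X : Type*} [MeasurableSpace X] {μ : Measure X} {f g : X → ℝ}
    (hf : MemLp f 2 μ) (hg : MemLp g 2 μ) : Integrable (fun x => f x * g x) μ := by
  have := integrable_inner hg hf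
  simpa using this

theorem faceInner_sum_left {i : Fin (m + 2)} {ι : Type*} [Fintype ι] (c : ι → ℝ)
    {b : ι → Euc (m + 1) → ℝ} (hb : ∀ j, Continuous (b j)) {g : Euc (m + 1) → ℝ}
    (hg : MemLp g 2 ((surf (m + 1)).restrict (face T i))) :
    faceInner T i (fun x => ∑ j, c j * b j x) g = ∑ j, c j * faceInner T i (b j) g := by
  simp only [faceInner, Finset.sum_mul, mul_assoc]
  rw [integral_finsetSum _ fun j _ =>
    (integrable_mul_of_memLp ((hb j).memLp_face T i) hg).const_mul (c j)]
  simp only [integral_const_mul]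

theorem elemInner_sum_left {n : ℕ} {T : Simplex n} {ι : Type*} [Fintype ι] (c : ι → ℝ)
    {b : ι → Euc n → ℝ} (hb : ∀ j, Continuous (b j)) {g : Euc n → ℝ}
    (hg : MemLp g 2 (volume.restrict (elem T))) :
    elemInner T (fun x => ∑ j, c j * b j x) g = ∑ j, c j * elemInner T (b j) g := by
  simp only [elemInner, Finset.sum_mul, mul_assoc]
  rw [integral_finsetSum _ fun j _ =>
    (integrable_mul_of_memLp ((hb j).memLp_elem T) hg).const_mul (c j)]
  simp only [integral_const_mul]

theorem faceInner_comm (i : Fin (m + 2)) (f g : Euc (m + 1) → ℝ) :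
    faceInner T i f g = faceInner T i g f := by
  simp only [faceInner, mul_comm]

theorem elemInner_comm {n : ℕ} (T : Simplex n) (f g : Euc n → ℝ) :
    elemInner T f g = elemInner T g f := by
  simp only [elemInner, mul_comm]

theorem continuous_faceBubble {n : ℕ} (T : Simplex n) (i : Fin (n + 1)) :
    Continuous (faceBubble T i) :=
  continuous_of_mem_polyFun (faceBubble_mem_polyFun T i)

/-- Both sides are linear in `q`, and the dual functions span, so biorthogonality decides. This
characterization is all that the estimates use about the dual system. -/
theorem DualSystem.faceInner_liftFace (i : Fin (m + 2)) {g : Euc (m + 1) → ℝ}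
    (hg : MemLp g 2 ((surf (m + 1)).restrict (face T i))) {q : Euc (m + 1) → ℝ}
    (hq : q ∈ polyFun (m + 1) p) :
    faceInner T i q (fun x => faceBubble T i x * D.liftFace i g x) = faceInner T i q g := by
  obtain ⟨c, hc⟩ := D.exists_face_combination i hq
  have hD := fun j => continuous_of_mem_polyFun (D.onFace_mem i j)
  have hη : ∀ j, Continuous (B.etaF i j) := fun j =>
    (continuous_faceBubble T i).mul (continuous_of_mem_polyFun ((B.onFace_basis i).1 j))
  have hw : (fun x => faceBubble T i x * D.liftFace i g x) =
      fun x => ∑ j, faceInner T i (D.onFace i j) g / area T i * B.etaF i j x := by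
    funext x
    simp only [DualSystem.liftFace, PolyBases.etaF, Finset.mul_sum]
    exact Finset.sum_congr rfl fun j _ => by ring
  have hwc : Continuous fun x =>
      ∑ j, faceInner T i (D.onFace i j) g / area T i * B.etaF i j x := by fun_prop
  rw [hw, faceInner_congr T i hc fun _ _ => rfl, faceInner_congr T i hc fun _ _ => rfl,
    faceInner_sum_left c hD hg, faceInner_sum_left c hD (hwc.memLp_face T i)]
  refine Finset.sum_congr rfl fun j _ => ?_
  congr 1
  rw [faceInner_comm, faceInner_sum_left _ hη ((hD j).memLp_face T i)]
  simp only [faceInner_comm i (B.etaF i _), D.onFace_dual, mul_ite, mul_zero, Finset.sum_ite_eq,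
    Finset.mem_univ, if_true]
  exact div_mul_cancel₀ _ (area_pos T i).ne'

theorem DualSystem.elemInner_liftElem {r : Euc (m + 1) → ℝ}
    (hr : MemLp r 2 (volume.restrict (elem T))) {q : Euc (m + 1) → ℝ}
    (hq : q ∈ polyFun (m + 1) p) :
    elemInner T q (fun x => elemBubble T x * D.liftElem r x) = elemInner T q r := by
  obtain ⟨c, hc⟩ := D.exists_elem_combination hq
  have hD := fun j => continuous_of_mem_polyFun (D.onElem_mem j)
  have hη : ∀ j, Continuous (B.etaT j) := fun j =>
    (continuous_elemBubble T).mul (continuous_of_mem_polyFun (B.onElem_basis.1 j))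
  have hw : (fun x => elemBubble T x * D.liftElem r x) =
      fun x => ∑ j, elemInner T (D.onElem j) r / vol T * B.etaT j x := by
    funext x
    simp only [DualSystem.liftElem, PolyBases.etaT, Finset.mul_sum]
    exact Finset.sum_congr rfl fun j _ => by ring
  have hwc : Continuous fun x =>
      ∑ j, elemInner T (D.onElem j) r / vol T * B.etaT j x := by fun_prop
  have hcongr : ∀ g, elemInner T q g = elemInner T (fun x => ∑ j, c j * D.onElem j x) g :=
    fun g => setIntegral_congr_fun (measurableSet_elem T) fun x hx => by simp only [hc x hx]
  rw [hw, hcongr, hcongr r, elemInner_sum_left c hD hr,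
    elemInner_sum_left c hD (hwc.memLp_elem T)]
  refine Finset.sum_congr rfl fun j _ => ?_
  congr 1
  rw [elemInner_comm, elemInner_sum_left _ hη ((hD j).memLp_elem T)]
  simp only [elemInner_comm T (B.etaT _), D.onElem_dual, mul_ite, mul_zero, Finset.sum_ite_eq,
    Finset.mem_univ, if_true]
  exact div_mul_cancel₀ _ (vol_pos T).ne'

/-- The exponential is one on its own face, so every denominator is the area, independently of `α`.
-/
theorem preFortin_eq (α : ℝ) (v : Euc (m + 1) → ℝ) : preFortin α B D v =
    meanProj T v + ∑ i, fun x =>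
      modFaceBubble T α i x * D.liftFace i (trace T (v - meanProj T v)) x := by
  have h : ∀ i j, faceInner T i (D.onFace i j) (B.etaαF α i j) = area T i := fun i j => by
    have h1 := D.onFace_dual i j j
    rw [if_pos rfl] at h1
    rw [← h1]
    refine faceInner_congr T i (fun _ _ => rfl) fun x hx => ?_
    rw [PolyBases.etaαF, PolyBases.etaF, modFaceBubble_of_mem_face T i α hx]
  rw [preFortin]
  congr 1
  refine Finset.sum_congr rfl fun i _ => ?_
  funext x
  simp only [h, Finset.sum_apply, Pi.smul_apply, smul_eq_mul, DualSystem.liftFace,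
    PolyBases.etaαF, Finset.mul_sum]
  exact Finset.sum_congr rfl fun j _ => by ring

theorem fortin_eq (α : ℝ) (v : Euc (m + 1) → ℝ) : fortin α B D v =
    preFortin α B D v + fun x => elemBubble T x * D.liftElem (v - preFortin α B D v) x := by
  have h : ∀ j, elemInner T (D.onElem j) (B.etaT j) = vol T := fun j => by
    rw [D.onElem_dual, if_pos rfl]
  rw [fortin]
  congr 1
  funext x
  simp only [h, Finset.sum_apply, Pi.smul_apply, smul_eq_mul, DualSystem.liftElem,
    PolyBases.etaT, Finset.mul_sum]
  exact Finset.sum_congr rfl fun j _ => by ring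

theorem contDiff_meanProj {n : ℕ} (T : Simplex n) (v : Euc n → ℝ) : ContDiff ℝ 1 (meanProj T v) :=
  contDiff_const

theorem contDiff_faceTerm (α : ℝ) (i : Fin (m + 2)) (g : Euc (m + 1) → ℝ) :
    ContDiff ℝ 1 fun x => modFaceBubble T α i x * D.liftFace i g x :=
  (contDiff_modFaceBubble T α i).mul (contDiff_of_mem_polyFun (D.liftFace_mem i g))

theorem contDiff_elemTerm (r : Euc (m + 1) → ℝ) :
    ContDiff ℝ 1 fun x => elemBubble T x * D.liftElem r x :=
  (contDiff_of_mem_polyFun (elemBubble_mem_polyFun T)).mul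
    (contDiff_of_mem_polyFun (D.liftElem_mem r))

theorem contDiff_finset_sum {n : ℕ} {ι : Type*} (s : Finset ι) {f : ι → Euc n → ℝ}
    (hf : ∀ i, ContDiff ℝ 1 (f i)) : ContDiff ℝ 1 (∑ i ∈ s, f i) := by
  have : (∑ i ∈ s, f i) = fun x => ∑ i ∈ s, f i x := by funext x; simp
  rw [this]
  exact ContDiff.sum fun i _ => hf i

theorem contDiff_preFortin (α : ℝ) (v : Euc (m + 1) → ℝ) : ContDiff ℝ 1 (preFortin α B D v) := by
  rw [preFortin_eq]
  exact (contDiff_meanProj T v).add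
    (contDiff_finset_sum _ fun i => contDiff_faceTerm D α i _)

theorem contDiff_fortin (α : ℝ) (v : Euc (m + 1) → ℝ) : ContDiff ℝ 1 (fortin α B D v) := by
  rw [fortin_eq]
  exact (contDiff_preFortin D α v).add (contDiff_elemTerm D _)

theorem fortin_mem_discreteSpace (α : ℝ) (v : Euc (m + 1) → ℝ) :
    fortin α B D v ∈ discreteSpace α B := by
  have h1 : meanProj T v ∈ polyFun (m + 1) 0 := mem_polyFun_zero.2 ⟨_, rfl⟩
  refine Submodule.add_mem _ (Submodule.add_mem _ ?_ ?_) ?_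
  · exact Submodule.mem_sup_left (Submodule.mem_sup_left h1)
  · refine Submodule.sum_mem _ fun i _ => Submodule.sum_mem _ fun j _ => Submodule.smul_mem _ _ ?_
    exact Submodule.mem_sup_left (Submodule.mem_sup_right (Submodule.subset_span ⟨i, j, rfl⟩))
  · refine Submodule.sum_mem _ fun j _ => Submodule.smul_mem _ _ ?_
    exact Submodule.mem_sup_right (Submodule.subset_span ⟨j, rfl⟩)

theorem meanProj_const (c : ℝ) : meanProj T (fun _ => c) = fun _ => c := by
  have h : vol T ≠ 0 := (vol_pos T).ne'
  funext x
  rw [meanProj, setAverage_eq, setIntegral_const, smul_smul]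
  rw [vol] at h
  rw [inv_mul_cancel₀ h, one_smul]

theorem faceInner_zero_right (i : Fin (m + 2)) (f : Euc (m + 1) → ℝ) : faceInner T i f 0 = 0 := by
  simp [faceInner]

theorem fortin_of_const (α : ℝ) {v : Euc (m + 1) → ℝ} (hv : v ∈ polyFun (m + 1) 0) :
    fortin α B D v = v := by
  obtain ⟨c, rfl⟩ := mem_polyFun_zero.1 hv
  have h0 : ContDiff ℝ 1 (0 : Euc (m + 1) → ℝ) := contDiff_const
  have hpre : preFortin α B D (fun _ => c) = fun _ => c := by
    rw [preFortin_eq, meanProj_const, sub_self]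
    have : ∀ i, D.liftFace i (trace T 0) = 0 := fun i => by
      funext x
      simp only [DualSystem.liftFace, Pi.zero_apply]
      refine Finset.sum_eq_zero fun j _ => ?_
      -- The chosen trace of zero need not be the zero function, but its polynomial moments vanish.
      rw [faceInner_trace_of_contDiff i h0 (contDiff_of_mem_polyFun (D.onFace_mem i j)),
        faceInner_zero_right, zero_div, zero_mul]
    funext x
    simp [this]
  rw [fortin_eq, hpre, sub_self]
  funext x
  simp [DualSystem.liftElem, elemInner]

/-- On a face only its own correction survives, with the exponential equal to one; the mean cancels
against the one subtracted in the data. -/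
theorem faceInner_trace_sub_fortin (α : ℝ) {v : Euc (m + 1) → ℝ} (hv : MemH1 T v)
    (i : Fin (m + 2)) {q : Euc (m + 1) → ℝ} (hq : q ∈ polyFun (m + 1) p) :
    faceInner T i q (trace T (v - fortin α B D v)) = 0 := by
  have hq1 := contDiff_of_mem_polyFun hq (s := 1)
  have hm := contDiff_meanProj T v
  have hv0 := hv.sub (memH1_of_contDiff hm)
  have htr := hv0.isTrace_trace.1.mono_measure (restrict_face_le T i)
  set g := trace T (v - meanProj T v) with hg
  have h1 : faceInner T i q (fun x => faceBubble T i x * D.liftFace i g x) =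
      faceInner T i q (trace T v) - faceInner T i q (meanProj T v) := by
    rw [D.faceInner_liftFace i htr hq, hg, faceInner_trace_sub i hv (memH1_of_contDiff hm) hq1,
      faceInner_trace_of_contDiff i hm hq1]
  rw [faceInner_trace_sub i hv (memH1_of_contDiff (contDiff_fortin D α v)) hq1,
    faceInner_trace_of_contDiff i (contDiff_fortin D α v) hq1]
  have h2 : faceInner T i q (fortin α B D v) = faceInner T i q
      (fun x => meanProj T v x + faceBubble T i x * D.liftFace i g x) := by
    refine faceInner_congr T i (fun _ _ => rfl) fun x hx => ?_
    rw [fortin_eq, preFortin_eq]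
    simp only [Pi.add_apply, Finset.sum_apply, elemBubble_of_mem_face T i hx, zero_mul, add_zero]
    rw [Finset.sum_eq_single i, modFaceBubble_of_mem_face T i α hx]
    · intro k _ hk
      rw [modFaceBubble, faceBubble_of_mem_face T i hk hx, mul_zero, zero_mul]
    · intro h
      exact absurd (Finset.mem_univ i) h
  have hl := continuous_of_mem_polyFun (D.liftFace_mem i g)
  have h3 : faceInner T i q (fun x => meanProj T v x + faceBubble T i x * D.liftFace i g x) =
      faceInner T i q (meanProj T v) +
        faceInner T i q (fun x => faceBubble T i x * D.liftFace i g x) := by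
    simp only [faceInner, mul_add]
    exact integral_add
      (integrable_mul_of_memLp (hq1.continuous.memLp_face T i) (hm.continuous.memLp_face T i))
      (integrable_mul_of_memLp (hq1.continuous.memLp_face T i)
        (((continuous_faceBubble T i).mul hl).memLp_face T i))
  rw [h2, h3, h1]
  ring

theorem elemInner_sub_fortin (α : ℝ) {v : Euc (m + 1) → ℝ} (hv : MemH1 T v)
    {q : Euc (m + 1) → ℝ} (hq : q ∈ polyFun (m + 1) p) :
    elemInner T q (v - fortin α B D v) = 0 := by
  have hqc := continuous_of_mem_polyFun hq
  have hr := hv.1.sub ((contDiff_preFortin D α v).continuous.memLp_elem T)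
  have h1 := D.elemInner_liftElem hr hq
  rw [fortin_eq, ← sub_sub]
  set r := v - preFortin α B D v
  have h2 : elemInner T q (r - fun x => elemBubble T x * D.liftElem r x) = elemInner T q r -
      elemInner T q (fun x => elemBubble T x * D.liftElem r x) := by
    simp only [elemInner, Pi.sub_apply, mul_sub]
    exact integral_sub (integrable_mul_of_memLp (hqc.memLp_elem T) hr)
      (integrable_mul_of_memLp (hqc.memLp_elem T)
        ((contDiff_elemTerm D r).continuous.memLp_elem T))
  rw [h2, h1, sub_self]

theorem integral_weakGrad_sub_fortin (α : ℝ) {v : Euc (m + 1) → ℝ} (hv : MemH1 T v)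
    {σ : Fin (m + 1) → Euc (m + 1) → ℝ} (hσ : ∀ k, σ k ∈ polyFun (m + 1) p) :
    ∫ x in elem T, ∑ k, σ k x * weakGrad T (v - fortin α B D v) x k = 0 := by
  have hd := hv.sub (memH1_of_contDiff (contDiff_fortin D α v))
  rw [integral_finsetSum _ fun k _ => integrable_mul_of_memLp
    ((continuous_of_mem_polyFun (hσ k)).memLp_elem T) (memLp_coordinate hd.weakGrad_spec.1 k)]
  refine Finset.sum_eq_zero fun k _ => ?_
  have h := hd.integral_weakGrad_eq_zero
    (fun i q hq => faceInner_trace_sub_fortin D α hv i hq)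
    (fun q hq => elemInner_sub_fortin D α hv hq) (hσ k) (EuclideanSpace.single k 1)
  simpa [EuclideanSpace.inner_single_left] using h

end Lifting

/-! ### Assembling the norm bound -/

section Bound

variable {n : ℕ} {T : Simplex n}

theorem l2norm_add_le {E : Type*} [NormedAddCommGroup E] {f g : Euc n → E}
    (hf : MemLp f 2 (volume.restrict (elem T))) (hg : MemLp g 2 (volume.restrict (elem T))) :
    l2norm T (f + g) ≤ l2norm T f + l2norm T g :=
  toReal_eLpNorm_add_le hf hg

/-- The sum `‖f‖_T + α ‖∇f‖_T` for a continuously differentiable function. -/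
noncomputable def sumNorm (T : Simplex n) (α : ℝ) (f : Euc n → ℝ) : ℝ :=
  l2norm T f + α * l2norm T (gradient f)

theorem gradient_add_of_contDiff {f g : Euc n → ℝ} (hf : ContDiff ℝ 1 f) (hg : ContDiff ℝ 1 g) :
    gradient (f + g) = gradient f + gradient g := by
  funext x
  rw [Pi.add_apply, gradient, gradient, gradient, fderiv_add (hf.differentiable one_ne_zero x)
    (hg.differentiable one_ne_zero x), map_add]

theorem sumNorm_add_le {α : ℝ} (hα : 0 ≤ α) {f g : Euc n → ℝ} (hf : ContDiff ℝ 1 f)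
    (hg : ContDiff ℝ 1 g) : sumNorm T α (f + g) ≤ sumNorm T α f + sumNorm T α g := by
  have h1 := l2norm_add_le (hf.continuous.memLp_elem T) (hg.continuous.memLp_elem T)
  have h2 := mul_le_mul_of_nonneg_left (l2norm_add_le (hf.continuous_gradient.memLp_elem T)
    (hg.continuous_gradient.memLp_elem T)) hα
  rw [← gradient_add_of_contDiff hf hg] at h2
  simp only [sumNorm]
  linarith

theorem gradient_const_fun (c : ℝ) : gradient (fun _ : Euc n => c) = 0 := by
  funext x
  simp [gradient]

theorem l2norm_zero {E : Type*} [NormedAddCommGroup E] : l2norm T (0 : Euc n → E) = 0 := by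
  simp [l2norm]

theorem sumNorm_const (α c : ℝ) : sumNorm T α (fun _ => c) = l2norm T fun _ => c := by
  rw [sumNorm, gradient_const_fun, l2norm_zero, mul_zero, add_zero]

theorem sumNorm_sum_le {α : ℝ} (hα : 0 ≤ α) {ι : Type*} (s : Finset ι) {f : ι → Euc n → ℝ}
    (hf : ∀ i, ContDiff ℝ 1 (f i)) : sumNorm T α (∑ i ∈ s, f i) ≤ ∑ i ∈ s, sumNorm T α (f i) := by
  classical
  induction s using Finset.induction_on with
  | empty =>
    have h0 : (0 : Euc n → ℝ) = fun _ => 0 := rfl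
    rw [Finset.sum_empty, Finset.sum_empty, h0, sumNorm_const, ← h0, l2norm_zero]
  | insert a s ha ih =>
    rw [Finset.sum_insert ha, Finset.sum_insert ha]
    exact (sumNorm_add_le hα (hf a) (contDiff_finset_sum s hf)).trans (by linarith)

theorem normα_le_sumNorm {α : ℝ} (hα : 0 ≤ α) {f : Euc n → ℝ} (hf : ContDiff ℝ 1 f) :
    normα T α f ≤ sumNorm T α f := by
  have h : l2norm T (weakGrad T f) = l2norm T (gradient f) := by
    rw [l2norm, l2norm, eLpNorm_congr_ae (weakGrad_contDiff_ae_eq hf)]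
  have h1 := l2norm_nonneg T f
  have h2 := mul_nonneg hα (l2norm_nonneg T (gradient f))
  refine Real.sqrt_le_iff.2 ⟨add_nonneg h1 h2, ?_⟩
  rw [h, sumNorm]
  nlinarith

theorem l2norm_le_sumNorm {α : ℝ} (hα : 0 ≤ α) (f : Euc n → ℝ) : l2norm T f ≤ sumNorm T α f :=
  le_add_of_nonneg_right (mul_nonneg hα (l2norm_nonneg T _))

theorem l2norm_le_normα (α : ℝ) (v : Euc n → ℝ) : l2norm T v ≤ normα T α v :=
  Real.le_sqrt_of_sq_le (le_add_of_nonneg_right (by positivity))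

theorem l2norm_meanProj_le {v : Euc n → ℝ} (hv : MemLp v 2 (volume.restrict (elem T))) :
    l2norm T (meanProj T v) ≤ l2norm T v := by
  have hT := vol_pos T
  have h1 := abs_integral_mul_le ((continuous_const (y := (1 : ℝ))).memLp_elem T) hv
  have h2 := toReal_eLpNorm_sq ((continuous_const (y := (1 : ℝ))).memLp_elem T)
  have h3 : ∫ _ in elem T, ‖(1 : ℝ)‖ ^ 2 = vol T := by simp [vol]
  have h4 := pow_le_pow_left₀ (abs_nonneg _) h1 2
  simp only [one_mul] at h4
  rw [sq_abs, mul_pow, h2, h3] at h4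
  have h5 : l2norm T (meanProj T v) ^ 2 ≤ ((vol T)⁻¹ * ∫ x in elem T, v x) ^ 2 * vol T := by
    have h6 := l2norm_sq_le_of_bound (T := T)
      (continuous_const (y := (vol T)⁻¹ * ∫ x in elem T, v x)) fun _ _ => le_rfl
    rw [Real.norm_eq_abs, sq_abs] at h6
    have h7 : meanProj T v = fun _ => (vol T)⁻¹ * ∫ x in elem T, v x := by
      funext x
      rw [meanProj, setAverage_eq, smul_eq_mul, vol]
    rw [h7]
    exact h6
  refine abs_le_of_sq_le_sq' (h5.trans ?_) (l2norm_nonneg T v) |>.2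
  calc ((vol T)⁻¹ * ∫ x in elem T, v x) ^ 2 * vol T
      = (vol T)⁻¹ * (∫ x in elem T, v x) ^ 2 := by field_simp
    _ ≤ (vol T)⁻¹ * (vol T * l2norm T v ^ 2) := mul_le_mul_of_nonneg_left h4 (by positivity)
    _ = l2norm T v ^ 2 := by field_simp

theorem normα_sub_meanProj_le (α : ℝ) {v : Euc n → ℝ} (hv : MemH1 T v) :
    normα T α (v - meanProj T v) ≤ 2 * normα T α v := by
  have hm := contDiff_meanProj T v
  have h1 : l2norm T (v - meanProj T v) ≤ 2 * l2norm T v := by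
    have := toReal_eLpNorm_sub_le hv.1 (hm.continuous.memLp_elem T)
    have h2 := l2norm_meanProj_le hv.1
    simp only [l2norm] at h2 ⊢
    linarith
  have h2 : l2norm T (weakGrad T (v - meanProj T v)) = l2norm T (weakGrad T v) := by
    rw [l2norm, l2norm]
    congr 1
    refine eLpNorm_congr_ae ?_
    filter_upwards [weakGrad_sub_ae_eq hv (memH1_of_contDiff hm),
      weakGrad_contDiff_ae_eq (T := T) hm] with x hx hx'
    have h0 : gradient (meanProj T v) = 0 := gradient_const_fun _
    rw [hx, Pi.sub_apply, hx', h0, Pi.zero_apply, sub_zero]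
  have h3 : 0 ≤ normα T α v := Real.sqrt_nonneg _
  refine Real.sqrt_le_iff.2 ⟨by positivity, ?_⟩
  rw [h2, mul_pow, normα_sq]
  have h4 := pow_le_pow_left₀ (l2norm_nonneg T _) h1 2
  have h5 : 0 ≤ α ^ 2 * l2norm T (weakGrad T v) ^ 2 := by positivity
  linarith [mul_pow 2 (l2norm T v) 2]

theorem exists_normα_fortin_le (m p : ℕ) {γ κ : ℝ} (M : ℝ) (hγ : 0 < γ) (hκ : 0 ≤ κ) :
    ∃ C, 0 < C ∧ ∀ T : Simplex (m + 1), ShapeRegular T γ → ∀ α, 0 < α → α ≤ κ * size T →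
    ∀ B : PolyBases T p, B.Stable M → ∀ (D : DualSystem B) (v : Euc (m + 1) → ℝ), MemH1 T v →
    normα T α (fortin α B D v) ≤ C * normα T α v := by
  obtain ⟨K, hK, hface⟩ := exists_face_estimate m p M hγ hκ
  obtain ⟨L, hL, helem⟩ := exists_elem_estimate (m + 1) p hγ hκ (by omega)
  -- The mean contributes `1`. Each of the `m + 2` faces contributes two terms of `sumNorm`, both at
  -- most `K` times the norm of `v` minus its mean, which costs a factor two.
  set A : ℝ := 1 + (m + 2) * (4 * K) with hA
  have hA0 : 0 < A := by positivity
  refine ⟨A + 2 * L * (1 + A), by positivity, fun T hT α hα hακ B hB D v hv => ?_⟩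
  set N := normα T α v with hN
  have hm := contDiff_meanProj T v
  have hv0 := hv.sub (memH1_of_contDiff hm)
  have hN0 := normα_sub_meanProj_le α hv
  have hlN := l2norm_le_normα (T := T) α v
  have hpc := contDiff_preFortin D α v
  have hr := hv.1.sub (hpc.continuous.memLp_elem T)
  have hE : ∀ i, sumNorm T α (fun x =>
      modFaceBubble T α i x * D.liftFace i (trace T (v - meanProj T v)) x) ≤ 4 * K * N := fun i => by
    have htr := hv0.isTrace_trace.1.mono_measure (restrict_face_le T i)
    obtain ⟨h1, h2⟩ := hface T hT α hα hακ i _ _ (D.liftFace_mem i _) hv0 (hB i _)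
      (D.faceInner_liftFace i htr (D.liftFace_mem i _))
    have h3 := mul_le_mul_of_nonneg_left hN0 hK.le
    rw [sumNorm]
    linarith
  have hpre : sumNorm T α (preFortin α B D v) ≤ A * N := by
    rw [preFortin_eq]
    refine (sumNorm_add_le hα.le hm
      (contDiff_finset_sum _ fun i => contDiff_faceTerm D α i _)).trans ?_
    have h1 := (sumNorm_sum_le (T := T) hα.le Finset.univ fun i => contDiff_faceTerm D α i _).trans
      (Finset.sum_le_sum fun i _ => hE i)
    have h2 : sumNorm T α (meanProj T v) ≤ N :=
      (sumNorm_const α _).le.trans ((l2norm_meanProj_le hv.1).trans hlN)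
    rw [Finset.sum_const, Finset.card_univ, Fintype.card_fin, nsmul_eq_mul] at h1
    push_cast at h1
    rw [hA]
    linarith
  have hrN : l2norm T (v - preFortin α B D v) ≤ (1 + A) * N := by
    have h1 : l2norm T (v - preFortin α B D v) ≤ l2norm T v + l2norm T (preFortin α B D v) :=
      toReal_eLpNorm_sub_le hv.1 (hpc.continuous.memLp_elem T)
    have h2 := l2norm_le_sumNorm (T := T) hα.le (preFortin α B D v)
    linarith
  obtain ⟨h1, h2⟩ := helem T hT α hα hακ _ _ (D.liftElem_mem _) hr
    (D.elemInner_liftElem hr (D.liftElem_mem _))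
  refine (normα_le_sumNorm hα.le (contDiff_fortin D α v)).trans ?_
  rw [fortin_eq]
  refine (sumNorm_add_le hα.le hpc (contDiff_elemTerm D _)).trans ?_
  have h3 := mul_le_mul_of_nonneg_left hrN hL.le
  have h4 : sumNorm T α (fun x => elemBubble T x * D.liftElem (v - preFortin α B D v) x) ≤
      2 * L * ((1 + A) * N) := by
    rw [sumNorm]; linarith
  linarith

end Bound

end Fortin

theorem theorem3p5 (n p : ℕ) (hn : 1 ≤ n) :
    -- the families of functions exist, with stability constant one, and each choice of bases
    -- has a finite stability constant and admits dual functions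
    (∀ T : Simplex n, (∃ B : PolyBases T p, B.Stable 1) ∧
      ∀ B : PolyBases T p, (∃ M : ℝ, B.Stable M) ∧ Nonempty (DualSystem B)) ∧
    ∀ γ κ M : ℝ, 0 < γ → ∃ C : ℝ, 0 < C ∧
      ∀ T : Simplex n, ShapeRegular T γ →
      ∀ α : ℝ, 0 < α → α ≤ κ * size T →
      ∀ B : PolyBases T p, B.Stable M → ∀ D : DualSystem B,
        -- idempotent on constants
        (∀ v ∈ polyFun n 0, fortin α B D v = v) ∧
        ∀ v : Euc n → ℝ, MemH1 T v →
          -- values in the discrete space, a subspace of `H¹(T)`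
          fortin α B D v ∈ discreteSpace α B ∧
          MemH1 T (fortin α B D v) ∧
          -- robust boundedness
          normα T α (fortin α B D v) ≤ C * normα T α v ∧
          -- moments on the boundary against face-wise polynomials
          (∀ σ : Fin (n + 1) → Euc n → ℝ, (∀ i, σ i ∈ polyFun n p) →
            ∑ i, faceInner T i (σ i) (trace T (v - fortin α B D v)) = 0) ∧
          -- moments on the element against polynomials
          (∀ u ∈ polyFun n p, elemInner T u (v - fortin α B D v) = 0) ∧
          -- moments of the gradient against vector-valued polynomials
          (∀ σ : Fin n → Euc n → ℝ, (∀ k, σ k ∈ polyFun n p) →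
            ∫ x in elem T, ∑ k, σ k x * weakGrad T (v - fortin α B D v) x k = 0) := by
  obtain ⟨m, rfl⟩ : ∃ m, n = m + 1 := ⟨n - 1, by omega⟩
  refine ⟨fun T => ⟨exists_stable_one T, fun B => ⟨exists_stable B, nonempty_dualSystem B⟩⟩,
    fun γ κ M hγ => ?_⟩
  -- The sign of `κ` is not prescribed, so the estimate is applied with its absolute value.
  obtain ⟨C, hC, h⟩ := exists_normα_fortin_le m p M hγ (abs_nonneg κ)
  refine ⟨C, hC, fun T hT α hα hακ B hB D =>
    ⟨fun v hv => fortin_of_const D α hv, fun v hv => ⟨fortin_mem_discreteSpace D α v,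
      memH1_of_contDiff (contDiff_fortin D α v), ?_, fun σ hσ => ?_,
      fun u hu => elemInner_sub_fortin D α hv hu,
      fun σ hσ => integral_weakGrad_sub_fortin D α hv hσ⟩⟩⟩
  · exact h T hT α hα
      (hακ.trans (mul_le_mul_of_nonneg_right (le_abs_self κ) (size_nonneg T))) B hB D v hv
  · exact Finset.sum_eq_zero fun i _ => faceInner_trace_sub_fortin D α hv i (hσ i)
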